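/- Let $(M,g,H)$ be a generalized Riemannian manifold: a smooth manifold with a Riemannian metric $g$ and a closed $3$-form $H$. Let a compact connected Lie group $G$ act smoothly and freely on $M$ preserving $g$ and $H$; let $V_a$ be the fundamental vector fields of a basis $e_a$ of the Lie algebra $\mathfrak g$, and let $\pi:M\to M/G$ be the projection onto the quotient manifold. Let $\xi:\mathfrak g\to\Omega^1(M)$, $e_a\mapsto\xi_a$, be a $G$-equivariant linear map such that $H+\phi^a\xi_a$ is equivariantly closed, i.e. $d\xi_a=\iota_{V_a}H$ and $\xi_a(V_b)+\xi_b(V_a)=0$. On $TM\oplus T^*M$ use the pairing $\langle X+\xi,Y+\eta\rangle=\xi(Y)+\eta(X)$ and the bracket $[X+\xi,Y+\eta]_H=[X,Y]+\mathcal L_X\eta-\iota_Yd\xi+\iota_Y\iota_XH$. Let $K$ be the subbundle spanned by the $V_a+\xi_a$, let $E^{red}=(K^\perp/K)/G$ be the reduced Courant algebroid over $M/G$ (its bracket is induced by $[\cdot,\cdot]_H$ on invariant sections of $K^\perp$), and put $$\tau_\pm=\{Y\in TM : g(Y,V_a)\pm\xi_a(Y)=0\ \text{for all } a\}.$$ Then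 $d\pi$ maps each fibre of $\tau_+$, and each fibre of $\tau_-$, isomorphically onto the tangent space of $M/G$. For a vector field $X$ on $M/G$ let $X^\pm$ be its lift to $\tau_\pm$ and $e_\pm(X)=X^\pm\pm g(X^\pm)$; these sections represent the $\pm$-eigenbundles of the reduced generalized metric on $E^{red}$. 1. There is a (unique) Riemannian metric $\tilde g$ on $M/G$ obtained by restricting $g$ to $\tau_+$ or, equivalently, to $\tau_-$. 2. There is a connection $\hat\nabla$ on $T(M/G)$, the reduced $+$-Bismut connection, such that for all smooth vector fields $X,Y$ the component of $[e_-(X),e_+(Y)]_H$ in the $+$-eigenbundle of $E^{red}$ is $e_+(\hat\nabla_XY)$. Every such $\hat\nabla$ is compatible with $\tilde g$. 3. The torsion of $\hat\nabla$ is a smooth $3$-form $\tilde H$ on $M/G$, the reduced NS-flux: $$\tilde H(X,Y,Z)=\tilde g(\hat\nabla_XY-\hat\nabla_YX-[X,Y],Z).$$ It is also the curvature of the metric splitting $s(X)=\tfrac12\big(e_+(X)+e_-(X)\big)$ of $E^{red}$, that is, $\tilde H(X,Y,Z)=\langle[s(X),s(Y)]_H,s(Z)\rangle$. 4. Let $\theta_+$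 be the principal connection form with kernel $\tau_+$ and $\theta_+(V_a)=e_a$ (it exists and is unique), and let $\Omega_+=\Omega_+^ae_a$ be its curvature, the horizontal part of $d\theta_+$. Modelling $T(M/G)$ on $\tau_+$, $$\tilde H=(H+\Omega_+^a\wedge\xi_a)|_{\tau_+},$$ that is, for all $x\in M$ and $u,v,w\in(\tau_+)_x$, $$\tilde H(d\pi\,u,d\pi\,v,d\pi\,w)=H(u,v,w)+\sum_a\big(\Omega_+^a(u,v)\,\xi_a(w)+\Omega_+^a(v,w)\,\xi_a(u)-\Omega_+^a(u,w)\,\xi_a(v)\big).$$ -/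

import Mathlib

open Set Bundle Manifold VectorField
open scoped Manifold ContDiff Topology

noncomputable section

namespace CourantReduction

/-! ### Differential forms on a manifold without boundary modelled on `E` -/

section Forms

variable {E : Type*} [NormedAddCommGroup E] [NormedSpace ℝ E]
  {M : Type*} [TopologicalSpace M] [ChartedSpace E M]

variable (E M) in
/-- Vector fields. -/
abbrev VField : Type _ := Π x : M, TangentSpace 𝓘(ℝ, E) x

variable (E M) in
/-- Fields of alternating `k`-forms. -/
abbrev Form (k : ℕ) : Type _ := Π x : M, TangentSpace 𝓘(ℝ, E) x [⋀^Fin k]→L[ℝ] ℝ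

variable (E M) in
/-- Fields of covectors. -/
abbrev CovField : Type _ := Π x : M, TangentSpace 𝓘(ℝ, E) x →L[ℝ] ℝ

/-- A smooth vector field. -/
def IsSmoothVField [IsManifold 𝓘(ℝ, E) ∞ M] (X : VField E M) : Prop :=
  ContMDiff 𝓘(ℝ, E) (𝓘(ℝ, E).prod 𝓘(ℝ, E)) ∞
    (fun x ↦ TotalSpace.mk' E x (X x) : M → TotalSpace E (TangentSpace 𝓘(ℝ, E) : M → Type _))

/-- A covector field as a field of alternating `1`-forms. -/
def covToForm (α : CovField E M) : Form E M 1 := fun x ↦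
  ContinuousAlternatingMap.ofSubsingleton ℝ (TangentSpace 𝓘(ℝ, E) x) ℝ 0 (α x)

/-- A form on the vector space `E`, as a function from `E` to alternating maps on `E`. -/
def Form.flat {k : ℕ} (σ : Form E E k) (y : E) : E [⋀^Fin k]→L[ℝ] ℝ := σ y

/-- The exterior derivative of a form on the vector space `E`. -/
def flatD {k : ℕ} (σ : Form E E k) : Form E E (k + 1) := fun y ↦
  (extDeriv (Form.flat σ) y : E [⋀^Fin (k + 1)]→L[ℝ] ℝ)

/-- The expression of a form in the chart at `x₀`: its pull-back under the inverse chart. -/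
def formInChart {k : ℕ} (σ : Form E M k) (x₀ : M) : Form E E k := fun y ↦
  (σ ((extChartAt 𝓘(ℝ, E) x₀).symm y)).compContinuousLinearMap
    (mfderiv 𝓘(ℝ, E) 𝓘(ℝ, E) (extChartAt 𝓘(ℝ, E) x₀).symm y)

/-- A form is smooth if its expressions in charts are smooth. -/
def FormSmooth {k : ℕ} (σ : Form E M k) : Prop :=
  ∀ x₀ : M, ContDiffOn ℝ ∞ (Form.flat (formInChart σ x₀)) (extChartAt 𝓘(ℝ, E) x₀).target

/-- The exterior derivative of a form, computed at `x` in the chart at `x`. -/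
def formD {k : ℕ} (σ : Form E M k) : Form E M (k + 1) := fun x ↦
  (flatD (formInChart σ x) (extChartAt 𝓘(ℝ, E) x x)).compContinuousLinearMap
    (mfderiv 𝓘(ℝ, E) 𝓘(ℝ, E) (extChartAt 𝓘(ℝ, E) x) x)

/-- The covector `v ↦ σ(u, v)`. -/
def contract₂ {x : M} (σ : TangentSpace 𝓘(ℝ, E) x [⋀^Fin 2]→L[ℝ] ℝ)
    (u : TangentSpace 𝓘(ℝ, E) x) : TangentSpace 𝓘(ℝ, E) x →L[ℝ] ℝ :=
  σ.toContinuousMultilinearMap.toContinuousLinearMap ![u, 0] 1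

/-- The covector `w ↦ σ(u, v, w)`. -/
def contract₃ {x : M} (σ : TangentSpace 𝓘(ℝ, E) x [⋀^Fin 3]→L[ℝ] ℝ)
    (u v : TangentSpace 𝓘(ℝ, E) x) : TangentSpace 𝓘(ℝ, E) x →L[ℝ] ℝ :=
  σ.toContinuousMultilinearMap.toContinuousLinearMap ![u, v, 0] 2

theorem contract₂_apply {x : M} (σ : TangentSpace 𝓘(ℝ, E) x [⋀^Fin 2]→L[ℝ] ℝ)
    (u v : TangentSpace 𝓘(ℝ, E) x) : contract₂ σ u v = σ ![u, v] := by
  change σ (Function.update ![u, 0] 1 v) = _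
  congr 1
  ext i
  fin_cases i <;> simp [Function.update]

theorem contract₃_apply {x : M} (σ : TangentSpace 𝓘(ℝ, E) x [⋀^Fin 3]→L[ℝ] ℝ)
    (u v w : TangentSpace 𝓘(ℝ, E) x) : contract₃ σ u v w = σ ![u, v, w] := by
  change σ (Function.update ![u, v, 0] 2 w) = _
  congr 1
  ext i
  fin_cases i <;> simp [Function.update]

/-! ### The generalized tangent bundle `TM ⊕ T*M` and the twisted Courant bracket -/

/-- The fibre of `TM ⊕ T*M`. -/
abbrev GenTangent (x : M) : Type _ :=
  TangentSpace 𝓘(ℝ, E) x × (TangentSpace 𝓘(ℝ, E) x →L[ℝ] ℝ)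

/-- The natural pairing `⟨X + ξ, Y + η⟩ = ξ(Y) + η(X)`. -/
def pairing {x : M} (A B : GenTangent (E := E) x) : ℝ := A.2 B.1 + B.2 A.1

/-- The Lie derivative of a covector field, `L_X η = d(η(X)) + ι_X dη`. -/
def lieDerivCov (X : VField E M) (η : CovField E M) : CovField E M := fun x ↦
  mvfderiv 𝓘(ℝ, E) (fun y ↦ η y (X y)) x + contract₂ (formD (covToForm η) x) (X x)

/-- The `H`-twisted Courant bracket
`[X + ξ, Y + η]_H = [X, Y] + L_X η - ι_Y dξ + ι_Y ι_X H`. -/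
def courantBracket (H : Form E M 3) (A B : Π x : M, GenTangent (E := E) x) :
    Π x : M, GenTangent (E := E) x := fun x ↦
  (mlieBracket 𝓘(ℝ, E) (fun y ↦ (A y).1) (fun y ↦ (B y).1) x,
    lieDerivCov (fun y ↦ (A y).1) (fun y ↦ (B y).2) x
      - contract₂ (formD (covToForm fun y ↦ (A y).2) x) (B x).1
      + contract₃ (H x) (A x).1 (B x).1)

end Forms

variable {E : Type*} [NormedAddCommGroup E] [NormedSpace ℝ E]
  {M : Type*} [TopologicalSpace M] [ChartedSpace E M]

/-- Smooth Riemannian metrics on `M`. -/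
abbrev RMetric (E M : Type*) [NormedAddCommGroup E] [NormedSpace ℝ E] [TopologicalSpace M]
    [ChartedSpace E M] [IsManifold 𝓘(ℝ, E) ∞ M] : Type _ :=
  ContMDiffRiemannianMetric 𝓘(ℝ, E) ∞ E (fun x : M ↦ TangentSpace 𝓘(ℝ, E) x)

/-- Connections on `TM`. -/
abbrev AffineConnection (E M : Type*) [NormedAddCommGroup E] [NormedSpace ℝ E]
    [TopologicalSpace M] [ChartedSpace E M] [IsManifold 𝓘(ℝ, E) ∞ M] : Type _ :=
  CovariantDerivative 𝓘(ℝ, E) E (fun x : M ↦ TangentSpace 𝓘(ℝ, E) x)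

/-! ### Group actions -/

section Action

variable {EG : Type*} [NormedAddCommGroup EG] [NormedSpace ℝ EG]
  {G : Type*} [TopologicalSpace G] [ChartedSpace EG G] [Group G] [MulAction G M]

/-- The differential at `x` of the action of `a`. -/
def actDeriv (E : Type*) [NormedAddCommGroup E] [NormedSpace ℝ E]
    {M : Type*} [TopologicalSpace M] [ChartedSpace E M] {G : Type*} [Group G] [MulAction G M]
    (a : G) (x : M) : TangentSpace 𝓘(ℝ, E) x →L[ℝ] TangentSpace 𝓘(ℝ, E) (a • x) :=
  mfderiv 𝓘(ℝ, E) 𝓘(ℝ, E) (fun y : M ↦ a • y) x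

/-- The fundamental vector fields: `fundMap x e` is the value at `x` of the vector field generated
by `e` in the Lie algebra, i.e. the image of `e` under the differential at `1` of `a ↦ a • x`. -/
def fundMap (x : M) :
    GroupLieAlgebra 𝓘(ℝ, EG) G →L[ℝ] TangentSpace 𝓘(ℝ, E) x :=
  mfderiv 𝓘(ℝ, EG) 𝓘(ℝ, E) (fun a : G ↦ a • x) 1

variable (EG) in
/-- The adjoint action, i.e. the differential at `1` of `h ↦ a h a⁻¹`. -/
def adjoint (a : G) : GroupLieAlgebra 𝓘(ℝ, EG) G →L[ℝ] GroupLieAlgebra 𝓘(ℝ, EG) G :=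
  mfderiv 𝓘(ℝ, EG) 𝓘(ℝ, EG) (fun h : G ↦ a * h * a⁻¹) 1

/-- The projection of `M` onto the orbit space `M/G`. -/
abbrev orbitProj (G M : Type*) [Group G] [MulAction G M] : M → MulAction.orbitRel.Quotient G M := Quotient.mk (MulAction.orbitRel G M)

variable (G) in
/-- The metric is invariant under `G`. -/
def MetricInvariant [IsManifold 𝓘(ℝ, E) ∞ M] (g : RMetric E M) : Prop :=
  ∀ (a : G) (x : M) (u v : TangentSpace 𝓘(ℝ, E) x),
    g.inner (a • x) (actDeriv E a x u) (actDeriv E a x v) = g.inner x u v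

variable (G) in
/-- The form is invariant under `G`. -/
def FormInvariant {k : ℕ} (σ : Form E M k) : Prop :=
  ∀ (a : G) (x : M), (σ (a • x)).compContinuousLinearMap (actDeriv E a x) = σ x

/-- `φ ↦ H + ξ_φ` is a closed equivariant extension of the `3`-form `H` in the Cartan model: `ξ` is
a smooth `G`-equivariant linear map from the Lie algebra to `1`-forms, and
`(d - ι_φ)(H + ξ_φ) = dH + (dξ_φ - ι_φ H) - ξ_φ(V_φ)` vanishes, degree by degree, for every `φ`. -/
structure IsClosedEquivariantExtension (H : Form E M 3)
    (ξ : GroupLieAlgebra 𝓘(ℝ, EG) G →ₗ[ℝ] CovField E M) : Prop where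
  smooth : ∀ φ, FormSmooth (covToForm (ξ φ))
  equivariant : ∀ (a : G) (φ : GroupLieAlgebra 𝓘(ℝ, EG) G) (x : M),
    (ξ (adjoint EG a φ) (a • x)).comp (actDeriv E a x) = ξ φ x
  degree_four : ∀ x, formD H x = 0
  degree_two : ∀ φ x (u v : TangentSpace 𝓘(ℝ, E) x),
    formD (covToForm (ξ φ)) x ![u, v] = H x ![fundMap x φ, u, v]
  degree_zero : ∀ φ x, ξ φ x (fundMap x φ) = 0

/-! ### The distributions `τ_±` and Courant reduction -/

variable [IsManifold 𝓘(ℝ, E) ∞ M]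

/-- For `s = ±1`, the distribution `τ_s = {u | g(u, V_a) + s ξ_a(u) = 0 for all a}`. -/
def tau (g : RMetric E M) (ξ : GroupLieAlgebra 𝓘(ℝ, EG) G →ₗ[ℝ] CovField E M) (s : ℝ) (x : M) :
    Set (TangentSpace 𝓘(ℝ, E) x) :=
  {u | ∀ e : GroupLieAlgebra 𝓘(ℝ, EG) G, g.inner x u (fundMap x e) + s * ξ e x u = 0}

/-- The fibre at `x` of the subbundle `K` generated by the `V_a + ξ_a`. -/
def subbundleK (ξ : GroupLieAlgebra 𝓘(ℝ, EG) G →ₗ[ℝ] CovField E M) (x : M) :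
    Set (GenTangent (E := E) x) :=
  range fun e : GroupLieAlgebra 𝓘(ℝ, EG) G ↦ (fundMap x e, ξ e x)

/-- `θ` is the connection form of the principal connection with horizontal distribution `τ`. -/
structure IsConnectionForm (τ : Π x : M, Set (TangentSpace 𝓘(ℝ, E) x))
    (θ : Π x : M, TangentSpace 𝓘(ℝ, E) x →L[ℝ] GroupLieAlgebra 𝓘(ℝ, EG) G) : Prop where
  vertical : ∀ x e, θ x (fundMap x e) = e
  ker_eq : ∀ x u, θ x u = 0 ↔ u ∈ τ x
  equivariant : ∀ (a : G) (x : M) (u : TangentSpace 𝓘(ℝ, E) x),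
    θ (a • x) (actDeriv E a x u) = adjoint EG a (θ x u)

/-- The coordinates on the Lie algebra with respect to a basis. -/
def coordCLM {ι : Type*} [FiniteDimensional ℝ EG]
    (b : Module.Basis ι ℝ (GroupLieAlgebra 𝓘(ℝ, EG) G)) (a : ι) :
    GroupLieAlgebra 𝓘(ℝ, EG) G →L[ℝ] ℝ :=
  LinearMap.toContinuousLinearMap (𝕜 := ℝ) (E := EG) (F' := ℝ) (b.coord a)

/-- The component `Ω^a`, with respect to a basis `b` of the Lie algebra, of the curvature of the
principal connection `θ`, i.e. the horizontal part of `dθ^a`. -/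
def curvature {ι : Type*} [FiniteDimensional ℝ EG]
    (b : Module.Basis ι ℝ (GroupLieAlgebra 𝓘(ℝ, EG) G))
    (θ : Π x : M, TangentSpace 𝓘(ℝ, E) x →L[ℝ] GroupLieAlgebra 𝓘(ℝ, EG) G) (a : ι) (x : M)
    (u v : TangentSpace 𝓘(ℝ, E) x) : ℝ :=
  formD (covToForm fun y ↦ (coordCLM b a).comp (θ y)) x
    ![u - fundMap x (θ x u), v - fundMap x (θ x v)]

/-- The value on `(u, v, w)` of the wedge product of a `2`-form and a `1`-form. -/
def wedge₂₁ {V : Type*} (Ω : V → V → ℝ) (α : V → ℝ) (u v w : V) : ℝ :=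
  Ω u v * α w + Ω v w * α u - Ω u w * α v

variable {EN : Type*} [NormedAddCommGroup EN] [NormedSpace ℝ EN]
  {N : Type*} [TopologicalSpace N] [ChartedSpace EN N] [IsManifold 𝓘(ℝ, EN) ∞ N]

/-- For `a` tangent to `N` at `p x`, the lift at `x` of `a` to `V_± ∩ K^⊥ = {u ± g(u) | u ∈ τ_±}`
(the sign being `s = ±1`): it is `u + s g(u)` where `u` is the lift of `a` to `τ_s`. Through these
lifts, `TN` is identified with the eigenbundles of the generalized metric on `E^red = K^⊥/K`. -/
def genLift (p : M → N) (g : RMetric E M)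
    (ξ : GroupLieAlgebra 𝓘(ℝ, EG) G →ₗ[ℝ] CovField E M) (s : ℝ) (x : M)
    (a : TangentSpace 𝓘(ℝ, EN) (p x)) : GenTangent (E := E) x :=
  let u : TangentSpace 𝓘(ℝ, E) x :=
    Function.invFunOn (mfderiv 𝓘(ℝ, E) 𝓘(ℝ, EN) p x) (tau g ξ s x) a
  (u, s • g.inner x u)

/-- The metric splitting `TN → E^red`, as an invariant section of `K^⊥`: it is the half sum of the
lifts to the two eigenbundles of the generalized metric. -/
def metricSplitting (p : M → N) (g : RMetric E M)
    (ξ : GroupLieAlgebra 𝓘(ℝ, EG) G →ₗ[ℝ] CovField E M) (X : VField EN N) (x : M) :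
    GenTangent (E := E) x :=
  (1 / 2 : ℝ) • (genLift p g ξ 1 x (X (p x)) + genLift p g ξ (-1) x (X (p x)))

/-- `D` is the reduced `+`-Bismut connection on `N`: modulo `K`, for all smooth vector fields `X`,
`Y` on `N`, the part in the `+`-eigenbundle of `E^red` of the reduced Courant bracket of the
`-`-lift of `X` and the `+`-lift of `Y` is the `+`-lift of `D_X Y`. -/
def IsReducedPlusBismut (p : M → N) (g : RMetric E M) (H : Form E M 3)
    (ξ : GroupLieAlgebra 𝓘(ℝ, EG) G →ₗ[ℝ] CovField E M)
    (D : AffineConnection EN N) : Prop :=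
  ∀ X Y : VField EN N, IsSmoothVField X → IsSmoothVField Y → ∀ x : M,
    ∃ w : TangentSpace 𝓘(ℝ, EN) (p x),
      courantBracket H (fun y ↦ genLift p g ξ (-1) y (X (p y)))
          (fun y ↦ genLift p g ξ 1 y (Y (p y))) x
        - (genLift p g ξ 1 x (D Y (p x) (X (p x))) + genLift p g ξ (-1) x w) ∈ subbundleK ξ x

/-- `h` is the reduced metric on `N`: it is obtained by restricting `g` to `τ_+`, and equally by
restricting `g` to `τ_-`. -/
def IsReducedMetric (p : M → N) (g : RMetric E M)
    (ξ : GroupLieAlgebra 𝓘(ℝ, EG) G →ₗ[ℝ] CovField E M) (h : RMetric EN N) : Prop :=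
  ∀ s : ℝ, s = 1 ∨ s = -1 → ∀ x, ∀ u ∈ tau g ξ s x, ∀ v ∈ tau g ξ s x,
    h.inner (p x) (mfderiv 𝓘(ℝ, E) 𝓘(ℝ, EN) p x u) (mfderiv 𝓘(ℝ, E) 𝓘(ℝ, EN) p x v)
      = g.inner x u v

/-- The connection `D` is compatible with the metric `h`. -/
def IsMetricConnection (h : RMetric EN N)
    (D : AffineConnection EN N) : Prop :=
  ∀ X Y : VField EN N, IsSmoothVField X → IsSmoothVField Y →
    ∀ (n : N) (a : TangentSpace 𝓘(ℝ, EN) n),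
      mvfderiv 𝓘(ℝ, EN) (fun m ↦ h.inner m (X m) (Y m)) n a
        = h.inner n (D X n a) (Y n) + h.inner n (X n) (D Y n a)

end Action

end CourantReduction

end

noncomputable section

namespace CourantReduction

section ChartCalculus

variable {E : Type*} [NormedAddCommGroup E] [NormedSpace ℝ E]
  {M : Type*} [TopologicalSpace M] [ChartedSpace E M]
  {F : Type*} [NormedAddCommGroup F] [NormedSpace ℝ F]

/-- The differential at `x` of the chart at `x₀`. -/
def chartPush (x₀ x : M) : TangentSpace 𝓘(ℝ, E) x →L[ℝ] E :=
  mfderiv 𝓘(ℝ, E) 𝓘(ℝ, E) (extChartAt 𝓘(ℝ, E) x₀) x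

/-- The differential at the image of `x` of the inverse of the chart at `x₀`. -/
def chartPull (x₀ x : M) : E →L[ℝ] TangentSpace 𝓘(ℝ, E) x :=
  mfderiv 𝓘(ℝ, E) 𝓘(ℝ, E) (extChartAt 𝓘(ℝ, E) x₀).symm (extChartAt 𝓘(ℝ, E) x₀ x)

/-- Smoothness at a point of a vector field. -/
def VFieldSmoothAt [IsManifold 𝓘(ℝ, E) ∞ M] (X : VField E M) (x : M) : Prop :=
  ContMDiffAt 𝓘(ℝ, E) (𝓘(ℝ, E).prod 𝓘(ℝ, E)) ∞
    (fun x ↦ TotalSpace.mk' E x (X x) : M → TotalSpace E (TangentSpace 𝓘(ℝ, E) : M → Type _)) x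

variable [IsManifold 𝓘(ℝ, E) ∞ M]

theorem isManifold_one : IsManifold 𝓘(ℝ, E) 1 M := IsManifold.of_le (n := ∞) (by norm_cast)

theorem isManifold_two : IsManifold 𝓘(ℝ, E) 2 M := IsManifold.of_le (n := ∞) (by norm_cast)

attribute [local instance] isManifold_one isManifold_two

theorem chartPush_chartPull {x₀ x : M} (hx : x ∈ (chartAt E x₀).source) (v : E) :
    chartPush x₀ x (chartPull x₀ x v) = v := by
  have h := mfderiv_extChartAt_comp_mfderivWithin_extChartAt_symm' (I := 𝓘(ℝ, E)) (x := x₀)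
    (y := x) (by simpa using hx)
  simp only [modelWithCornersSelf_coe, range_id, mfderivWithin_univ] at h
  exact DFunLike.congr_fun h v

theorem chartPull_chartPush {x₀ x : M} (hx : x ∈ (chartAt E x₀).source)
    (v : TangentSpace 𝓘(ℝ, E) x) : chartPull x₀ x (chartPush x₀ x v) = v := by
  have h := mfderivWithin_extChartAt_symm_comp_mfderiv_extChartAt' (I := 𝓘(ℝ, E)) (x := x₀)
    (y := x) (by simpa using hx)
  simp only [modelWithCornersSelf_coe, range_id, mfderivWithin_univ] at h
  exact DFunLike.congr_fun h v

theorem chartPush_self (x : M) (v : TangentSpace 𝓘(ℝ, E) x) : chartPush x x v = v := by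
  rw [chartPush, mfderiv_extChartAt_self]
  rfl

theorem chartPull_self (x : M) (v : E) : chartPull x x v = v := by
  conv_lhs => rw [← chartPush_self x (chartPull x x v)]
  exact chartPush_chartPull (mem_chart_source E x) v

theorem vfieldSmoothAt_iff {X : VField E M} {x₀ x : M} (hx : x ∈ (chartAt E x₀).source) :
    VFieldSmoothAt X x ↔ ContMDiffAt 𝓘(ℝ, E) 𝓘(ℝ, E) ∞ (fun z ↦ chartPush x₀ z (X z)) x := by
  have hb : x ∈ (trivializationAt E (TangentSpace 𝓘(ℝ, E)) x₀).baseSet := by simpa using hx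
  unfold VFieldSmoothAt
  rw [(trivializationAt E (TangentSpace 𝓘(ℝ, E)) x₀).contMDiffAt_section_iff hb]
  apply Filter.EventuallyEq.contMDiffAt_iff
  filter_upwards [(chartAt E x₀).open_source.mem_nhds hx] with z hz
  have := TangentBundle.continuousLinearMapAt_trivializationAt (I := 𝓘(ℝ, E)) (𝕜 := ℝ) hz
  rw [chartPush, ← this]
  rw [Trivialization.continuousLinearMapAt_apply, Trivialization.linearMapAt_apply]
  rw [if_pos (by simpa using hz)]

theorem mdifferentiableAt_vfield_iff {X : VField E M} {x₀ x : M}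
    (hx : x ∈ (chartAt E x₀).source) :
    MDifferentiableAt 𝓘(ℝ, E) (𝓘(ℝ, E).prod 𝓘(ℝ, E))
      (fun x ↦ TotalSpace.mk' E x (X x) : M → TotalSpace E (TangentSpace 𝓘(ℝ, E) : M → Type _)) x ↔
    MDifferentiableAt 𝓘(ℝ, E) 𝓘(ℝ, E) (fun z ↦ chartPush x₀ z (X z)) x := by
  have hb : x ∈ (trivializationAt E (TangentSpace 𝓘(ℝ, E)) x₀).baseSet := by simpa using hx
  rw [(trivializationAt E (TangentSpace 𝓘(ℝ, E)) x₀).mdifferentiableAt_section_iff _ _ hb]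
  apply Filter.EventuallyEq.mdifferentiableAt_iff
  filter_upwards [(chartAt E x₀).open_source.mem_nhds hx] with z hz
  have := TangentBundle.continuousLinearMapAt_trivializationAt (I := 𝓘(ℝ, E)) (𝕜 := ℝ) hz
  rw [chartPush, ← this]
  rw [Trivialization.continuousLinearMapAt_apply, Trivialization.linearMapAt_apply]
  rw [if_pos (by simpa using hz)]

omit [IsManifold 𝓘(ℝ, E) ∞ M] in
theorem mvfderiv_eq_fderiv {f : M → F} {x : M} (hf : MDifferentiableAt 𝓘(ℝ, E) 𝓘(ℝ, F) f x)
    (v : E) : mvfderiv 𝓘(ℝ, E) f x v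
      = fderiv ℝ (f ∘ (extChartAt 𝓘(ℝ, E) x).symm) (extChartAt 𝓘(ℝ, E) x x) v := by
  have : mfderiv 𝓘(ℝ, E) 𝓘(ℝ, F) f x
      = fderiv ℝ (f ∘ (extChartAt 𝓘(ℝ, E) x).symm) (extChartAt 𝓘(ℝ, E) x x) := by
    refine hf.mfderiv.trans ?_
    simp only [modelWithCornersSelf_coe, range_id, fderivWithin_univ]
    rfl
  simp only [mvfderiv]
  exact DFunLike.congr_fun this v

omit [IsManifold 𝓘(ℝ, E) ∞ M] in
theorem differentiableAt_comp_chart_of_mdifferentiableAt {f : M → F} {x : M} :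
    MDifferentiableAt 𝓘(ℝ, E) 𝓘(ℝ, F) f x →
      DifferentiableAt ℝ (f ∘ (extChartAt 𝓘(ℝ, E) x).symm) (extChartAt 𝓘(ℝ, E) x x) := by
  intro h
  have := (mdifferentiableAt_iff _ _).1 h
  have h2 := this.2
  simp only [modelWithCornersSelf_coe, range_id, differentiableWithinAt_univ] at h2
  exact h2

theorem lieBracketWithin_univ_eq_of_eventuallyEq {V W V' W' : E → E} {p : E}
    (hV : V =ᶠ[𝓝 p] V') (hW : W =ᶠ[𝓝 p] W') :
    lieBracketWithin ℝ V W univ p = fderiv ℝ W' p (V' p) - fderiv ℝ V' p (W' p) := by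
  rw [lieBracketWithin_univ, lieBracket_eq]
  simp only [hV.fderiv_eq, hW.fderiv_eq, hV.eq_of_nhds, hW.eq_of_nhds]

/-- The Lie bracket in terms of the components in the chart at the given point. -/
theorem mlieBracket_eq [CompleteSpace E] {X Y : VField E M} {x : M}
    (hX : MDifferentiableAt 𝓘(ℝ, E) 𝓘(ℝ, E) (fun z ↦ chartPush x z (X z)) x)
    (hY : MDifferentiableAt 𝓘(ℝ, E) 𝓘(ℝ, E) (fun z ↦ chartPush x z (Y z)) x) :
    mlieBracket 𝓘(ℝ, E) X Y x = mvfderiv 𝓘(ℝ, E) (fun z ↦ chartPush x z (Y z)) x (X x)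
      - mvfderiv 𝓘(ℝ, E) (fun z ↦ chartPush x z (X z)) x (Y x) := by
  have key (Z : VField E M) :
      mpullbackWithin 𝓘(ℝ, E) 𝓘(ℝ, E) (extChartAt 𝓘(ℝ, E) x).symm Z (range 𝓘(ℝ, E))
      =ᶠ[𝓝 (extChartAt 𝓘(ℝ, E) x x)]
      (fun z ↦ chartPush x z (Z z)) ∘ (extChartAt 𝓘(ℝ, E) x).symm := by
    filter_upwards [extChartAt_target_mem_nhds (I := 𝓘(ℝ, E)) x] with y hy
    have hy' : (extChartAt 𝓘(ℝ, E) x).symm y ∈ (chartAt E x).source := by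
      simpa using (extChartAt 𝓘(ℝ, E) x).map_target hy
    have hyy : extChartAt 𝓘(ℝ, E) x ((extChartAt 𝓘(ℝ, E) x).symm y) = y :=
      (extChartAt 𝓘(ℝ, E) x).right_inv hy
    rw [mpullbackWithin_apply]
    have h1 := mfderivWithin_extChartAt_symm_comp_mfderiv_extChartAt (I := 𝓘(ℝ, E)) hy
    have h2 := mfderiv_extChartAt_comp_mfderivWithin_extChartAt_symm (I := 𝓘(ℝ, E)) hy
    rw [ContinuousLinearMap.inverse_eq h1 h2]
    rfl
  have hinv (v : E) : (mfderiv 𝓘(ℝ, E) 𝓘(ℝ, E) (extChartAt 𝓘(ℝ, E) x) x).inverse v = v := by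
    rw [mfderiv_extChartAt_self]
    exact DFunLike.congr_fun (ContinuousLinearMap.inverse_id (R := ℝ) (M := E)) _
  rw [← mlieBracketWithin_univ, mlieBracketWithin_apply]
  refine (hinv _).trans ?_
  simp only [modelWithCornersSelf_coe, range_id, preimage_univ, inter_univ] at key ⊢
  refine (lieBracketWithin_univ_eq_of_eventuallyEq (key X) (key Y)).trans ?_
  refine Eq.trans ?_ (congrArg₂ (· - ·) (mvfderiv_eq_fderiv hY _) (mvfderiv_eq_fderiv hX _)).symm
  have hv (Z : VField E M) (z : M) (hz : z = x) : chartPush x z (Z z) = (Z x : E) := by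
    subst hz
    exact chartPush_self _ _
  exact congrArg₂ (· - ·) (congrArg _ (hv X _ (extChartAt_to_inv x)))
    (congrArg _ (hv Y _ (extChartAt_to_inv x)))

end ChartCalculus

section TensorFields

theorem contMDiffAt_of_injective {E : Type*} [NormedAddCommGroup E] [NormedSpace ℝ E]
    {M : Type*} [TopologicalSpace M] [ChartedSpace E M]
    {F V ι : Type*} [NormedAddCommGroup F] [NormedSpace ℝ F] [FiniteDimensional ℝ F]
    [NormedAddCommGroup V] [NormedSpace ℝ V] [Finite ι] (T : V →ₗ[ℝ] ι → F)
    (hT : Function.Injective T) {f : M → V} {x : M} {n : WithTop ℕ∞}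
    (hf : ∀ i, ContMDiffAt 𝓘(ℝ, E) 𝓘(ℝ, F) n (fun z ↦ T (f z) i) x) :
    ContMDiffAt 𝓘(ℝ, E) 𝓘(ℝ, V) n f x := by
  have := Fintype.ofFinite ι
  obtain ⟨S, hS⟩ := T.exists_leftInverse_of_injective (LinearMap.ker_eq_bot.2 hT)
  have h1 : ContMDiffAt 𝓘(ℝ, E) 𝓘(ℝ, ι → F) n (fun z ↦ T (f z)) x :=
    contMDiffAt_pi_space.2 hf
  have h2 := (LinearMap.toContinuousLinearMap S).contMDiff.contMDiffAt.comp x h1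
  refine h2.congr_of_eventuallyEq (Filter.Eventually.of_forall fun z ↦ ?_)
  exact (DFunLike.congr_fun hS (f z)).symm

theorem contMDiffAt_clm_of_apply {E : Type*} [NormedAddCommGroup E] [NormedSpace ℝ E]
    {M : Type*} [TopologicalSpace M] [ChartedSpace E M]
    {F V : Type*} [NormedAddCommGroup F] [NormedSpace ℝ F] [FiniteDimensional ℝ F]
    [NormedAddCommGroup V] [NormedSpace ℝ V] [FiniteDimensional ℝ V]
    {f : M → V →L[ℝ] F} {x : M} {n : WithTop ℕ∞}
    (hf : ∀ v, ContMDiffAt 𝓘(ℝ, E) 𝓘(ℝ, F) n (fun z ↦ f z v) x) :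
    ContMDiffAt 𝓘(ℝ, E) 𝓘(ℝ, V →L[ℝ] F) n f x := by
  let b := Module.finBasis ℝ V
  let T : (V →L[ℝ] F) →ₗ[ℝ] Fin (Module.finrank ℝ V) → F :=
    { toFun := fun g i ↦ g (b i)
      map_add' := fun _ _ ↦ rfl
      map_smul' := fun _ _ ↦ rfl }
  refine contMDiffAt_of_injective T (fun g g' h ↦ ?_) (fun i ↦ hf (b i))
  apply ContinuousLinearMap.coe_injective
  exact b.ext fun i ↦ congrFun h i

theorem contMDiffAt_alternating_of_apply {E : Type*} [NormedAddCommGroup E] [NormedSpace ℝ E]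
    {M : Type*} [TopologicalSpace M] [ChartedSpace E M]
    {V : Type*} [NormedAddCommGroup V] [NormedSpace ℝ V] [FiniteDimensional ℝ V] {k : ℕ}
    {f : M → V [⋀^Fin k]→L[ℝ] ℝ} {x : M} {n : WithTop ℕ∞}
    (hf : ∀ v, ContMDiffAt 𝓘(ℝ, E) 𝓘(ℝ, ℝ) n (fun z ↦ f z v) x) :
    ContMDiffAt 𝓘(ℝ, E) 𝓘(ℝ, V [⋀^Fin k]→L[ℝ] ℝ) n f x := by
  let b := Module.finBasis ℝ V
  let T : (V [⋀^Fin k]→L[ℝ] ℝ) →ₗ[ℝ] (Fin k → Fin (Module.finrank ℝ V)) → ℝ :=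
    { toFun := fun g i ↦ g (fun j ↦ b (i j))
      map_add' := fun _ _ ↦ rfl
      map_smul' := fun _ _ ↦ rfl }
  refine contMDiffAt_of_injective T (fun g g' h ↦ ?_) (fun i ↦ hf _)
  apply ContinuousAlternatingMap.toAlternatingMap_injective
  refine AlternatingMap.coe_multilinearMap_injective ?_
  exact Module.Basis.ext_multilinear (fun _ ↦ b) fun i ↦ congrFun h i

variable {E : Type*} [NormedAddCommGroup E] [NormedSpace ℝ E]
  {M : Type*} [TopologicalSpace M] [ChartedSpace E M]
  {F : Type*} [NormedAddCommGroup F] [NormedSpace ℝ F]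
  [IsManifold 𝓘(ℝ, E) ∞ M]

attribute [local instance] isManifold_one isManifold_two

theorem IsSmoothVField.contMDiffAt_push {X : VField E M} (hX : IsSmoothVField X) {x₀ x : M}
    (hx : x ∈ (chartAt E x₀).source) :
    ContMDiffAt 𝓘(ℝ, E) 𝓘(ℝ, E) ∞ (fun z ↦ chartPush x₀ z (X z)) x :=
  (vfieldSmoothAt_iff hx).1 (hX x)

theorem isSmoothVField_of_push {X : VField E M}
    (h : ∀ x, ContMDiffAt 𝓘(ℝ, E) 𝓘(ℝ, E) ∞ (fun z ↦ chartPush x z (X z)) x) :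
    IsSmoothVField X := fun x ↦ (vfieldSmoothAt_iff (mem_chart_source E x)).2 (h x)

theorem exists_contMDiff_eventuallyEq_one [FiniteDimensional ℝ E] [T2Space M] {x : M} {s : Set M}
    (hs : s ∈ 𝓝 x) : ∃ χ : M → ℝ, ContMDiff 𝓘(ℝ, E) 𝓘(ℝ, ℝ) ∞ χ ∧ (∀ᶠ z in 𝓝 x, χ z = 1) ∧
      tsupport χ ⊆ s := by
  obtain ⟨f, -, hf⟩ := (SmoothBumpFunction.nhds_basis_tsupport (I := 𝓘(ℝ, E)) x).mem_iff.1 hs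
  exact ⟨f, f.contMDiff, f.eventuallyEq_one, hf⟩

/-- Vector fields that are constant in a chart near a given point extend to the manifold. -/
theorem exists_isSmoothVField_eq_chartPull [FiniteDimensional ℝ E] [T2Space M] {x₀ x₁ : M}
    (h : x₁ ∈ (chartAt E x₀).source) (v : E) :
    ∃ V : VField E M, IsSmoothVField V ∧ ∀ᶠ x in 𝓝 x₁, V x = chartPull x₀ x v := by
  obtain ⟨χ, hχ, hχ1, hχs⟩ := exists_contMDiff_eventuallyEq_one (E := E)
    ((chartAt E x₀).open_source.mem_nhds h)
  refine ⟨fun x ↦ χ x • chartPull x₀ x v, fun x ↦ ?_, ?_⟩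
  · by_cases hx : x ∈ tsupport χ
    · refine (vfieldSmoothAt_iff (hχs hx)).2 ?_
      have : ContMDiffAt 𝓘(ℝ, E) 𝓘(ℝ, E) ∞ (fun z ↦ χ z • v) x :=
        (hχ x).smul contMDiffAt_const
      refine this.congr_of_eventuallyEq ?_
      filter_upwards [(chartAt E x₀).open_source.mem_nhds (hχs hx)] with z hz
      rw [map_smul, chartPush_chartPull hz]
    · refine (vfieldSmoothAt_iff (mem_chart_source E x)).2 ?_
      have : ContMDiffAt 𝓘(ℝ, E) 𝓘(ℝ, E) ∞ (fun _ : M ↦ (0 : E)) x := contMDiffAt_const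
      refine this.congr_of_eventuallyEq ?_
      filter_upwards [(isClosed_tsupport χ).isOpen_compl.mem_nhds hx] with z hz
      rw [image_eq_zero_of_notMem_tsupport hz, zero_smul, map_zero]
  · filter_upwards [hχ1] with x hx
    rw [hx, one_smul]

theorem exists_isSmoothVField_eq [FiniteDimensional ℝ E] [T2Space M] (x : M)
    (v : TangentSpace 𝓘(ℝ, E) x) : ∃ V : VField E M, IsSmoothVField V ∧ V x = v := by
  obtain ⟨V, hV, h⟩ := exists_isSmoothVField_eq_chartPull (mem_chart_source E x) v
  exact ⟨V, hV, h.self_of_nhds.trans (chartPull_self (E := E) x v)⟩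

/-- A field of `F`-valued covectors is smooth if its values on smooth vector fields are. -/
def CovSmooth (α : Π x : M, TangentSpace 𝓘(ℝ, E) x →L[ℝ] F) : Prop :=
  ∀ X : VField E M, IsSmoothVField X → ContMDiff 𝓘(ℝ, E) 𝓘(ℝ, F) ∞ (fun x ↦ α x (X x))

/-- The components of a covector field in a chart. -/
def covRep (α : Π x : M, TangentSpace 𝓘(ℝ, E) x →L[ℝ] F) (x₀ x : M) : E →L[ℝ] F :=
  (α x).comp (chartPull x₀ x)

theorem covRep_chartPush (α : Π x : M, TangentSpace 𝓘(ℝ, E) x →L[ℝ] F) {x₀ x : M}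
    (hx : x ∈ (chartAt E x₀).source) (v : TangentSpace 𝓘(ℝ, E) x) :
    covRep α x₀ x (chartPush x₀ x v) = α x v := by
  change α x (chartPull x₀ x (chartPush x₀ x v)) = _
  rw [chartPull_chartPush hx v]

theorem covRep_self (α : Π x : M, TangentSpace 𝓘(ℝ, E) x →L[ℝ] F) (x : M)
    (v : TangentSpace 𝓘(ℝ, E) x) : covRep α x x v = α x v := by
  change α x (chartPull x x v) = _
  rw [chartPull_self (E := E) x v]

theorem CovSmooth.contMDiffAt_covRep [FiniteDimensional ℝ E] [T2Space M] [FiniteDimensional ℝ F]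
    {α : Π x : M, TangentSpace 𝓘(ℝ, E) x →L[ℝ] F} (hα : CovSmooth α) {x₀ x : M}
    (hx : x ∈ (chartAt E x₀).source) :
    ContMDiffAt 𝓘(ℝ, E) 𝓘(ℝ, E →L[ℝ] F) ∞ (covRep α x₀) x := by
  refine contMDiffAt_clm_of_apply fun v ↦ ?_
  obtain ⟨V, hV, h⟩ := exists_isSmoothVField_eq_chartPull hx v
  refine (hα V hV x).congr_of_eventuallyEq ?_
  filter_upwards [h] with z hz
  rw [hz]
  rfl

theorem covSmooth_of_covRep {α : Π x : M, TangentSpace 𝓘(ℝ, E) x →L[ℝ] F}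
    (h : ∀ x, ContMDiffAt 𝓘(ℝ, E) 𝓘(ℝ, E →L[ℝ] F) ∞ (covRep α x) x) : CovSmooth α := by
  intro X hX x
  refine ((h x).clm_apply (hX.contMDiffAt_push (mem_chart_source E x))).congr_of_eventuallyEq ?_
  filter_upwards [(chartAt E x).open_source.mem_nhds (mem_chart_source E x)] with z hz
  exact (covRep_chartPush α hz _).symm

/-- The exterior derivative of a field of `F`-valued covectors. -/
def covD (α : Π x : M, TangentSpace 𝓘(ℝ, E) x →L[ℝ] F) (x : M) (u v : TangentSpace 𝓘(ℝ, E) x) :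
    F :=
  mvfderiv 𝓘(ℝ, E) (covRep α x) x u v - mvfderiv 𝓘(ℝ, E) (covRep α x) x v u

omit [IsManifold 𝓘(ℝ, E) ∞ M] in
theorem mvfderiv_clm_apply {V : Type*} [NormedAddCommGroup V] [NormedSpace ℝ V]
    {a : M → V →L[ℝ] F} {u : M → V} {x : M}
    (ha : MDifferentiableAt 𝓘(ℝ, E) 𝓘(ℝ, V →L[ℝ] F) a x)
    (hu : MDifferentiableAt 𝓘(ℝ, E) 𝓘(ℝ, V) u x) (v : TangentSpace 𝓘(ℝ, E) x) :
    mvfderiv 𝓘(ℝ, E) (fun z ↦ a z (u z)) x v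
      = mvfderiv 𝓘(ℝ, E) a x v (u x) + a x (mvfderiv 𝓘(ℝ, E) u x v) := by
  have e1 := mvfderiv_eq_fderiv ha v
  have e2 := mvfderiv_eq_fderiv hu v
  have e3 := mvfderiv_eq_fderiv (ha.clm_apply hu) v
  have h := fderiv_clm_apply (differentiableAt_comp_chart_of_mdifferentiableAt ha)
    (differentiableAt_comp_chart_of_mdifferentiableAt hu)
  refine e3.trans ?_
  refine (DFunLike.congr_fun h v).trans ?_
  refine Eq.trans ?_ (congrArg₂ (· + ·) (congrArg (fun l : V →L[ℝ] F ↦ l (u x)) e1)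
    (congrArg (a x) e2)).symm
  simp only [Function.comp_apply, extChartAt_to_inv]
  exact add_comm _ _

omit [IsManifold 𝓘(ℝ, E) ∞ M] in
theorem mvfderiv_congr {f f' : M → F} {x : M} (h : f =ᶠ[𝓝 x] f') (v : TangentSpace 𝓘(ℝ, E) x) :
    mvfderiv 𝓘(ℝ, E) f x v = mvfderiv 𝓘(ℝ, E) f' x v := by
  have : mfderiv 𝓘(ℝ, E) 𝓘(ℝ, F) f x = mfderiv 𝓘(ℝ, E) 𝓘(ℝ, F) f' x := h.mfderiv_eq
  simp only [mvfderiv]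
  exact DFunLike.congr_fun this v

variable [FiniteDimensional ℝ E] [T2Space M] [FiniteDimensional ℝ F]

/-- Cartan's formula for the exterior derivative of a `1`-form. -/
theorem covD_apply {α : Π x : M, TangentSpace 𝓘(ℝ, E) x →L[ℝ] F} (hα : CovSmooth α)
    {X Y : VField E M} (hX : IsSmoothVField X) (hY : IsSmoothVField Y) (x : M) :
    covD α x (X x) (Y x) = mvfderiv 𝓘(ℝ, E) (fun z ↦ α z (Y z)) x (X x)
      - mvfderiv 𝓘(ℝ, E) (fun z ↦ α z (X z)) x (Y x) - α x (mlieBracket 𝓘(ℝ, E) X Y x) := by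
  have : CompleteSpace E := FiniteDimensional.complete ℝ E
  have hx := mem_chart_source E x
  have hX' := (hX.contMDiffAt_push hx).mdifferentiableAt (by simp)
  have hY' := (hY.contMDiffAt_push hx).mdifferentiableAt (by simp)
  have hα' := (hα.contMDiffAt_covRep hx).mdifferentiableAt (by simp)
  have key (Z : VField E M) :
      (fun z ↦ α z (Z z)) =ᶠ[𝓝 x] fun z ↦ covRep α x z (chartPush x z (Z z)) := by
    filter_upwards [(chartAt E x).open_source.mem_nhds hx] with z hz
    exact (covRep_chartPush α hz _).symm
  have hb := (covRep_self α x (mlieBracket 𝓘(ℝ, E) X Y x)).symm.trans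
    ((congrArg (covRep α x x) (mlieBracket_eq hX' hY')).trans (map_sub _ _ _))
  rw [mvfderiv_congr (key X), mvfderiv_congr (key Y), mvfderiv_clm_apply hα' hX',
    mvfderiv_clm_apply hα' hY', hb, chartPush_self, chartPush_self, covD]
  abel

end TensorFields

section FormFields

variable {E : Type*} [NormedAddCommGroup E] [NormedSpace ℝ E]
  {M : Type*} [TopologicalSpace M] [ChartedSpace E M]
  {F : Type*} [NormedAddCommGroup F] [NormedSpace ℝ F]

/-- The components of a form in a chart. -/
def formRep {k : ℕ} (σ : Form E M k) (x₀ x : M) : E [⋀^Fin k]→L[ℝ] ℝ :=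
  (σ x).compContinuousLinearMap (chartPull x₀ x)

theorem flat_formInChart {k : ℕ} (σ : Form E M k) (x₀ : M) {y : E}
    (hy : y ∈ (extChartAt 𝓘(ℝ, E) x₀).target) :
    Form.flat (formInChart σ x₀) y = formRep σ x₀ ((extChartAt 𝓘(ℝ, E) x₀).symm y) := by
  change (σ _).compContinuousLinearMap
    (mfderiv 𝓘(ℝ, E) 𝓘(ℝ, E) (extChartAt 𝓘(ℝ, E) x₀).symm y) = _
  ext v
  change σ _ (fun i ↦ mfderiv 𝓘(ℝ, E) 𝓘(ℝ, E) (extChartAt 𝓘(ℝ, E) x₀).symm y (v i))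
    = σ _ (fun i ↦ chartPull x₀ _ (v i))
  congr 1
  ext i
  exact congrArg (fun z ↦ mfderiv 𝓘(ℝ, E) 𝓘(ℝ, E) (extChartAt 𝓘(ℝ, E) x₀).symm z (v i))
    ((extChartAt 𝓘(ℝ, E) x₀).right_inv hy).symm

variable [IsManifold 𝓘(ℝ, E) ∞ M]

theorem contMDiffAt_iff_comp_chart {f : M → F} {x₀ x : M} (hx : x ∈ (chartAt E x₀).source) :
    ContMDiffAt 𝓘(ℝ, E) 𝓘(ℝ, F) ∞ f x ↔
      ContDiffAt ℝ ∞ (f ∘ (extChartAt 𝓘(ℝ, E) x₀).symm) (extChartAt 𝓘(ℝ, E) x₀ x) := by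
  rw [contMDiffAt_iff_source_of_mem_source hx]
  simp only [modelWithCornersSelf_coe, range_id]
  rw [contMDiffWithinAt_univ, contMDiffAt_iff_contDiffAt]

theorem formSmooth_iff {k : ℕ} {σ : Form E M k} : FormSmooth σ ↔
    ∀ x₀ x : M, x ∈ (chartAt E x₀).source →
      ContMDiffAt 𝓘(ℝ, E) 𝓘(ℝ, E [⋀^Fin k]→L[ℝ] ℝ) ∞ (formRep σ x₀) x := by
  refine forall_congr' fun x₀ ↦ ?_
  have ho := isOpen_extChartAt_target (I := 𝓘(ℝ, E)) x₀
  have hc : EqOn (Form.flat (formInChart σ x₀))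
      (formRep σ x₀ ∘ (extChartAt 𝓘(ℝ, E) x₀).symm) (extChartAt 𝓘(ℝ, E) x₀).target :=
    fun y hy ↦ flat_formInChart σ x₀ hy
  rw [contDiffOn_congr hc]
  constructor
  · intro h x hx
    rw [contMDiffAt_iff_comp_chart hx]
    exact h.contDiffAt (ho.mem_nhds ((extChartAt 𝓘(ℝ, E) x₀).map_source (by simpa using hx)))
  · intro h y hy
    have hs : (extChartAt 𝓘(ℝ, E) x₀).symm y ∈ (chartAt E x₀).source := by
      simpa using (extChartAt 𝓘(ℝ, E) x₀).map_target hy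
    have := (contMDiffAt_iff_comp_chart hs).1 (h _ hs)
    rw [(extChartAt 𝓘(ℝ, E) x₀).right_inv hy] at this
    exact this.contDiffWithinAt

theorem formRep_chartPush {k : ℕ} (σ : Form E M k) {x₀ x : M} (hx : x ∈ (chartAt E x₀).source)
    (v : Fin k → TangentSpace 𝓘(ℝ, E) x) :
    formRep σ x₀ x (fun i ↦ chartPush x₀ x (v i)) = σ x v := by
  change σ x (fun i ↦ chartPull x₀ x (chartPush x₀ x (v i))) = _
  simp only [chartPull_chartPush hx]

variable [FiniteDimensional ℝ E]

omit [IsManifold 𝓘(ℝ, E) ∞ M] [FiniteDimensional ℝ E] in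
theorem contMDiffAt_alternating_apply {V : Type*} [NormedAddCommGroup V] [NormedSpace ℝ V]
    [FiniteDimensional ℝ V] {k : ℕ} {f : M → V [⋀^Fin k]→L[ℝ] ℝ} {w : Fin k → M → V} {x : M}
    {n : WithTop ℕ∞} (hf : ContMDiffAt 𝓘(ℝ, E) 𝓘(ℝ, V [⋀^Fin k]→L[ℝ] ℝ) n f x)
    (hw : ∀ i, ContMDiffAt 𝓘(ℝ, E) 𝓘(ℝ, V) n (w i) x) :
    ContMDiffAt 𝓘(ℝ, E) 𝓘(ℝ, ℝ) n (fun z ↦ f z (fun i ↦ w i z)) x := by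
  let b := Module.finBasis ℝ V
  have key (z : M) : f z (fun i ↦ w i z)
      = ∑ r : Fin k → Fin (Module.finrank ℝ V),
        (∏ i, b.coord (r i) (w i z)) * f z (fun i ↦ b (r i)) := by
    have h1 : (fun i ↦ w i z) = fun i ↦ ∑ j, b.coord j (w i z) • b j := by
      ext i
      exact (b.sum_repr _).symm
    conv_lhs => rw [h1]
    change (f z).toContinuousMultilinearMap _ = _
    rw [ContinuousMultilinearMap.map_sum]
    refine Finset.sum_congr rfl fun r _ ↦ ?_
    exact ContinuousMultilinearMap.map_smul_univ _ _ _
  simp only [key]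
  refine ContMDiffAt.sum fun r _ ↦ ContMDiffAt.mul (ContMDiffAt.prod fun i _ ↦ ?_) ?_
  · exact (LinearMap.toContinuousLinearMap (b.coord (r i))).contMDiff.contMDiffAt.comp x (hw i)
  · let ev : (V [⋀^Fin k]→L[ℝ] ℝ) →L[ℝ] ℝ :=
      LinearMap.mkContinuous
        { toFun := fun g ↦ g (fun i ↦ b (r i))
          map_add' := fun _ _ ↦ rfl
          map_smul' := fun _ _ ↦ rfl } (∏ i, ‖b (r i)‖)
        (fun g ↦ by rw [mul_comm]; exact g.le_opNorm _)
    exact ev.contMDiff.contMDiffAt.comp x hf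

theorem FormSmooth.contMDiff_apply {k : ℕ} {σ : Form E M k} (hσ : FormSmooth σ)
    {X : Fin k → VField E M} (hX : ∀ i, IsSmoothVField (X i)) :
    ContMDiff 𝓘(ℝ, E) 𝓘(ℝ, ℝ) ∞ (fun x ↦ σ x (fun i ↦ X i x)) := by
  intro x
  have hx := mem_chart_source E x
  refine (contMDiffAt_alternating_apply (formSmooth_iff.1 hσ x x hx)
    (fun i ↦ (hX i).contMDiffAt_push hx)).congr_of_eventuallyEq ?_
  filter_upwards [(chartAt E x).open_source.mem_nhds hx] with z hz
  exact (formRep_chartPush σ hz _).symm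

theorem formSmooth_of_apply [T2Space M] {k : ℕ} {σ : Form E M k}
    (h : ∀ X : Fin k → VField E M, (∀ i, IsSmoothVField (X i)) →
      ContMDiff 𝓘(ℝ, E) 𝓘(ℝ, ℝ) ∞ (fun x ↦ σ x (fun i ↦ X i x))) : FormSmooth σ := by
  refine formSmooth_iff.2 fun x₀ x hx ↦ contMDiffAt_alternating_of_apply fun v ↦ ?_
  choose V hV hVx using fun i ↦ exists_isSmoothVField_eq_chartPull hx (v i)
  refine (h V hV x).congr_of_eventuallyEq ?_
  filter_upwards [Filter.eventually_all.2 hVx] with z hz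
  simp only [hz]
  rfl

theorem covSmooth_of_formSmooth {α : CovField E M} (h : FormSmooth (covToForm α)) :
    CovSmooth α := fun X hX ↦ h.contMDiff_apply (X := fun _ ↦ X) fun _ ↦ hX

variable [T2Space M]

theorem formD_covToForm {α : CovField E M} (hα : CovSmooth α) (x : M)
    (u v : TangentSpace 𝓘(ℝ, E) x) : formD (covToForm α) x ![u, v] = covD α x u v := by
  have hx := mem_chart_source E x
  have hd := (hα.contMDiffAt_covRep hx).mdifferentiableAt (by simp)
  let L : (E →L[ℝ] ℝ) →L[ℝ] (E [⋀^Fin 1]→L[ℝ] ℝ) :=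
    (ContinuousAlternatingMap.ofSubsingletonLIE (𝕜 := ℝ) (E := E) (F := ℝ) (0 : Fin 1)).toContinuousLinearEquiv
  have he : Form.flat (formInChart (covToForm α) x) =ᶠ[𝓝 (extChartAt 𝓘(ℝ, E) x x)]
      fun y ↦ L ((covRep α x ∘ (extChartAt 𝓘(ℝ, E) x).symm) y) := by
    filter_upwards [extChartAt_target_mem_nhds (I := 𝓘(ℝ, E)) x] with y hy
    rw [flat_formInChart _ _ hy]
    rfl
  have hd' := differentiableAt_comp_chart_of_mdifferentiableAt hd
  have hdL : DifferentiableAt ℝ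
      (fun y ↦ L ((covRep α x ∘ (extChartAt 𝓘(ℝ, E) x).symm) y)) (extChartAt 𝓘(ℝ, E) x x) :=
    L.differentiableAt.comp _ hd'
  let R : E → E →L[ℝ] ℝ := covRep α x ∘ (extChartAt 𝓘(ℝ, E) x).symm
  have hc (c w : E) : fderiv ℝ (fun y ↦ R y c) (extChartAt 𝓘(ℝ, E) x x) w
      = fderiv ℝ R (extChartAt 𝓘(ℝ, E) x x) w c := by
    rw [fderiv_clm_apply hd' (differentiableAt_const c)]
    simp
    rfl
  have hm (w : Fin 2 → TangentSpace 𝓘(ℝ, E) x) : formD (covToForm α) x w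
      = extDeriv (Form.flat (formInChart (covToForm α) x)) (extChartAt 𝓘(ℝ, E) x x)
        (fun i ↦ chartPush x x (w i)) := rfl
  have h0 (w : Fin 2 → E) : extDeriv (fun y ↦ L (R y)) (extChartAt 𝓘(ℝ, E) x x) w
      = (-1) ^ 0 • fderiv ℝ (fun y ↦ R y (w 1)) (extChartAt 𝓘(ℝ, E) x x) (w 0)
        + (-1) ^ 1 • fderiv ℝ (fun y ↦ R y (w 0)) (extChartAt 𝓘(ℝ, E) x x) (w 1) := by
    rw [extDeriv_apply hdL, Fin.sum_univ_two]
    rfl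
  rw [hm, he.extDeriv_eq]
  refine (h0 _).trans ?_
  simp only [chartPush_self, Matrix.cons_val_zero, Matrix.cons_val_one]
  refine Eq.trans ?_ (congrArg₂ (· - ·) (congrArg (fun l : E →L[ℝ] ℝ ↦ l v)
    (mvfderiv_eq_fderiv hd u)) (congrArg (fun l : E →L[ℝ] ℝ ↦ l u) (mvfderiv_eq_fderiv hd v))).symm
  rw [pow_zero, one_smul, pow_one, neg_one_smul, ← sub_eq_add_neg]
  exact congrArg₂ (· - ·) (hc v u) (hc u v)

end FormFields

section Related

variable {E : Type*} [NormedAddCommGroup E] [NormedSpace ℝ E]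
  {M : Type*} [TopologicalSpace M] [ChartedSpace E M]
  {F : Type*} [NormedAddCommGroup F] [NormedSpace ℝ F]
  [IsManifold 𝓘(ℝ, E) ∞ M]

attribute [local instance] isManifold_one isManifold_two

theorem covRep_mvfderiv {f : M → F} {x₀ x : M} (hx : x ∈ (chartAt E x₀).source)
    (hf : MDifferentiableAt 𝓘(ℝ, E) 𝓘(ℝ, F) f x) :
    covRep (mvfderiv 𝓘(ℝ, E) f) x₀ x
      = fderiv ℝ (f ∘ (extChartAt 𝓘(ℝ, E) x₀).symm) (extChartAt 𝓘(ℝ, E) x₀ x) := by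
  have ht := (extChartAt 𝓘(ℝ, E) x₀).map_source (by simpa using hx)
  have hc : MDifferentiableAt 𝓘(ℝ, E) 𝓘(ℝ, E) (extChartAt 𝓘(ℝ, E) x₀).symm
      (extChartAt 𝓘(ℝ, E) x₀ x) := by
    have := mdifferentiableWithinAt_extChartAt_symm (I := 𝓘(ℝ, E)) ht
    rwa [modelWithCornersSelf_coe, range_id, mdifferentiableWithinAt_univ] at this
  have hxx : (extChartAt 𝓘(ℝ, E) x₀).symm (extChartAt 𝓘(ℝ, E) x₀ x) = x :=
    (extChartAt 𝓘(ℝ, E) x₀).left_inv (by simpa using hx)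
  have h := mfderiv_comp_of_eq hf hc hxx
  rw [← mfderiv_eq_fderiv, h]
  ext v
  exact congrArg (fun z ↦ mvfderiv 𝓘(ℝ, E) f z
    (mfderiv 𝓘(ℝ, E) 𝓘(ℝ, E) (extChartAt 𝓘(ℝ, E) x₀).symm (extChartAt 𝓘(ℝ, E) x₀ x) v)) hxx.symm

variable [FiniteDimensional ℝ E] [FiniteDimensional ℝ F]

omit [FiniteDimensional ℝ E] [FiniteDimensional ℝ F] in
theorem contMDiffAt_covRep_mvfderiv {f : M → F} (hf : ContMDiff 𝓘(ℝ, E) 𝓘(ℝ, F) ∞ f) (x : M) :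
    ContMDiffAt 𝓘(ℝ, E) 𝓘(ℝ, E →L[ℝ] F) ∞ (covRep (mvfderiv 𝓘(ℝ, E) f) x) x := by
  have hx := mem_chart_source E x
  have h1 : ContDiffAt ℝ ∞ (fderiv ℝ (f ∘ (extChartAt 𝓘(ℝ, E) x).symm))
      (extChartAt 𝓘(ℝ, E) x x) :=
    ((contMDiffAt_iff_comp_chart hx).1 (hf x)).fderiv_right (by simp)
  refine ((h1.contMDiffAt).comp x contMDiffAt_extChartAt).congr_of_eventuallyEq ?_
  filter_upwards [(chartAt E x).open_source.mem_nhds hx] with z hz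
  exact covRep_mvfderiv hz ((hf z).mdifferentiableAt (by simp))

omit [FiniteDimensional ℝ E] [FiniteDimensional ℝ F] in
theorem covSmooth_mvfderiv {f : M → F} (hf : ContMDiff 𝓘(ℝ, E) 𝓘(ℝ, F) ∞ f) :
    CovSmooth (mvfderiv 𝓘(ℝ, E) f) :=
  covSmooth_of_covRep fun x ↦ contMDiffAt_covRep_mvfderiv hf x

omit [FiniteDimensional ℝ E] [FiniteDimensional ℝ F] in
theorem covD_mvfderiv {f : M → F} (hf : ContMDiff 𝓘(ℝ, E) 𝓘(ℝ, F) ∞ f) (x : M)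
    (u v : TangentSpace 𝓘(ℝ, E) x) : covD (mvfderiv 𝓘(ℝ, E) f) x u v = 0 := by
  have hx := mem_chart_source E x
  have hd := (contMDiffAt_covRep_mvfderiv hf x).mdifferentiableAt (by simp)
  have hs := ((contMDiffAt_iff_comp_chart hx).1 (hf x)).isSymmSndFDerivAt
    (by simp; norm_cast)
  have he : covRep (mvfderiv 𝓘(ℝ, E) f) x ∘ (extChartAt 𝓘(ℝ, E) x).symm
      =ᶠ[𝓝 (extChartAt 𝓘(ℝ, E) x x)] fderiv ℝ (f ∘ (extChartAt 𝓘(ℝ, E) x).symm) := by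
    filter_upwards [extChartAt_target_mem_nhds (I := 𝓘(ℝ, E)) x] with y hy
    have hz : (extChartAt 𝓘(ℝ, E) x).symm y ∈ (chartAt E x).source := by
      simpa using (extChartAt 𝓘(ℝ, E) x).map_target hy
    refine (covRep_mvfderiv hz ((hf _).mdifferentiableAt (by simp))).trans ?_
    rw [(extChartAt 𝓘(ℝ, E) x).right_inv hy]
  have key (w : E) : mvfderiv 𝓘(ℝ, E) (covRep (mvfderiv 𝓘(ℝ, E) f) x) x w
      = fderiv ℝ (fderiv ℝ (f ∘ (extChartAt 𝓘(ℝ, E) x).symm)) (extChartAt 𝓘(ℝ, E) x x) w := by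
    refine (mvfderiv_eq_fderiv hd w).trans ?_
    rw [he.fderiv_eq]
  exact sub_eq_zero.2 (((congrArg (fun l : E →L[ℝ] F ↦ l v) (key u)).trans (hs u v)).trans
    (congrArg (fun l : E →L[ℝ] F ↦ l u) (key v)).symm)

variable [T2Space M]

/-- The Lie bracket as the commutator of derivations. -/
theorem mvfderiv_mlieBracket {f : M → F} (hf : ContMDiff 𝓘(ℝ, E) 𝓘(ℝ, F) ∞ f)
    {X Y : VField E M} (hX : IsSmoothVField X) (hY : IsSmoothVField Y) (x : M) :
    mvfderiv 𝓘(ℝ, E) f x (mlieBracket 𝓘(ℝ, E) X Y x)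
      = mvfderiv 𝓘(ℝ, E) (fun z ↦ mvfderiv 𝓘(ℝ, E) f z (Y z)) x (X x)
        - mvfderiv 𝓘(ℝ, E) (fun z ↦ mvfderiv 𝓘(ℝ, E) f z (X z)) x (Y x) := by
  have h := covD_apply (covSmooth_mvfderiv hf) hX hY x
  rw [covD_mvfderiv hf] at h
  exact (sub_eq_zero.1 h.symm).symm

omit [FiniteDimensional ℝ F] in
theorem exists_contMDiff_mvfderiv_eq_id (x : M) : ∃ φ : M → E,
    ContMDiff 𝓘(ℝ, E) 𝓘(ℝ, E) ∞ φ ∧ ∀ v, mvfderiv 𝓘(ℝ, E) φ x v = v := by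
  obtain ⟨χ, hχ, hχ1, hχs⟩ := exists_contMDiff_eventuallyEq_one (E := E)
    ((chartAt E x).open_source.mem_nhds (mem_chart_source E x))
  refine ⟨fun z ↦ χ z • extChartAt 𝓘(ℝ, E) x z, fun z ↦ ?_, fun v ↦ ?_⟩
  · by_cases hz : z ∈ tsupport χ
    · exact (hχ z).smul (contMDiffAt_extChartAt' (hχs hz))
    · have : ContMDiffAt 𝓘(ℝ, E) 𝓘(ℝ, E) ∞ (fun _ : M ↦ (0 : E)) z := contMDiffAt_const
      refine this.congr_of_eventuallyEq ?_
      filter_upwards [(isClosed_tsupport χ).isOpen_compl.mem_nhds hz] with y hy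
      rw [image_eq_zero_of_notMem_tsupport hy, zero_smul]
  · have he : (fun z ↦ χ z • extChartAt 𝓘(ℝ, E) x z) =ᶠ[𝓝 x] extChartAt 𝓘(ℝ, E) x := by
      filter_upwards [hχ1] with z hz
      rw [hz, one_smul]
    rw [mvfderiv_congr he]
    exact chartPush_self x v

variable {E' : Type*} [NormedAddCommGroup E'] [NormedSpace ℝ E'] [FiniteDimensional ℝ E']
  {M' : Type*} [TopologicalSpace M'] [ChartedSpace E' M'] [IsManifold 𝓘(ℝ, E') ∞ M'] [T2Space M']

omit [FiniteDimensional ℝ E] [T2Space M] [FiniteDimensional ℝ E'] [T2Space M']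
  [IsManifold 𝓘(ℝ, E') ∞ M'] [IsManifold 𝓘(ℝ, E) ∞ M] [FiniteDimensional ℝ F] in
theorem mvfderiv_comp_mfderiv {p : M → M'} {f : M' → F} {x : M}
    (hf : MDifferentiableAt 𝓘(ℝ, E') 𝓘(ℝ, F) f (p x))
    (hp : MDifferentiableAt 𝓘(ℝ, E) 𝓘(ℝ, E') p x) (v : TangentSpace 𝓘(ℝ, E) x) :
    mvfderiv 𝓘(ℝ, E) (fun z ↦ f (p z)) x v
      = mvfderiv 𝓘(ℝ, E') f (p x) (mfderiv 𝓘(ℝ, E) 𝓘(ℝ, E') p x v) := by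
  have h := mfderiv_comp x hf hp
  simp only [mvfderiv]
  exact DFunLike.congr_fun h v

omit [FiniteDimensional ℝ F] in
/-- The Lie bracket is natural with respect to related vector fields. -/
theorem mfderiv_mlieBracket_of_related {p : M → M'} (hp : ContMDiff 𝓘(ℝ, E) 𝓘(ℝ, E') ∞ p)
    {X Y : VField E M} (hX : IsSmoothVField X) (hY : IsSmoothVField Y) {X' Y' : VField E' M'}
    (hX' : IsSmoothVField X') (hY' : IsSmoothVField Y')
    (hXX : ∀ x, mfderiv 𝓘(ℝ, E) 𝓘(ℝ, E') p x (X x) = X' (p x))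
    (hYY : ∀ x, mfderiv 𝓘(ℝ, E) 𝓘(ℝ, E') p x (Y x) = Y' (p x)) (x : M) :
    mfderiv 𝓘(ℝ, E) 𝓘(ℝ, E') p x (mlieBracket 𝓘(ℝ, E) X Y x)
      = mlieBracket 𝓘(ℝ, E') X' Y' (p x) := by
  obtain ⟨φ, hφ, hφx⟩ := exists_contMDiff_mvfderiv_eq_id (E := E') (M := M') (p x)
  have hp' (z : M) : MDifferentiableAt 𝓘(ℝ, E) 𝓘(ℝ, E') p z := (hp z).mdifferentiableAt (by simp)
  have key (Z : VField E M) (Z' : VField E' M') (h : ∀ x,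
      mfderiv 𝓘(ℝ, E) 𝓘(ℝ, E') p x (Z x) = Z' (p x)) {f : M' → E'}
      (hf : ContMDiff 𝓘(ℝ, E') 𝓘(ℝ, E') ∞ f) (z : M) :
      mvfderiv 𝓘(ℝ, E) (fun z ↦ f (p z)) z (Z z) = mvfderiv 𝓘(ℝ, E') f (p z) (Z' (p z)) := by
    rw [mvfderiv_comp_mfderiv ((hf _).mdifferentiableAt (by simp)) (hp' z), h]
  have h1 := mvfderiv_mlieBracket (f := φ ∘ p) (hφ.comp hp) hX hY x
  have h2 := mvfderiv_mlieBracket hφ hX' hY' (p x)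
  simp only [Function.comp_def, key X X' hXX hφ, key Y Y' hYY hφ] at h1
  rw [key X X' hXX (f := fun z ↦ mvfderiv 𝓘(ℝ, E') φ z (Y' z)) (covSmooth_mvfderiv hφ Y' hY'),
    key Y Y' hYY (f := fun z ↦ mvfderiv 𝓘(ℝ, E') φ z (X' z)) (covSmooth_mvfderiv hφ X' hX'),
    ← h2, mvfderiv_comp_mfderiv ((hφ _).mdifferentiableAt (by simp)) (hp' x)] at h1
  exact (hφx _).symm.trans (h1.trans (hφx _))

omit [T2Space M] in
theorem isSmoothVField_mlieBracket {X Y : VField E M} (hX : IsSmoothVField X)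
    (hY : IsSmoothVField Y) : IsSmoothVField (mlieBracket 𝓘(ℝ, E) X Y) := by
  have : CompleteSpace E := FiniteDimensional.complete ℝ E
  have : IsManifold 𝓘(ℝ, E) (minSmoothness ℝ 2) M := by
    rw [minSmoothness_of_isRCLikeNormedField]
    infer_instance
  have : IsManifold 𝓘(ℝ, E) (((⊤ : ℕ∞) : WithTop ℕ∞) + 1) M := ‹IsManifold 𝓘(ℝ, E) ∞ M›
  intro x
  exact ContMDiffAt.mlieBracket_vectorField (m := ⊤) (n := ⊤) (hX x) (hY x)
    (by rw [minSmoothness_of_isRCLikeNormedField]; rfl)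

end Related

section SubmersionMaps

variable {E : Type*} [NormedAddCommGroup E] [NormedSpace ℝ E]
  {M : Type*} [TopologicalSpace M] [ChartedSpace E M]
  {EN : Type*} [NormedAddCommGroup EN] [NormedSpace ℝ EN]
  {N : Type*} [TopologicalSpace N] [ChartedSpace EN N]
  {p : M → N} {x : M}

theorem exists_local_section (hp : IsSubmersionAt 𝓘(ℝ, E) 𝓘(ℝ, EN) ∞ p x) :
    ∃ s : N → M, ContMDiffAt 𝓘(ℝ, EN) 𝓘(ℝ, E) ∞ s (p x) ∧ s (p x) = x ∧
      ∀ᶠ n in 𝓝 (p x), p (s n) = n := by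
  set d := hp.domChart
  set c := hp.codChart
  have hxd : x ∈ d.source := hp.mem_domChart_source
  have hxc : p x ∈ c.source := hp.mem_codChart_source
  have hw (y : E) (hy : y ∈ d.target) : c (p (d.symm y)) = (hp.equiv y).1 := by
    have := hp.writtenInCharts (show y ∈ (d.extend 𝓘(ℝ, E)).target by simpa using hy)
    simpa using this
  have hsrc (y : E) (hy : y ∈ d.target) : p (d.symm y) ∈ c.source :=
    hp.source_subset_preimage_source (d.map_target hy)
  let r : N → E := fun n ↦ hp.equiv.symm (c n, (hp.equiv (d x)).2)
  have hr : ContMDiffAt 𝓘(ℝ, EN) 𝓘(ℝ, E) ∞ r (p x) := by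
    have h1 : ContMDiffAt 𝓘(ℝ, EN) 𝓘(ℝ, EN) ∞ c (p x) :=
      contMDiffAt_of_mem_maximalAtlas hp.codChart_mem_maximalAtlas hxc
    have h2 : ContDiffAt ℝ ∞ (fun z : EN ↦ hp.equiv.symm (z, (hp.equiv (d x)).2)) (c (p x)) :=
      (hp.equiv.symm.contDiff.comp (contDiff_id.prodMk contDiff_const)).contDiffAt
    exact h2.contMDiffAt.comp _ h1
  have hrx : r (p x) = d x := by
    have h1 := hw (d x) (d.map_source hxd)
    rw [d.left_inv hxd] at h1
    change hp.equiv.symm (c (p x), _) = _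
    rw [h1]
    exact hp.equiv.symm_apply_apply _
  have hdx : d x ∈ d.target := d.map_source hxd
  refine ⟨fun n ↦ d.symm (r n), ?_, (congrArg d.symm hrx).trans (d.left_inv hxd), ?_⟩
  · refine ContMDiffAt.comp (I' := 𝓘(ℝ, E)) (p x) ?_ hr
    rw [hrx]
    exact contMDiffAt_symm_of_mem_maximalAtlas hp.domChart_mem_maximalAtlas hdx
  · have h1 : ∀ᶠ n in 𝓝 (p x), r n ∈ d.target :=
      hr.continuousAt.eventually_mem (d.open_target.mem_nhds (by rwa [hrx]))
    filter_upwards [h1, c.open_source.mem_nhds hxc] with n hn hnc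
    refine c.injOn (hsrc _ hn) hnc ?_
    rw [hw _ hn]
    simp [r]

theorem exists_curve_in_fibre (hp : IsSubmersionAt 𝓘(ℝ, E) 𝓘(ℝ, EN) ∞ p x)
    {v : TangentSpace 𝓘(ℝ, E) x} (hv : mfderiv 𝓘(ℝ, E) 𝓘(ℝ, EN) p x v = 0) :
    ∃ c : ℝ → M, c 0 = x ∧ HasMFDerivAt 𝓘(ℝ, ℝ) 𝓘(ℝ, E) c 0
      (ContinuousLinearMap.toSpanSingleton ℝ (M₁ := E) v) ∧ ∀ᶠ t in 𝓝 0, p (c t) = p x := by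
  set d := hp.domChart
  set c := hp.codChart
  have hxd : x ∈ d.source := hp.mem_domChart_source
  have hxc : p x ∈ c.source := hp.mem_codChart_source
  have hw (y : E) (hy : y ∈ d.target) : c (p (d.symm y)) = (hp.equiv y).1 := by
    have := hp.writtenInCharts (show y ∈ (d.extend 𝓘(ℝ, E)).target by simpa using hy)
    simpa using this
  have hsrc (y : E) (hy : y ∈ d.target) : p (d.symm y) ∈ c.source :=
    hp.source_subset_preimage_source (d.map_target hy)
  have hdx : d x ∈ d.target := d.map_source hxd
  have hd : MDifferentiableAt 𝓘(ℝ, E) 𝓘(ℝ, E) d x :=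
    (contMDiffAt_of_mem_maximalAtlas hp.domChart_mem_maximalAtlas hxd).mdifferentiableAt (by simp)
  have hds : MDifferentiableAt 𝓘(ℝ, E) 𝓘(ℝ, E) d.symm (d x) :=
    (contMDiffAt_symm_of_mem_maximalAtlas hp.domChart_mem_maximalAtlas hdx).mdifferentiableAt
      (by simp)
  have hc : MDifferentiableAt 𝓘(ℝ, EN) 𝓘(ℝ, EN) c (p x) :=
    (contMDiffAt_of_mem_maximalAtlas hp.codChart_mem_maximalAtlas hxc).mdifferentiableAt (by simp)
  have hpd : MDifferentiableAt 𝓘(ℝ, E) 𝓘(ℝ, EN) p x := hp.contMDiffAt.mdifferentiableAt (by simp)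
  let w : E := mfderiv 𝓘(ℝ, E) 𝓘(ℝ, E) d x v
  have hw0 : (hp.equiv w).1 = 0 := by
    let q : E →L[ℝ] EN := (ContinuousLinearMap.fst ℝ EN hp.complement).comp
      (hp.equiv : E →L[ℝ] EN × hp.complement)
    have h1 : (fun z ↦ c (p z)) =ᶠ[𝓝 x] fun z ↦ q (d z) := by
      filter_upwards [d.open_source.mem_nhds hxd] with z hz
      have := hw (d z) (d.map_source hz)
      rwa [d.left_inv hz] at this
    have h2 := h1.mfderiv_eq (I := 𝓘(ℝ, E)) (I' := 𝓘(ℝ, EN))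
    have h3 := mfderiv_comp x hc hpd
    have h4 := mfderiv_comp x (I' := 𝓘(ℝ, E)) (I'' := 𝓘(ℝ, EN)) (g := q)
      q.mdifferentiableAt hd
    have h5 := DFunLike.congr_fun (h3.symm.trans (h2.trans h4)) v
    have h6 : mfderiv 𝓘(ℝ, EN) 𝓘(ℝ, EN) c (p x) (mfderiv 𝓘(ℝ, E) 𝓘(ℝ, EN) p x v) = 0 :=
      (congrArg _ hv).trans (map_zero _)
    have h7 : mfderiv 𝓘(ℝ, E) 𝓘(ℝ, EN) q (d x) w = q w := by
      rw [q.mfderiv_eq]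
      rfl
    exact h7.symm.trans (h5.symm.trans h6)
  let l : ℝ → E := fun t ↦ d x + t • w
  have hl : HasDerivAt l w 0 := by
    have := ((hasDerivAt_id (0 : ℝ)).smul_const w).const_add (d x)
    rwa [one_smul] at this
  have hl0 : l 0 = d x := by simp [l]
  refine ⟨fun t ↦ d.symm (l t), (congrArg d.symm hl0).trans (d.left_inv hxd), ?_, ?_⟩
  · have h1 : HasMFDerivAt 𝓘(ℝ, E) 𝓘(ℝ, E) d.symm (l 0)
        (mfderiv 𝓘(ℝ, E) 𝓘(ℝ, E) d.symm (l 0)) := by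
      rw [hl0]; exact hds.hasMFDerivAt
    have h2 := h1.comp 0 hl.hasFDerivAt.hasMFDerivAt
    have h3 : mfderiv 𝓘(ℝ, E) 𝓘(ℝ, E) d.symm (d x) w = v := by
      have h4 := mfderiv_comp x hds hd
      have h5 : (d.symm ∘ d) =ᶠ[𝓝 x] id := by
        filter_upwards [d.open_source.mem_nhds hxd] with z hz
        exact d.left_inv hz
      have h6 := h5.mfderiv_eq (I := 𝓘(ℝ, E)) (I' := 𝓘(ℝ, E))
      rw [mfderiv_id] at h6
      exact DFunLike.congr_fun (h4.symm.trans h6) v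
    have h4 : (mfderiv 𝓘(ℝ, E) 𝓘(ℝ, E) d.symm (l 0) : E →L[ℝ] E) w = v := by
      rw [hl0]; exact h3
    refine h2.congr_mfderiv ?_
    refine ContinuousLinearMap.ext fun t : ℝ ↦ ?_
    have h5 : (mfderiv 𝓘(ℝ, E) 𝓘(ℝ, E) d.symm (l 0) : E →L[ℝ] E) (t • w) = t • (v : E) :=
      (ContinuousLinearMap.map_smul (mfderiv 𝓘(ℝ, E) 𝓘(ℝ, E) d.symm (l 0) : E →L[ℝ] E) t w).trans
        (congrArg (fun z : E ↦ t • z) h4)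
    exact h5
  · have h1 : ∀ᶠ t in 𝓝 0, l t ∈ d.target :=
      hl.continuousAt.eventually_mem (d.open_target.mem_nhds (by rwa [hl0]))
    filter_upwards [h1] with t ht
    refine c.injOn (hsrc _ ht) hxc ?_
    have h2 := hw (d x) hdx
    rw [d.left_inv hxd] at h2
    rw [hw _ ht, h2]
    simp [l, hw0]

theorem contMDiff_of_comp_submersion {E' : Type*} [NormedAddCommGroup E'] [NormedSpace ℝ E']
    {M' : Type*} [TopologicalSpace M'] [ChartedSpace E' M']
    (hp : IsSubmersion 𝓘(ℝ, E) 𝓘(ℝ, EN) ∞ p) (hps : Function.Surjective p) {f : N → M'}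
    (hf : ContMDiff 𝓘(ℝ, E) 𝓘(ℝ, E') ∞ fun z ↦ f (p z)) :
    ContMDiff 𝓘(ℝ, EN) 𝓘(ℝ, E') ∞ f := by
  intro n
  obtain ⟨x, rfl⟩ := hps n
  obtain ⟨s, hs, -, hps⟩ := exists_local_section (hp.isSubmersionAt x)
  refine ((hf (s (p x))).comp (p x) hs).congr_of_eventuallyEq ?_
  filter_upwards [hps] with m hm
  exact congrArg f hm.symm

theorem mfderiv_surjective_of_isSubmersionAt (hp : IsSubmersionAt 𝓘(ℝ, E) 𝓘(ℝ, EN) ∞ p x) :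
    Function.Surjective (mfderiv 𝓘(ℝ, E) 𝓘(ℝ, EN) p x) := by
  obtain ⟨s, hs, hsx, hps⟩ := exists_local_section hp
  intro v
  have h1 := mfderiv_comp_of_eq (g := p) (x := p x) (y := x)
    (hp.contMDiffAt.mdifferentiableAt (by simp))
    (hs.mdifferentiableAt (by simp)) hsx
  have h2 : (p ∘ s) =ᶠ[𝓝 (p x)] id := hps
  have h3 := h2.mfderiv_eq (I := 𝓘(ℝ, EN)) (I' := 𝓘(ℝ, EN))
  rw [mfderiv_id] at h3
  have h4 (y : M) (hy : y = x) : (mfderiv 𝓘(ℝ, E) 𝓘(ℝ, EN) p y : E →L[ℝ] EN)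
      = mfderiv 𝓘(ℝ, E) 𝓘(ℝ, EN) p x := by rw [hy]
  exact ⟨mfderiv 𝓘(ℝ, EN) 𝓘(ℝ, E) s (p x) v,
    (DFunLike.congr_fun (h4 (s (p x)) hsx) _).symm.trans (DFunLike.congr_fun (h1.symm.trans h3) v)⟩

end SubmersionMaps

section ActionGeometry

variable {E : Type*} [NormedAddCommGroup E] [NormedSpace ℝ E]
  {EG : Type*} [NormedAddCommGroup EG] [NormedSpace ℝ EG]
  {EN : Type*} [NormedAddCommGroup EN] [NormedSpace ℝ EN]
  {M : Type*} [TopologicalSpace M] [ChartedSpace E M]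
  {G : Type*} [TopologicalSpace G] [ChartedSpace EG G] [Group G]
  [MulAction G M]

attribute [local instance] isManifold_one isManifold_two

variable (EG E) in
theorem contMDiff_smul_left [ContMDiffSMul 𝓘(ℝ, EG) 𝓘(ℝ, E) ∞ G M] (a : G) :
    ContMDiff 𝓘(ℝ, E) 𝓘(ℝ, E) ∞ fun y : M ↦ a • y :=
  (contMDiff_smul (I := 𝓘(ℝ, EG)) (I' := 𝓘(ℝ, E)) (G := G) (M := M) (n := ∞)).comp
    (contMDiff_const.prodMk contMDiff_id)

variable (EG E) in
theorem contMDiff_smul_right [ContMDiffSMul 𝓘(ℝ, EG) 𝓘(ℝ, E) ∞ G M] (x : M) :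
    ContMDiff 𝓘(ℝ, EG) 𝓘(ℝ, E) ∞ fun a : G ↦ a • x :=
  (contMDiff_smul (I := 𝓘(ℝ, EG)) (I' := 𝓘(ℝ, E)) (G := G) (M := M) (n := ∞)).comp
    (contMDiff_id.prodMk contMDiff_const)

omit [ChartedSpace E M] [ChartedSpace EG G] in
theorem t2Space_orbitRel_quotient [CompactSpace G] [T2Space M] [ContinuousSMul G M] :
    T2Space (MulAction.orbitRel.Quotient G M) := by
  have hq : IsOpenQuotientMap (orbitProj G M) := MulAction.isOpenQuotientMap_quotientMk
  rw [t2Space_iff_of_isOpenQuotientMap hq]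
  have h : IsClosed {q : G × M × M | q.1 • q.2.2 = q.2.1} :=
    isClosed_eq (by fun_prop) (by fun_prop)
  convert isClosedMap_snd_of_compactSpace _ h using 1
  ext ⟨x, y⟩
  constructor
  · intro hxy
    obtain ⟨a, ha⟩ := Quotient.exact hxy
    exact ⟨(a, x, y), ha, rfl⟩
  · rintro ⟨⟨a, x', y'⟩, h1, h2⟩
    obtain ⟨rfl, rfl⟩ := Prod.mk.inj h2
    exact Quotient.sound ⟨a, h1⟩

omit [TopologicalSpace M] [ChartedSpace E M] [TopologicalSpace G] [ChartedSpace EG G] in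
theorem orbitProj_smul (a : G) (x : M) : orbitProj G M (a • x) = orbitProj G M x :=
  Quotient.sound ⟨a, rfl⟩

variable (EG) in
theorem mfderiv_actDeriv_of_invariant [ContMDiffSMul 𝓘(ℝ, EG) 𝓘(ℝ, E) ∞ G M] {E' : Type*} [NormedAddCommGroup E'] [NormedSpace ℝ E']
    {M' : Type*} [TopologicalSpace M'] [ChartedSpace E' M'] {f : M → M'}
    (hf : ∀ (a : G) x, f (a • x) = f x)
    (hfs : MDifferentiable 𝓘(ℝ, E) 𝓘(ℝ, E') f) (a : G) (x : M) (v : TangentSpace 𝓘(ℝ, E) x) :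
    (mfderiv 𝓘(ℝ, E) 𝓘(ℝ, E') f (a • x) (actDeriv E a x v) : E')
      = mfderiv 𝓘(ℝ, E) 𝓘(ℝ, E') f x v := by
  have h1 := mfderiv_comp x (hfs (a • x))
    ((contMDiff_smul_left E EG a).mdifferentiableAt (x := x) (by simp))
  have h2 : (f ∘ fun y ↦ a • y) = f := funext (hf a)
  have h3 : (mfderiv 𝓘(ℝ, E) 𝓘(ℝ, E') (f ∘ fun y ↦ a • y) x : E →L[ℝ] E')
    = mfderiv 𝓘(ℝ, E) 𝓘(ℝ, E') f x := by rw [h2]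
  exact DFunLike.congr_fun (h1.symm.trans h3) v

variable [ContMDiffSMul 𝓘(ℝ, EG) 𝓘(ℝ, E) ∞ G M]

theorem mfderiv_fundMap_of_invariant {E' : Type*} [NormedAddCommGroup E'] [NormedSpace ℝ E']
    {M' : Type*} [TopologicalSpace M'] [ChartedSpace E' M'] {f : M → M'}
    (hf : ∀ (a : G) x, f (a • x) = f x) (hfs : MDifferentiable 𝓘(ℝ, E) 𝓘(ℝ, E') f) (x : M)
    (e : GroupLieAlgebra 𝓘(ℝ, EG) G) :
    mfderiv 𝓘(ℝ, E) 𝓘(ℝ, E') f x (fundMap x e) = 0 := by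
  have h1 := mfderiv_comp_of_eq (g := f) (f := fun a : G ↦ a • x) (x := 1) (y := x) (hfs x)
    ((contMDiff_smul_right E EG x).mdifferentiableAt (by simp)) (one_smul G x)
  have h2 : (f ∘ fun a : G ↦ a • x) = fun _ ↦ f x := funext fun a ↦ hf a x
  have h3 : (mfderiv 𝓘(ℝ, EG) 𝓘(ℝ, E') (f ∘ fun a : G ↦ a • x) 1 : EG →L[ℝ] E') = 0 := by
    rw [h2, mfderiv_const]
  have h4 : (mfderiv 𝓘(ℝ, E) 𝓘(ℝ, E') f ((1 : G) • x) : E →L[ℝ] E')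
      = mfderiv 𝓘(ℝ, E) 𝓘(ℝ, E') f x := by rw [one_smul]
  exact (DFunLike.congr_fun h4 (fundMap x e : E)).symm.trans
    (DFunLike.congr_fun (h1.symm.trans h3) e)

theorem mfderiv_orbit_mulInvariant [LieGroup 𝓘(ℝ, EG) ∞ G] (a : G) (x : M)
    (e : GroupLieAlgebra 𝓘(ℝ, EG) G) :
    mfderiv 𝓘(ℝ, EG) 𝓘(ℝ, E) (fun c : G ↦ c • x) a (mulInvariantVectorField e a)
      = actDeriv E a x (fundMap x e) := by
  have h1 := mfderiv_comp_of_eq (g := fun c : G ↦ c • x) (f := fun c : G ↦ a * c) (x := 1)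
    (y := a) ((contMDiff_smul_right E EG x).mdifferentiableAt (by simp))
    ((contMDiff_mul_left (I := 𝓘(ℝ, EG)) (n := ∞) (a := a)).mdifferentiableAt (by simp))
    (mul_one a)
  have h2 := mfderiv_comp_of_eq (g := fun y : M ↦ a • y) (f := fun c : G ↦ c • x) (x := 1)
    (y := x) ((contMDiff_smul_left E EG a).mdifferentiableAt (by simp))
    ((contMDiff_smul_right E EG x).mdifferentiableAt (by simp)) (one_smul G x)
  have h3 : ((fun c : G ↦ c • x) ∘ fun c : G ↦ a * c) = (fun y : M ↦ a • y) ∘ fun c : G ↦ c • x :=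
    funext fun c ↦ mul_smul a c x
  have h4 : (mfderiv 𝓘(ℝ, EG) 𝓘(ℝ, E) ((fun c : G ↦ c • x) ∘ fun c : G ↦ a * c) 1 : EG →L[ℝ] E)
    = mfderiv 𝓘(ℝ, EG) 𝓘(ℝ, E) ((fun y : M ↦ a • y) ∘ fun c : G ↦ c • x) 1 := by rw [h3]
  have h5 : (mfderiv 𝓘(ℝ, EG) 𝓘(ℝ, E) (fun c : G ↦ c • x) (a * 1) : EG →L[ℝ] E)
      = mfderiv 𝓘(ℝ, EG) 𝓘(ℝ, E) (fun c : G ↦ c • x) a := by rw [mul_one]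
  have h6 : (mfderiv 𝓘(ℝ, E) 𝓘(ℝ, E) (fun y : M ↦ a • y) ((1 : G) • x) : E →L[ℝ] E)
      = mfderiv 𝓘(ℝ, E) 𝓘(ℝ, E) (fun y : M ↦ a • y) x := by rw [one_smul]
  exact (DFunLike.congr_fun h5 _).symm.trans ((DFunLike.congr_fun (h1.symm.trans (h4.trans h2))
    e).trans (DFunLike.congr_fun h6 _))

theorem actDeriv_fundMap [LieGroup 𝓘(ℝ, EG) ∞ G] (a : G) (x : M)
    (e : GroupLieAlgebra 𝓘(ℝ, EG) G) :
    actDeriv E a x (fundMap x e) = fundMap (a • x) (adjoint EG a e) := by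
  have hc : ContMDiff 𝓘(ℝ, EG) 𝓘(ℝ, EG) ∞ fun c : G ↦ a * c * a⁻¹ :=
    (contMDiff_mul_right (I := 𝓘(ℝ, EG)) (n := ∞) (a := a⁻¹)).comp
      (contMDiff_mul_left (I := 𝓘(ℝ, EG)) (n := ∞) (a := a))
  have h1 := mfderiv_comp_of_eq (g := fun c : G ↦ c • (a • x)) (f := fun c : G ↦ a * c * a⁻¹)
    (x := 1) (y := 1) ((contMDiff_smul_right E EG _).mdifferentiableAt (by simp))
    (hc.mdifferentiableAt (by simp)) (by simp)
  have h2 := mfderiv_comp_of_eq (g := fun y : M ↦ a • y) (f := fun c : G ↦ c • x) (x := 1)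
    (y := x) ((contMDiff_smul_left E EG a).mdifferentiableAt (by simp))
    ((contMDiff_smul_right E EG x).mdifferentiableAt (by simp)) (one_smul G x)
  have h3 : ((fun c : G ↦ c • (a • x)) ∘ fun c : G ↦ a * c * a⁻¹)
      = (fun y : M ↦ a • y) ∘ fun c : G ↦ c • x :=
    funext fun c ↦ by simp [smul_smul]
  have h4 : (mfderiv 𝓘(ℝ, EG) 𝓘(ℝ, E) ((fun c : G ↦ c • (a • x)) ∘ fun c : G ↦ a * c * a⁻¹) 1 :
      EG →L[ℝ] E)
    = mfderiv 𝓘(ℝ, EG) 𝓘(ℝ, E) ((fun y : M ↦ a • y) ∘ fun c : G ↦ c • x) 1 := by rw [h3]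
  have h5 : (mfderiv 𝓘(ℝ, EG) 𝓘(ℝ, E) (fun c : G ↦ c • (a • x)) (a * 1 * a⁻¹) : EG →L[ℝ] E)
      = mfderiv 𝓘(ℝ, EG) 𝓘(ℝ, E) (fun c : G ↦ c • (a • x)) 1 := by
    rw [mul_one, mul_inv_cancel]
  have h6 : (mfderiv 𝓘(ℝ, E) 𝓘(ℝ, E) (fun y : M ↦ a • y) ((1 : G) • x) : E →L[ℝ] E)
      = mfderiv 𝓘(ℝ, E) 𝓘(ℝ, E) (fun y : M ↦ a • y) x := by rw [one_smul]
  exact ((DFunLike.congr_fun h5 _).symm.trans ((DFunLike.congr_fun (h1.symm.trans (h4.trans h2))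
    e).trans (DFunLike.congr_fun h6 _))).symm

variable [IsManifold 𝓘(ℝ, E) ∞ M]

theorem isSmoothVField_fundMap [LieGroup 𝓘(ℝ, EG) ∞ G] (e : GroupLieAlgebra 𝓘(ℝ, EG) G) :
    IsSmoothVField (E := E) (fun x : M ↦ fundMap x e) := by
  have : IsManifold 𝓘(ℝ, EG) ∞ G := inferInstance
  let fM : M → TangentBundle 𝓘(ℝ, E) M := fun y ↦ TotalSpace.mk' E y 0
  have sfM : ContMDiff 𝓘(ℝ, E) (𝓘(ℝ, E).prod 𝓘(ℝ, E)) ∞ fM := contMDiff_zeroSection _ _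
  let fv : M → TangentBundle 𝓘(ℝ, EG) G := fun _ ↦ TotalSpace.mk' EG 1 e
  have sfv : ContMDiff 𝓘(ℝ, E) (𝓘(ℝ, EG).prod 𝓘(ℝ, EG)) ∞ fv := contMDiff_const
  have S₂ : ContMDiff (𝓘(ℝ, EG).tangent.prod 𝓘(ℝ, E).tangent) (𝓘(ℝ, EG).prod 𝓘(ℝ, E)).tangent ∞
      (equivTangentBundleProd 𝓘(ℝ, EG) G 𝓘(ℝ, E) M).symm :=
    contMDiff_equivTangentBundleProd_symm
  have hs := contMDiff_smul (I := 𝓘(ℝ, EG)) (I' := 𝓘(ℝ, E)) (G := G) (M := M) (n := ∞)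
  have S₃ : ContMDiff (𝓘(ℝ, EG).prod 𝓘(ℝ, E)).tangent 𝓘(ℝ, E).tangent ∞ (tangentMap (𝓘(ℝ, EG).prod 𝓘(ℝ, E)) 𝓘(ℝ, E)
      (fun q : G × M ↦ q.1 • q.2)) := hs.contMDiff_tangentMap le_rfl
  have S := (S₃.comp S₂).comp (sfv.prodMk sfM)
  have h1 : (fun y ↦ TotalSpace.mk' E y (fundMap y e) :
      M → TotalSpace E (TangentSpace 𝓘(ℝ, E) : M → Type _)) =
      (tangentMap (𝓘(ℝ, EG).prod 𝓘(ℝ, E)) 𝓘(ℝ, E) (fun q : G × M ↦ q.1 • q.2)) ∘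
      (equivTangentBundleProd 𝓘(ℝ, EG) G 𝓘(ℝ, E) M).symm ∘ fun y ↦ (fv y, fM y) := by
    funext y
    have h2 (y' : M) (hy : y' = y) (a : TangentSpace 𝓘(ℝ, E) y) (b : TangentSpace 𝓘(ℝ, E) y')
        (hab : (a : E) = b) : TotalSpace.mk' E (E := fun x : M ↦ TangentSpace 𝓘(ℝ, E) x) y a
          = TotalSpace.mk' E y' b := by
      subst hy; exact congrArg _ hab
    refine h2 ((1 : G) • y) (one_smul G y) _ (mfderiv (𝓘(ℝ, EG).prod 𝓘(ℝ, E)) 𝓘(ℝ, E)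
      (fun q : G × M ↦ q.1 • q.2) ((1 : G), y) (e, (0 : E))) ?_
    refine Eq.trans ?_ (mfderiv_prod_eq_add_apply (p := ((1 : G), y))
      (v := ((e, (0 : E)) : EG × E)) (hs.mdifferentiableAt (by simp))).symm
    exact ((congrArg _ (map_zero _)).trans (add_zero _)).symm
  rw [IsSmoothVField, h1]
  exact S

end ActionGeometry

section OrbitMaps

variable {E : Type*} [NormedAddCommGroup E] [NormedSpace ℝ E]
  {EG : Type*} [NormedAddCommGroup EG] [NormedSpace ℝ EG] [FiniteDimensional ℝ EG]
  {EN : Type*} [NormedAddCommGroup EN] [NormedSpace ℝ EN]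
  {M : Type*} [TopologicalSpace M] [ChartedSpace E M]
  {G : Type*} [TopologicalSpace G] [ChartedSpace EG G] [Group G]
  [MulAction G M] [ContMDiffSMul 𝓘(ℝ, EG) 𝓘(ℝ, E) ∞ G M]

attribute [local instance] isManifold_one isManifold_two

theorem eventually_eq_of_hasMFDerivAt_zero {c : ℝ → M} {t₀ : ℝ}
    (hc : ∀ᶠ t in 𝓝 t₀, HasMFDerivAt 𝓘(ℝ, ℝ) 𝓘(ℝ, E) c t 0) [IsManifold 𝓘(ℝ, E) ∞ M] :
    ∀ᶠ t in 𝓝 t₀, c t = c t₀ := by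
  have h1 : ∀ᶠ t in 𝓝 t₀, c t ∈ (extChartAt 𝓘(ℝ, E) (c t₀)).source :=
    hc.self_of_nhds.continuousAt.eventually_mem (extChartAt_source_mem_nhds _)
  obtain ⟨ε, hε, hb⟩ := Metric.eventually_nhds_iff_ball.1 (hc.and h1)
  have h2 (t : ℝ) (ht : t ∈ Metric.ball t₀ ε) :
      HasFDerivAt (extChartAt 𝓘(ℝ, E) (c t₀) ∘ c) (0 : ℝ →L[ℝ] E) t := by
    have h3 : MDifferentiableAt 𝓘(ℝ, E) 𝓘(ℝ, E) (extChartAt 𝓘(ℝ, E) (c t₀)) (c t) :=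
      mdifferentiableAt_extChartAt (by simpa using (hb t ht).2)
    have h4 := (h3.hasMFDerivAt.comp t (hb t ht).1).hasFDerivAt
    refine h4.congr_fderiv ?_
    exact ContinuousLinearMap.comp_zero _
  filter_upwards [Metric.ball_mem_nhds t₀ hε] with t ht
  have h5 := (convex_ball t₀ ε).is_const_of_fderivWithin_eq_zero (𝕜 := ℝ)
    (fun s hs ↦ (h2 s hs).differentiableAt.differentiableWithinAt)
    (fun s hs ↦ by
      rw [fderivWithin_of_isOpen Metric.isOpen_ball hs]
      exact (h2 s hs).fderiv) ht (Metric.mem_ball_self hε)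
  exact (extChartAt 𝓘(ℝ, E) (c t₀)).injOn (hb t ht).2 (hb t₀ (Metric.mem_ball_self hε)).2 h5

theorem fundMap_injective [LieGroup 𝓘(ℝ, EG) ∞ G] [IsManifold 𝓘(ℝ, E) ∞ M]
    (hfree : ∀ (a : G) (x : M), a • x = x → a = 1) (x : M) :
    Function.Injective (fundMap (E := E) (EG := EG) (G := G) x) := by
  rw [injective_iff_map_eq_zero]
  intro e he
  have : CompleteSpace EG := FiniteDimensional.complete ℝ EG
  have : IsManifold 𝓘(ℝ, EG) ∞ G := inferInstance
  have : LieGroup 𝓘(ℝ, EG) (minSmoothness ℝ 3) G := by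
    rw [minSmoothness_of_isRCLikeNormedField]
    exact LieGroup.of_le (n := ∞) (by norm_cast)
  have hsm : ContMDiff 𝓘(ℝ, EG) 𝓘(ℝ, EG).tangent 1
      (fun a : G ↦ (⟨a, mulInvariantVectorField e a⟩ : TangentBundle 𝓘(ℝ, EG) G)) :=
    (contMDiff_mulInvariantVectorField e).of_le (by
      rw [minSmoothness_of_isRCLikeNormedField]; norm_num)
  obtain ⟨γ, hγ0, hγ⟩ := exists_isMIntegralCurveAt_of_contMDiffAt_boundaryless 0 (hsm 1)
  have h1 : ∀ᶠ t in 𝓝 (0 : ℝ), HasMFDerivAt 𝓘(ℝ, ℝ) 𝓘(ℝ, E) (fun t ↦ γ t • x) t 0 := by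
    filter_upwards [hγ] with t ht
    have h2 := ((contMDiff_smul_right E EG x).mdifferentiableAt (x := γ t)
      (by simp)).hasMFDerivAt.comp t ht
    refine h2.congr_mfderiv (ContinuousLinearMap.ext fun s : ℝ ↦ ?_)
    have h3 : mfderiv 𝓘(ℝ, EG) 𝓘(ℝ, E) (fun c : G ↦ c • x) (γ t)
        (mulInvariantVectorField e (γ t)) = 0 := by
      rw [mfderiv_orbit_mulInvariant, he, map_zero]
    exact (ContinuousLinearMap.map_smul (mfderiv 𝓘(ℝ, EG) 𝓘(ℝ, E) (fun c : G ↦ c • x) (γ t)) s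
      (mulInvariantVectorField e (γ t))).trans ((congrArg (fun z : E ↦ s • z) h3).trans
        (by exact smul_zero (M := ℝ) (A := E) s))
  have h4 : γ =ᶠ[𝓝 0] fun _ ↦ 1 := by
    filter_upwards [eventually_eq_of_hasMFDerivAt_zero h1] with t ht
    refine hfree _ x ?_
    rw [ht, hγ0, one_smul]
  have h5 := hγ.self_of_nhds.mfderiv
  have h6 := h4.mfderiv_eq (I := 𝓘(ℝ, ℝ)) (I' := 𝓘(ℝ, EG))
  have h7 : (mfderiv 𝓘(ℝ, ℝ) 𝓘(ℝ, EG) γ 0 : ℝ →L[ℝ] EG) = 0 := h6.trans mfderiv_const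
  have h8 : (mulInvariantVectorField e (γ 0) : EG) = 0 := by
    have := DFunLike.congr_fun (h5.symm.trans h7) (1 : ℝ)
    exact (one_smul ℝ (mulInvariantVectorField e (γ 0) : EG)).symm.trans this
  rw [hγ0] at h8
  have h9 : mfderiv 𝓘(ℝ, EG) 𝓘(ℝ, EG) (fun c : G ↦ 1 * c) 1 = mfderiv 𝓘(ℝ, EG) 𝓘(ℝ, EG)
      (id : G → G) 1 := by
    congr 1
    exact funext fun c ↦ one_mul c
  have h10 : (mfderiv 𝓘(ℝ, EG) 𝓘(ℝ, EG) (fun c : G ↦ 1 * c) 1 : EG →L[ℝ] EG) e = e := by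
    exact (DFunLike.congr_fun h9 e).trans (DFunLike.congr_fun mfderiv_id e)
  exact h10.symm.trans h8

theorem mem_range_fundMap_of_curve [FiniteDimensional ℝ E] [IsManifold 𝓘(ℝ, E) ∞ M] [T2Space M]
    [CompactSpace G] [LieGroup 𝓘(ℝ, EG) ∞ G]
    (hfree : ∀ (a : G) (x : M), a • x = x → a = 1) {x : M} {v : TangentSpace 𝓘(ℝ, E) x}
    {c : ℝ → M} (hc0 : c 0 = x) (hc : HasMFDerivAt 𝓘(ℝ, ℝ) 𝓘(ℝ, E) c 0
      (ContinuousLinearMap.toSpanSingleton ℝ (M₁ := E) v))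
    (horb : ∀ᶠ t in 𝓝 0, ∃ a : G, a • x = c t) :
    ∃ e : GroupLieAlgebra 𝓘(ℝ, EG) G, fundMap x e = v := by
  have : CompleteSpace EG := FiniteDimensional.complete ℝ EG
  let f : G → M := fun a ↦ a • x
  have hfs : ContMDiff 𝓘(ℝ, EG) 𝓘(ℝ, E) ∞ f := contMDiff_smul_right E EG x
  have hf1 : f 1 = x := one_smul G x
  have hfinj : Function.Injective f := by
    intro a b hab
    have h1 : (b⁻¹ * a) • x = x := by
      rw [mul_smul]
      exact inv_smul_eq_iff.2 hab
    exact (inv_mul_eq_one.1 (hfree _ x h1)).symm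
  have hemb : Topology.IsInducing f := (hfs.continuous.isClosedEmbedding hfinj).isInducing
  have hγ' : ∃ γ : ℝ → G, ∀ᶠ t in 𝓝 0, f (γ t) = c t := by
    classical
    refine ⟨fun t ↦ if h : ∃ a : G, a • x = c t then h.choose else 1, ?_⟩
    filter_upwards [horb] with t ht
    simp only [dif_pos ht]
    exact ht.choose_spec
  obtain ⟨γ, hγ⟩ := hγ'
  have hγ0 : γ 0 = 1 := hfinj (by rw [hγ.self_of_nhds, hc0, hf1])
  have hγc : Filter.Tendsto γ (𝓝 0) (𝓝 1) := by
    rw [hemb.tendsto_nhds_iff, hf1]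
    have h1 : Filter.Tendsto c (𝓝 0) (𝓝 x) := by
      have := hc.continuousAt
      rwa [ContinuousAt, hc0] at this
    exact h1.congr' (hγ.mono fun t ht ↦ ht.symm)
  let k := extChartAt 𝓘(ℝ, E) x
  let l := extChartAt 𝓘(ℝ, EG) (1 : G)
  let Φ : EG → E := fun y ↦ k (f (l.symm y))
  have hkf : ContMDiffAt 𝓘(ℝ, EG) 𝓘(ℝ, E) ∞ (fun a ↦ k (f a)) 1 := by
    refine ContMDiffAt.comp (I' := 𝓘(ℝ, E)) 1 (contMDiffAt_extChartAt' ?_) (hfs 1)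
    rw [hf1]
    exact mem_chart_source E x
  have hk3 (y : M) (hy : y = x) (w : E) : (mfderiv 𝓘(ℝ, E) 𝓘(ℝ, E) k y : E →L[ℝ] E) w = w := by
    subst hy; exact chartPush_self y w
  have hkd : MDifferentiableAt 𝓘(ℝ, E) 𝓘(ℝ, E) k x :=
    mdifferentiableAt_extChartAt (mem_chart_source E x)
  have hΦ : ContDiffAt ℝ ∞ Φ (l 1) := by
    exact (contMDiffAt_iff_comp_chart (E := EG) (mem_chart_source EG (1 : G))).1 hkf
  let A : EG →L[ℝ] E := fundMap (E := E) (EG := EG) (G := G) x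
  have hA : HasFDerivAt Φ A (l 1) := by
    have h1 : fderiv ℝ Φ (l 1) = A := by
      refine ContinuousLinearMap.ext fun w ↦ ?_
      refine (mvfderiv_eq_fderiv (E := EG) (x := (1 : G)) (hkf.mdifferentiableAt (by simp))
        w).symm.trans ?_
      have h2 := mvfderiv_comp_mfderiv (x := (1 : G)) (f := k) (p := f) (by rwa [hf1])
        ((hfs 1).mdifferentiableAt (by simp)) w
      exact h2.trans (hk3 (f 1) hf1 _)
    rw [← h1]
    exact (hΦ.differentiableAt (by simp)).hasFDerivAt
  have hAs : HasStrictFDerivAt Φ A (l 1) := by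
    have := hΦ.hasStrictFDerivAt (by simp)
    rwa [hA.fderiv] at this
  obtain ⟨L₀, hL₀⟩ := LinearMap.exists_leftInverse_of_injective (A : EG →ₗ[ℝ] E)
    (LinearMap.ker_eq_bot.2 (fundMap_injective hfree x))
  let L : E →L[ℝ] EG := LinearMap.toContinuousLinearMap L₀
  have hLΦ : HasStrictFDerivAt (fun y ↦ L (Φ y))
      ((ContinuousLinearEquiv.refl ℝ EG : EG ≃L[ℝ] EG) : EG →L[ℝ] EG) (l 1) := by
    have h1 := L.hasStrictFDerivAt.comp (l 1) hAs
    have h2 : L.comp A = ((ContinuousLinearEquiv.refl ℝ EG : EG ≃L[ℝ] EG) : EG →L[ℝ] EG) :=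
      ContinuousLinearMap.ext fun y ↦ DFunLike.congr_fun hL₀ y
    rwa [h2] at h1
  let u : ℝ → EG := fun t ↦ l (γ t)
  have hu0 : u 0 = l 1 := congrArg l hγ0
  have hut : Filter.Tendsto u (𝓝 0) (𝓝 (l 1)) :=
    ((continuousAt_extChartAt (I := 𝓘(ℝ, EG)) (1 : G)).tendsto).comp hγc
  have hΦu : ∀ᶠ t in 𝓝 0, Φ (u t) = k (c t) := by
    filter_upwards [hγ, hγc (extChartAt_source_mem_nhds (I := 𝓘(ℝ, EG)) (1 : G))] with t h1 h2
    change k (f (l.symm (l (γ t)))) = _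
    rw [l.left_inv h2, h1]
  have hkc : HasDerivAt (fun t ↦ k (c t)) (v : E) 0 := by
    have h1 : MDifferentiableAt 𝓘(ℝ, E) 𝓘(ℝ, E) k (c 0) := by rwa [hc0]
    let B : E →L[ℝ] E := mfderiv 𝓘(ℝ, E) 𝓘(ℝ, E) k (c 0)
    let C : ℝ →L[ℝ] E := ContinuousLinearMap.toSpanSingleton ℝ (M₁ := E) v
    have h2 : HasFDerivAt (fun t ↦ k (c t)) (B.comp C) 0 := (h1.hasMFDerivAt.comp 0 hc).hasFDerivAt
    refine h2.hasDerivAt.congr_deriv ?_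
    refine Eq.trans ?_ (hk3 (c 0) hc0 v)
    exact congrArg B (by exact one_smul (M := ℝ) (α := E) v)
  have hud : DifferentiableAt ℝ u 0 := by
    have h1 : DifferentiableAt ℝ (fun t ↦ hLΦ.localInverse _ _ _ (L (k (c t)))) 0 := by
      refine DifferentiableAt.comp (g := hLΦ.localInverse _ _ _) (f := fun t ↦ L (k (c t))) 0 ?_
        (L.differentiableAt.comp 0 hkc.differentiableAt)
      have h2 : L (k (c 0)) = L (Φ (l 1)) := by
        rw [← hΦu.self_of_nhds, hu0]
      rw [h2]
      exact hLΦ.to_localInverse.differentiableAt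
    refine h1.congr_of_eventuallyEq ?_
    filter_upwards [hΦu, hut.eventually hLΦ.eventually_left_inverse] with t h2 h3
    rw [← h2]
    exact h3.symm
  refine ⟨deriv u 0, ?_⟩
  have h1 : HasDerivAt (fun t ↦ Φ (u t)) (A (deriv u 0)) 0 := by
    have h2 : HasFDerivAt Φ A (u 0) := by rwa [hu0]
    exact h2.comp_hasDerivAt 0 hud.hasDerivAt
  have h2 := hkc.congr_of_eventuallyEq hΦu
  exact h1.unique h2

end OrbitMaps

section ConnectionForms

variable {E : Type*} [NormedAddCommGroup E] [NormedSpace ℝ E]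
  {EG : Type*} [NormedAddCommGroup EG] [NormedSpace ℝ EG]
  {M : Type*} [TopologicalSpace M] [ChartedSpace E M]
  {G : Type*} [TopologicalSpace G] [ChartedSpace EG G] [Group G]
  [MulAction G M]

attribute [local instance] isManifold_one isManifold_two

theorem adjoint_adjoint_inv [LieGroup 𝓘(ℝ, EG) ∞ G] (a : G) (e : GroupLieAlgebra 𝓘(ℝ, EG) G) :
    adjoint EG a (adjoint EG a⁻¹ e) = e := by
  have hc (a : G) : ContMDiff 𝓘(ℝ, EG) 𝓘(ℝ, EG) ∞ fun c : G ↦ a * c * a⁻¹ :=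
    (contMDiff_mul_right (I := 𝓘(ℝ, EG)) (n := ∞) (a := a⁻¹)).comp
      (contMDiff_mul_left (I := 𝓘(ℝ, EG)) (n := ∞) (a := a))
  have h1 := mfderiv_comp_of_eq (g := fun c : G ↦ a * c * a⁻¹) (f := fun c : G ↦ a⁻¹ * c * a⁻¹⁻¹)
    (x := 1) (y := 1) ((hc a).mdifferentiableAt (by simp)) ((hc a⁻¹).mdifferentiableAt (by simp))
    (by simp)
  have h2 : ((fun c : G ↦ a * c * a⁻¹) ∘ fun c : G ↦ a⁻¹ * c * a⁻¹⁻¹) = id :=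
    funext fun c ↦ by simp [mul_assoc]
  have h3 : (mfderiv 𝓘(ℝ, EG) 𝓘(ℝ, EG)
      ((fun c : G ↦ a * c * a⁻¹) ∘ fun c : G ↦ a⁻¹ * c * a⁻¹⁻¹) 1 : EG →L[ℝ] EG)
      = ContinuousLinearMap.id ℝ EG := by
    rw [h2]; exact mfderiv_id
  have h5 : (mfderiv 𝓘(ℝ, EG) 𝓘(ℝ, EG) (fun c : G ↦ a * c * a⁻¹) (a⁻¹ * 1 * a⁻¹⁻¹) :
      EG →L[ℝ] EG) = mfderiv 𝓘(ℝ, EG) 𝓘(ℝ, EG) (fun c : G ↦ a * c * a⁻¹) 1 := by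
    rw [mul_one, mul_inv_cancel]
  exact (DFunLike.congr_fun h5 _).symm.trans (DFunLike.congr_fun (h1.symm.trans h3) e)

theorem fundMap_smul_eq [LieGroup 𝓘(ℝ, EG) ∞ G] [ContMDiffSMul 𝓘(ℝ, EG) 𝓘(ℝ, E) ∞ G M] (a : G)
    (x : M) (e : GroupLieAlgebra 𝓘(ℝ, EG) G) :
    fundMap (E := E) (a • x) e = actDeriv E a x (fundMap x (adjoint EG a⁻¹ e)) := by
  rw [actDeriv_fundMap, adjoint_adjoint_inv]

variable [IsManifold 𝓘(ℝ, E) ∞ M] {g : RMetric E M} {H : Form E M 3}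
  {ξ : GroupLieAlgebra 𝓘(ℝ, EG) G →ₗ[ℝ] CovField E M} {ι : Type*}
  (b : Module.Basis ι ℝ (GroupLieAlgebra 𝓘(ℝ, EG) G)) {s : ℝ}

omit [IsManifold 𝓘(ℝ, E) ∞ M] in
theorem IsClosedEquivariantExtension.antisymm (hξ : IsClosedEquivariantExtension H ξ)
    (φ ψ : GroupLieAlgebra 𝓘(ℝ, EG) G) (x : M) :
    ξ φ x (fundMap x ψ) = - ξ ψ x (fundMap x φ) := by
  have h := hξ.degree_zero (φ + ψ) x
  have h1 : ξ (φ + ψ) x = ξ φ x + ξ ψ x := by rw [map_add]; rfl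
  have h2 := hξ.degree_zero φ x
  have h3 := hξ.degree_zero ψ x
  rw [h1, map_add (fundMap x) φ ψ] at h
  simp only [add_apply, map_add] at h
  linarith

omit [IsManifold 𝓘(ℝ, E) ∞ M] in
theorem IsClosedEquivariantExtension.apply_actDeriv [LieGroup 𝓘(ℝ, EG) ∞ G]
    (hξ : IsClosedEquivariantExtension H ξ) (a : G) (e : GroupLieAlgebra 𝓘(ℝ, EG) G) (x : M)
    (u : TangentSpace 𝓘(ℝ, E) x) :
    ξ e (a • x) (actDeriv E a x u) = ξ (adjoint EG a⁻¹ e) x u := by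
  have h := DFunLike.congr_fun (hξ.equivariant a (adjoint EG a⁻¹ e) x) u
  rw [adjoint_adjoint_inv] at h
  exact h

theorem tau_actDeriv [LieGroup 𝓘(ℝ, EG) ∞ G] [ContMDiffSMul 𝓘(ℝ, EG) 𝓘(ℝ, E) ∞ G M]
    (hg : MetricInvariant G g) (hξ : IsClosedEquivariantExtension H ξ) (a : G) {x : M}
    {u : TangentSpace 𝓘(ℝ, E) x} (hu : u ∈ tau g ξ s x) :
    actDeriv E a x u ∈ tau g ξ s (a • x) := by
  intro e
  rw [fundMap_smul_eq, hg, hξ.apply_actDeriv]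
  exact hu _

theorem RMetric.eq_zero {x : M} {u : TangentSpace 𝓘(ℝ, E) x} (g : RMetric E M)
    (h : g.inner x u u = 0) : u = 0 := by
  by_contra hu
  exact (g.pos x u hu).ne' h

variable (g ξ s) in
/-- The linear map whose kernel is `τ_s`. -/
def tauMap (x : M) : TangentSpace 𝓘(ℝ, E) x →L[ℝ] (ι → ℝ) :=
  ContinuousLinearMap.pi fun i ↦ g.inner x (fundMap x (b i)) + s • ξ (b i) x

theorem tauMap_apply (x : M) (u : TangentSpace 𝓘(ℝ, E) x) (i : ι) :
    tauMap g ξ b s x u i = g.inner x u (fundMap x (b i)) + s * ξ (b i) x u := by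
  rw [g.symm]
  rfl

theorem mem_tau_iff {x : M} {u : TangentSpace 𝓘(ℝ, E) x} :
    u ∈ tau g ξ s x ↔ tauMap g ξ b s x u = 0 := by
  let l : GroupLieAlgebra 𝓘(ℝ, EG) G →ₗ[ℝ] ℝ :=
    { toFun e := g.inner x u (fundMap x e) + s * ξ e x u
      map_add' e f := by
        have h1 : ξ (e + f) x = ξ e x + ξ f x := by rw [map_add]; rfl
        have h2 : fundMap (E := E) x (e + f) = fundMap x e + fundMap x f := map_add _ e f
        rw [h1, h2, map_add, add_apply]
        ring
      map_smul' c e := by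
        have h1 : ξ (c • e) x = c • ξ e x := by rw [map_smul]; rfl
        have h2 : fundMap (E := E) x (c • e) = c • fundMap x e := map_smul _ c e
        rw [h1, h2, map_smul, smul_apply, smul_eq_mul, smul_eq_mul, RingHom.id_apply, smul_eq_mul]
        ring }
  constructor
  · intro h
    ext i
    rw [tauMap_apply]
    exact h (b i)
  · intro h e
    have : l = 0 := b.ext fun i ↦ by
      change g.inner x u (fundMap x (b i)) + s * ξ (b i) x u = 0
      rw [← tauMap_apply, h]
      rfl
    exact DFunLike.congr_fun this e

variable (g ξ s) in
/-- The restriction of `tauMap` to the vertical directions. -/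
def vertMap (x : M) : EG →L[ℝ] (ι → ℝ) :=
  (tauMap g ξ b s x).comp (fundMap (E := E) (EG := EG) (G := G) x)

theorem eq_zero_of_fundMap_mem_tau (hξ : IsClosedEquivariantExtension H ξ) {x : M}
    (hinj : Function.Injective (fundMap (E := E) (EG := EG) (G := G) x))
    {e : GroupLieAlgebra 𝓘(ℝ, EG) G} (h : fundMap x e ∈ tau g ξ s x) : e = 0 := by
  have h1 := h e
  rw [hξ.degree_zero, mul_zero, add_zero] at h1
  exact hinj ((g.eq_zero h1).trans (map_zero _).symm)

variable [FiniteDimensional ℝ EG] [Fintype ι]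

theorem vertMap_isInvertible (hξ : IsClosedEquivariantExtension H ξ) {x : M}
    (hinj : Function.Injective (fundMap (E := E) (EG := EG) (G := G) x)) :
    (vertMap g ξ b s x).IsInvertible := by
  let B : EG →ₗ[ℝ] (ι → ℝ) := vertMap g ξ b s x
  have hB : Function.Injective B := by
    rw [injective_iff_map_eq_zero]
    intro e he
    exact eq_zero_of_fundMap_mem_tau hξ hinj ((mem_tau_iff b).2 he)
  have hd : Module.finrank ℝ EG = Module.finrank ℝ (ι → ℝ) := by
    rw [Module.finrank_fintype_fun_eq_card]
    exact Module.finrank_eq_card_basis (M := EG) b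
  exact ⟨(LinearEquiv.ofInjectiveOfFinrankEq B hB hd).toContinuousLinearEquiv,
    ContinuousLinearMap.ext fun e ↦ rfl⟩

variable (g ξ s) in
/-- The connection form with horizontal distribution `τ_s`. -/
def connForm (x : M) : TangentSpace 𝓘(ℝ, E) x →L[ℝ] GroupLieAlgebra 𝓘(ℝ, EG) G :=
  (vertMap g ξ b s x).inverse.comp (tauMap g ξ b s x)

theorem connForm_fundMap (hξ : IsClosedEquivariantExtension H ξ) {x : M}
    (hinj : Function.Injective (fundMap (E := E) (EG := EG) (G := G) x))
    (e : GroupLieAlgebra 𝓘(ℝ, EG) G) : connForm g ξ b s x (fundMap x e) = e :=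
  DFunLike.congr_fun (vertMap_isInvertible b hξ hinj).inverse_comp_self e

theorem connForm_eq_zero_iff (hξ : IsClosedEquivariantExtension H ξ) {x : M}
    (hinj : Function.Injective (fundMap (E := E) (EG := EG) (G := G) x))
    {u : TangentSpace 𝓘(ℝ, E) x} : connForm g ξ b s x u = 0 ↔ u ∈ tau g ξ s x := by
  rw [mem_tau_iff b]
  constructor
  · intro h
    have h1 := DFunLike.congr_fun (vertMap_isInvertible (g := g) (s := s) b hξ hinj).self_comp_inverse
      (tauMap g ξ b s x u)
    refine h1.symm.trans ?_
    exact (congrArg (vertMap g ξ b s x) h).trans (map_zero _)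
  · intro h
    exact (congrArg (vertMap g ξ b s x).inverse h).trans
      (map_zero _)

theorem sub_fundMap_connForm_mem_tau (hξ : IsClosedEquivariantExtension H ξ) {x : M}
    (hinj : Function.Injective (fundMap (E := E) (EG := EG) (G := G) x))
    (u : TangentSpace 𝓘(ℝ, E) x) :
    u - fundMap x (connForm g ξ b s x u) ∈ tau g ξ s x := by
  rw [← connForm_eq_zero_iff b hξ hinj, map_sub, connForm_fundMap b hξ hinj, sub_self]

theorem isConnectionForm_connForm [LieGroup 𝓘(ℝ, EG) ∞ G]
    [ContMDiffSMul 𝓘(ℝ, EG) 𝓘(ℝ, E) ∞ G M] (hg : MetricInvariant G g)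
    (hξ : IsClosedEquivariantExtension H ξ)
    (hinj : ∀ x, Function.Injective (fundMap (E := E) (EG := EG) (G := G) (M := M) x)) :
    IsConnectionForm (tau g ξ s) (connForm g ξ b s) where
  vertical x e := connForm_fundMap b hξ (hinj x) e
  ker_eq x u := connForm_eq_zero_iff b hξ (hinj x)
  equivariant a x u := by
    have h1 := tau_actDeriv hg hξ a (sub_fundMap_connForm_mem_tau (g := g) (s := s) b hξ (hinj x) u)
    rw [← connForm_eq_zero_iff b hξ (hinj (a • x)), map_sub, map_sub, actDeriv_fundMap,
      connForm_fundMap b hξ (hinj (a • x))] at h1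
    exact sub_eq_zero.1 h1

variable {EN : Type*} [NormedAddCommGroup EN] [NormedSpace ℝ EN]
  {N : Type*} [TopologicalSpace N] [ChartedSpace EN N] {p : M → N}

theorem bijOn_mfderiv_tau (hξ : IsClosedEquivariantExtension H ξ) {x : M}
    (hinj : Function.Injective (fundMap (E := E) (EG := EG) (G := G) x))
    (hsurj : Function.Surjective (mfderiv 𝓘(ℝ, E) 𝓘(ℝ, EN) p x))
    (hker : ∀ u, mfderiv 𝓘(ℝ, E) 𝓘(ℝ, EN) p x u = 0 ↔
      u ∈ range (fundMap (E := E) (EG := EG) (G := G) x)) :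
    BijOn (mfderiv 𝓘(ℝ, E) 𝓘(ℝ, EN) p x) (tau g ξ s x) univ := by
  refine ⟨mapsTo_univ _ _, fun u hu v hv huv ↦ ?_, fun a _ ↦ ?_⟩
  · have h1 : mfderiv 𝓘(ℝ, E) 𝓘(ℝ, EN) p x (u - v) = 0 := by
      rw [map_sub]; exact sub_eq_zero.2 huv
    obtain ⟨e, he⟩ := (hker _).1 h1
    let b := Module.finBasis ℝ EG
    have h2 : fundMap x e ∈ tau g ξ s x := by
      rw [he, mem_tau_iff (G := G) (EG := EG) b, map_sub, (mem_tau_iff b).1 hu,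
        (mem_tau_iff b).1 hv, sub_zero]
    rw [eq_zero_of_fundMap_mem_tau hξ hinj h2, map_zero] at he
    exact (sub_eq_zero.1 he.symm)
  · obtain ⟨u, hu⟩ := hsurj a
    let b := Module.finBasis ℝ EG
    refine ⟨u - fundMap x (connForm g ξ (EG := EG) (G := G) b s x u),
      sub_fundMap_connForm_mem_tau _ hξ hinj u, ?_⟩
    rw [map_sub, hu, (hker _).2 ⟨_, rfl⟩, sub_zero]

end ConnectionForms

section HorizontalLifts

set_option linter.unusedSectionVars false

variable {E : Type*} [NormedAddCommGroup E] [NormedSpace ℝ E]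
  {EG : Type*} [NormedAddCommGroup EG] [NormedSpace ℝ EG]
  {EN : Type*} [NormedAddCommGroup EN] [NormedSpace ℝ EN]
  {M : Type*} [TopologicalSpace M] [ChartedSpace E M] [IsManifold 𝓘(ℝ, E) ∞ M]
  {N : Type*} [TopologicalSpace N] [ChartedSpace EN N] [IsManifold 𝓘(ℝ, EN) ∞ N]
  {G : Type*} [TopologicalSpace G] [ChartedSpace EG G] [Group G] [MulAction G M]

attribute [local instance] isManifold_one isManifold_two

variable (EN) in
/-- `p : M → N` is the quotient of a generalized Riemannian manifold by a free extended action. -/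
structure IsReduction (p : M → N) (g : RMetric E M) (H : Form E M 3)
    (ξ : GroupLieAlgebra 𝓘(ℝ, EG) G →ₗ[ℝ] CovField E M) : Prop where
  free : ∀ (a : G) (x : M), a • x = x → a = 1
  submersion : IsSubmersion 𝓘(ℝ, E) 𝓘(ℝ, EN) ∞ p
  surjective : Function.Surjective p
  proj_smul : ∀ (a : G) (x : M), p (a • x) = p x
  exists_smul : ∀ {x y : M}, p x = p y → ∃ a : G, a • y = x
  metric : MetricInvariant G g
  formSmooth : FormSmooth H
  formInvariant : FormInvariant G H
  extension : IsClosedEquivariantExtension H ξ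

/-- The lift to `τ_s` of a tangent vector of the quotient. -/
def horLift (p : M → N) (g : RMetric E M)
    (ξ : GroupLieAlgebra 𝓘(ℝ, EG) G →ₗ[ℝ] CovField E M) (s : ℝ) (x : M)
    (a : TangentSpace 𝓘(ℝ, EN) (p x)) : TangentSpace 𝓘(ℝ, E) x :=
  Function.invFunOn (mfderiv 𝓘(ℝ, E) 𝓘(ℝ, EN) p x) (tau g ξ s x) a

theorem contMDiff_inner_apply (g : RMetric E M) {X Y : VField E M} (hX : IsSmoothVField X)
    (hY : IsSmoothVField Y) : ContMDiff 𝓘(ℝ, E) 𝓘(ℝ, ℝ) ∞ fun x ↦ g.inner x (X x) (Y x) := by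
  have := ContMDiff.clm_bundle_apply₂ (F₃ := ℝ) (E₃ := fun _ : M ↦ ℝ) g.contMDiff hX hY
  intro x
  exact (contMDiffAt_totalSpace.1 (this x)).2

theorem isSmoothVField_of_bijective [FiniteDimensional ℝ E] [T2Space M] {X : VField E M}
    {F : Type*} [NormedAddCommGroup F] [NormedSpace ℝ F] [FiniteDimensional ℝ F]
    (h : ∀ x₀, ∃ L : Π x : M, TangentSpace 𝓘(ℝ, E) x →L[ℝ] F, CovSmooth L ∧
      Function.Bijective (L x₀) ∧ ContMDiffAt 𝓘(ℝ, E) 𝓘(ℝ, F) ∞ (fun x ↦ L x (X x)) x₀) :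
    IsSmoothVField X := by
  have : CompleteSpace E := FiniteDimensional.complete ℝ E
  refine isSmoothVField_of_push fun x₀ ↦ ?_
  obtain ⟨L, hL, hb, hLX⟩ := h x₀
  have h1 := hL.contMDiffAt_covRep (mem_chart_source E x₀)
  have hb' : Function.Bijective (covRep L x₀ x₀) := by
    have : ⇑(covRep L x₀ x₀) = ⇑(L x₀) := funext fun v ↦ covRep_self L x₀ v
    rw [this]; exact hb
  let e : E ≃L[ℝ] F := (LinearEquiv.ofBijective (covRep L x₀ x₀ : E →ₗ[ℝ] F)
    hb').toContinuousLinearEquiv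
  have he : (e : E →L[ℝ] F) = covRep L x₀ x₀ := ContinuousLinearMap.ext fun v ↦ rfl
  have h2 : ContMDiffAt 𝓘(ℝ, E) 𝓘(ℝ, F →L[ℝ] E) ∞
      (fun z ↦ (covRep L x₀ z).inverse) x₀ := by
    have h3 : ContDiffAt ℝ ∞ ContinuousLinearMap.inverse (covRep L x₀ x₀) := by
      rw [← he]; exact contDiffAt_map_inverse e
    exact h3.contMDiffAt.comp x₀ h1
  refine (h2.clm_apply hLX).congr_of_eventuallyEq ?_
  have h4 : ∀ᶠ z in 𝓝 x₀, covRep L x₀ z ∈ range ((↑) : (E ≃L[ℝ] F) → E →L[ℝ] F) := by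
    refine h1.continuousAt.eventually_mem ?_
    rw [← he]
    exact ContinuousLinearEquiv.nhds e
  filter_upwards [h4, (chartAt E x₀).open_source.mem_nhds (mem_chart_source E x₀)] with z hz hzs
  have h5 : (covRep L x₀ z).IsInvertible := hz
  rw [← covRep_chartPush L hzs (X z)]
  exact (DFunLike.congr_fun h5.inverse_comp_self (chartPush x₀ z (X z))).symm

variable {p : M → N} {g : RMetric E M} {H : Form E M 3}
  {ξ : GroupLieAlgebra 𝓘(ℝ, EG) G →ₗ[ℝ] CovField E M}
  [FiniteDimensional ℝ E] [FiniteDimensional ℝ EG]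
  [CompactSpace G] [LieGroup 𝓘(ℝ, EG) ∞ G] [ContMDiffSMul 𝓘(ℝ, EG) 𝓘(ℝ, E) ∞ G M]
  {s : ℝ}

namespace IsReduction

theorem injective (S : IsReduction EN p g H ξ) (x : M) :
    Function.Injective (fundMap (E := E) (EG := EG) (G := G) x) := fundMap_injective S.free x

theorem mdifferentiable (S : IsReduction EN p g H ξ) : MDifferentiable 𝓘(ℝ, E) 𝓘(ℝ, EN) p :=
  S.submersion.contMDiff.mdifferentiable (by simp)

theorem mfderiv_fundMap (S : IsReduction EN p g H ξ) (x : M) (e : GroupLieAlgebra 𝓘(ℝ, EG) G) :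
    mfderiv 𝓘(ℝ, E) 𝓘(ℝ, EN) p x (fundMap x e) = 0 :=
  mfderiv_fundMap_of_invariant S.proj_smul S.mdifferentiable x e

theorem mfderiv_eq_zero_iff [T2Space M] (S : IsReduction EN p g H ξ) {x : M}
    {u : TangentSpace 𝓘(ℝ, E) x} : mfderiv 𝓘(ℝ, E) 𝓘(ℝ, EN) p x u = 0 ↔
      u ∈ range (fundMap (E := E) (EG := EG) (G := G) x) := by
  constructor
  · intro hu
    obtain ⟨c, hc0, hc, hpc⟩ := exists_curve_in_fibre (S.submersion.isSubmersionAt x) hu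
    refine mem_range_fundMap_of_curve S.free hc0 hc ?_
    filter_upwards [hpc] with t ht
    exact S.exists_smul ht
  · rintro ⟨e, rfl⟩
    exact S.mfderiv_fundMap x e

variable [T2Space M]

theorem bijOn (S : IsReduction EN p g H ξ) (s : ℝ) (x : M) :
    BijOn (mfderiv 𝓘(ℝ, E) 𝓘(ℝ, EN) p x) (tau g ξ s x) univ :=
  bijOn_mfderiv_tau S.extension (S.injective x)
    (mfderiv_surjective_of_isSubmersionAt (S.submersion.isSubmersionAt x))
    fun _ ↦ S.mfderiv_eq_zero_iff

theorem horLift_mem (S : IsReduction EN p g H ξ) {x : M} (a : TangentSpace 𝓘(ℝ, EN) (p x)) :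
    horLift p g ξ s x a ∈ tau g ξ s x :=
  Function.invFunOn_mem (by
    obtain ⟨u, hu, h⟩ := (S.bijOn s x).surjOn (mem_univ a)
    exact ⟨u, hu, h⟩)

theorem mfderiv_horLift (S : IsReduction EN p g H ξ) {x : M} (a : TangentSpace 𝓘(ℝ, EN) (p x)) :
    mfderiv 𝓘(ℝ, E) 𝓘(ℝ, EN) p x (horLift p g ξ s x a) = a :=
  Function.invFunOn_eq (by
    obtain ⟨u, hu, h⟩ := (S.bijOn s x).surjOn (mem_univ a)
    exact ⟨u, hu, h⟩)

theorem horLift_eq (S : IsReduction EN p g H ξ) {x : M} {a : TangentSpace 𝓘(ℝ, EN) (p x)}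
    {u : TangentSpace 𝓘(ℝ, E) x} (hu : u ∈ tau g ξ s x)
    (h : mfderiv 𝓘(ℝ, E) 𝓘(ℝ, EN) p x u = a) : horLift p g ξ s x a = u :=
  (S.bijOn s x).injOn (S.horLift_mem a) hu ((S.mfderiv_horLift a).trans h.symm)

theorem horLift_mfderiv (S : IsReduction EN p g H ξ) {x : M} {u : TangentSpace 𝓘(ℝ, E) x}
    (hu : u ∈ tau g ξ s x) :
    horLift p g ξ s x (mfderiv 𝓘(ℝ, E) 𝓘(ℝ, EN) p x u) = u := S.horLift_eq hu rfl

theorem horLift_add (S : IsReduction EN p g H ξ) {x : M} (a a' : TangentSpace 𝓘(ℝ, EN) (p x)) :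
    horLift p g ξ s x (a + a') = horLift p g ξ s x a + horLift p g ξ s x a' := by
  let b := Module.finBasis ℝ EG
  refine S.horLift_eq ?_ ?_
  · rw [mem_tau_iff (G := G) (EG := EG) b, map_add, (mem_tau_iff b).1 (S.horLift_mem a),
      (mem_tau_iff b).1 (S.horLift_mem a'), add_zero]
  · rw [map_add, S.mfderiv_horLift, S.mfderiv_horLift]

theorem horLift_smul (S : IsReduction EN p g H ξ) {x : M} (c : ℝ)
    (a : TangentSpace 𝓘(ℝ, EN) (p x)) :
    horLift p g ξ s x (c • a) = c • horLift p g ξ s x a := by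
  let b := Module.finBasis ℝ EG
  refine S.horLift_eq ?_ ?_
  · rw [mem_tau_iff (G := G) (EG := EG) b, map_smul, (mem_tau_iff b).1 (S.horLift_mem a),
      smul_zero]
  · rw [map_smul, S.mfderiv_horLift]

theorem actDeriv_horLift (S : IsReduction EN p g H ξ) (X : VField EN N) (a : G) (x : M) :
    actDeriv E a x (horLift p g ξ s x (X (p x))) = horLift p g ξ s (a • x) (X (p (a • x))) := by
  refine (S.horLift_eq (tau_actDeriv S.metric S.extension a (S.horLift_mem _)) ?_).symm
  have h1 := mfderiv_actDeriv_of_invariant EG S.proj_smul S.mdifferentiable a x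
    (horLift p g ξ s x (X (p x)))
  have h2 : (X (p (a • x)) : EN) = X (p x) := by rw [S.proj_smul]
  exact h1.trans ((S.mfderiv_horLift (X (p x))).trans h2.symm)

variable {ι : Type*} [Fintype ι] (b : Module.Basis ι ℝ (GroupLieAlgebra 𝓘(ℝ, EG) G))

theorem covSmooth_tauMap (S : IsReduction EN p g H ξ) : CovSmooth (tauMap g ξ b s) := by
  intro X hX
  refine contMDiff_pi_space.2 fun i ↦ ?_
  have h1 := (contMDiff_inner_apply g (isSmoothVField_fundMap (b i)) hX).add
    (contMDiff_const (c := s) |>.mul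
      (covSmooth_of_formSmooth (S.extension.smooth (b i)) X hX))
  exact h1

theorem contMDiff_vertMap (S : IsReduction EN p g H ξ) :
    ContMDiff 𝓘(ℝ, E) 𝓘(ℝ, EG →L[ℝ] (ι → ℝ)) ∞ (vertMap g ξ b s) := fun _ ↦
  contMDiffAt_clm_of_apply fun e ↦ S.covSmooth_tauMap b _ (isSmoothVField_fundMap e) _

theorem covSmooth_connForm (S : IsReduction EN p g H ξ) :
    CovSmooth (F := EG) (connForm g ξ b s) := by
  have : CompleteSpace EG := FiniteDimensional.complete ℝ EG
  intro X hX x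
  have h1 : ContMDiffAt 𝓘(ℝ, E) 𝓘(ℝ, (ι → ℝ) →L[ℝ] EG) ∞
      (fun z ↦ (vertMap g ξ b s z).inverse) x := by
    have h3 : ContDiffAt ℝ ∞ ContinuousLinearMap.inverse (vertMap g ξ b s x) :=
      (vertMap_isInvertible b S.extension (S.injective x)).contDiffAt_map_inverse
    exact h3.contMDiffAt.comp x (S.contMDiff_vertMap b x)
  exact h1.clm_apply (S.covSmooth_tauMap b X hX x)

theorem isSmoothVField_horLift [FiniteDimensional ℝ EN] [T2Space N] (S : IsReduction EN p g H ξ)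
    {X : VField EN N} (hX : IsSmoothVField X) :
    IsSmoothVField fun x ↦ horLift p g ξ s x (X (p x)) := by
  let b := Module.finBasis ℝ EG
  refine isSmoothVField_of_bijective (F := EN × (Fin (Module.finrank ℝ EG) → ℝ)) fun x₀ ↦ ?_
  obtain ⟨φ, hφ, hφx⟩ := exists_contMDiff_mvfderiv_eq_id (E := EN) (M := N) (p x₀)
  have hφp : ContMDiff 𝓘(ℝ, E) 𝓘(ℝ, EN) ∞ fun z ↦ φ (p z) := hφ.comp S.submersion.contMDiff
  have hd (x : M) (u : TangentSpace 𝓘(ℝ, E) x) : mvfderiv 𝓘(ℝ, E) (fun z ↦ φ (p z)) x u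
      = mvfderiv 𝓘(ℝ, EN) φ (p x) (mfderiv 𝓘(ℝ, E) 𝓘(ℝ, EN) p x u) :=
    mvfderiv_comp_mfderiv ((hφ _).mdifferentiableAt (by simp)) (S.mdifferentiable x) u
  have hd₀ (u : TangentSpace 𝓘(ℝ, E) x₀) : mvfderiv 𝓘(ℝ, E) (fun z ↦ φ (p z)) x₀ u
      = mfderiv 𝓘(ℝ, E) 𝓘(ℝ, EN) p x₀ u := (hd x₀ u).trans (hφx _)
  let C : Π x : M, TangentSpace 𝓘(ℝ, E) x →L[ℝ] (Fin (Module.finrank ℝ EG) → ℝ) :=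
    tauMap (EG := EG) (G := G) g ξ b s
  refine ⟨fun x ↦ (mvfderiv 𝓘(ℝ, E) (fun z ↦ φ (p z)) x).prod (C x), ?_, ?_, ?_⟩
  · intro Y hY
    exact (covSmooth_mvfderiv hφp Y hY).prodMk_space (S.covSmooth_tauMap b Y hY)
  · constructor
    · rw [injective_iff_map_eq_zero]
      intro u hu
      obtain ⟨h1, h2⟩ := Prod.mk.inj hu
      have h3 : u ∈ tau g ξ s x₀ := (mem_tau_iff b).2 h2
      have h4 : (0 : TangentSpace 𝓘(ℝ, E) x₀) ∈ tau g ξ s x₀ := (mem_tau_iff b).2 (map_zero _)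
      exact (S.bijOn s x₀).injOn h3 h4 (((hd₀ u).symm.trans h1).trans (map_zero _).symm)
    · rintro ⟨a, c⟩
      obtain ⟨u, hu⟩ := mfderiv_surjective_of_isSubmersionAt (S.submersion.isSubmersionAt x₀) a
      have hv := vertMap_isInvertible (g := g) (s := s) b S.extension (S.injective x₀)
      let e : EG := (vertMap (EG := EG) (G := G) g ξ b s x₀).inverse (c - C x₀ u)
      have he : C x₀ (fundMap (E := E) (EG := EG) (G := G) x₀ e) = c - C x₀ u :=
        DFunLike.congr_fun hv.self_comp_inverse (c - C x₀ u)
      refine ⟨u + fundMap (E := E) (EG := EG) (G := G) x₀ e, Prod.ext ?_ ?_⟩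
      · refine (hd₀ _).trans ?_
        rw [map_add]
        exact (congrArg₂ (fun y z : EN ↦ y + z) hu (S.mfderiv_fundMap x₀ e)).trans (add_zero a)
      · change C x₀ (u + _) = c
        rw [map_add, he]
        exact add_sub_cancel _ _
  · have h1 : ContMDiffAt 𝓘(ℝ, E) 𝓘(ℝ, EN) ∞ (fun x ↦ mvfderiv 𝓘(ℝ, EN) φ (p x) (X (p x))) x₀ :=
      ((covSmooth_mvfderiv hφ X hX).comp S.submersion.contMDiff) x₀
    have h2 : ContMDiffAt 𝓘(ℝ, E) 𝓘(ℝ, Fin (Module.finrank ℝ EG) → ℝ) ∞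
      (fun _ : M ↦ (0 : Fin (Module.finrank ℝ EG) → ℝ)) x₀ := contMDiffAt_const
    convert! h1.prodMk_space h2 using 2 with x
    refine Prod.ext ?_ ?_
    · refine (hd _ _).trans ?_
      rw [S.mfderiv_horLift]
    · exact (mem_tau_iff b).1 (S.horLift_mem _)

end IsReduction

end HorizontalLifts

section InvariantFields

set_option linter.unusedSectionVars false

variable {E : Type*} [NormedAddCommGroup E] [NormedSpace ℝ E] [FiniteDimensional ℝ E]
  {EG : Type*} [NormedAddCommGroup EG] [NormedSpace ℝ EG]
  {M : Type*} [TopologicalSpace M] [ChartedSpace E M] [IsManifold 𝓘(ℝ, E) ∞ M] [T2Space M]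
  {G : Type*} [TopologicalSpace G] [ChartedSpace EG G] [Group G] [MulAction G M]

attribute [local instance] isManifold_one isManifold_two

variable (G) in
/-- Invariance of a vector field under the action. -/
def VFieldInvariant (X : VField E M) : Prop :=
  ∀ (a : G) (x : M), actDeriv E a x (X x) = X (a • x)

variable (EG) in
theorem VFieldInvariant.mlieBracket [ContMDiffSMul 𝓘(ℝ, EG) 𝓘(ℝ, E) ∞ G M] {X Y : VField E M}
    (hXi : VFieldInvariant G X) (hYi : VFieldInvariant G Y) (hX : IsSmoothVField X)
    (hY : IsSmoothVField Y) : VFieldInvariant G (mlieBracket 𝓘(ℝ, E) X Y) := fun a x ↦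
  mfderiv_mlieBracket_of_related (contMDiff_smul_left E EG a) hX hY hX hY (hXi a) (hYi a) x

theorem fderiv_fderiv_prod_comm {E₁ E₂ F : Type*} [NormedAddCommGroup E₁] [NormedSpace ℝ E₁]
    [NormedAddCommGroup E₂] [NormedSpace ℝ E₂] [NormedAddCommGroup F] [NormedSpace ℝ F]
    {Φ : E₁ × E₂ → F} {s₀ : E₁} {y₀ : E₂} (hΦ : ContDiffAt ℝ ∞ Φ (s₀, y₀)) (e : E₁) (w : E₂) :
    fderiv ℝ (fun s ↦ fderiv ℝ (fun y ↦ Φ (s, y)) y₀ w) s₀ e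
      = fderiv ℝ (fun y ↦ fderiv ℝ (fun s ↦ Φ (s, y)) s₀ e) y₀ w := by
  have hd : ∀ᶠ q in 𝓝 (s₀, y₀), DifferentiableAt ℝ Φ q := by
    have h1 : ContDiffAt ℝ 1 Φ (s₀, y₀) := hΦ.of_le (by norm_cast)
    filter_upwards [h1.eventually (by simp)] with q hq
    exact hq.differentiableAt (by simp)
  have hdd : HasFDerivAt (fderiv ℝ Φ) (fderiv ℝ (fderiv ℝ Φ) (s₀, y₀)) (s₀, y₀) :=
    ((hΦ.fderiv_right (m := 1) (by norm_cast)).differentiableAt (by simp)).hasFDerivAt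
  have hs : HasFDerivAt (fun s : E₁ ↦ (s, y₀)) (ContinuousLinearMap.inl ℝ E₁ E₂) s₀ :=
    hasFDerivAt_prodMk_left s₀ y₀
  have hy : HasFDerivAt (fun y : E₂ ↦ (s₀, y)) (ContinuousLinearMap.inr ℝ E₁ E₂) y₀ :=
    hasFDerivAt_prodMk_right s₀ y₀
  have e1 : (fun s ↦ fderiv ℝ (fun y ↦ Φ (s, y)) y₀ w) =ᶠ[𝓝 s₀]
      fun s ↦ fderiv ℝ Φ (s, y₀) (0, w) := by
    filter_upwards [hs.continuousAt.eventually hd] with s h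
    have := h.hasFDerivAt.comp y₀ (hasFDerivAt_prodMk_right s y₀)
    exact congrArg (fun l : E₂ →L[ℝ] F ↦ l w) this.fderiv
  have e2 : (fun y ↦ fderiv ℝ (fun s ↦ Φ (s, y)) s₀ e) =ᶠ[𝓝 y₀]
      fun y ↦ fderiv ℝ Φ (s₀, y) (e, 0) := by
    filter_upwards [hy.continuousAt.eventually hd] with y h
    have : HasFDerivAt (fun s ↦ Φ (s, y)) _ s₀ := h.hasFDerivAt.comp s₀ (hasFDerivAt_prodMk_left s₀ y)
    exact congrArg (fun l : E₁ →L[ℝ] F ↦ l e) this.fderiv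
  rw [e1.fderiv_eq, e2.fderiv_eq]
  have d1 : HasFDerivAt (fun s ↦ fderiv ℝ Φ (s, y₀)) _ s₀ := hdd.comp s₀ hs
  have d2 : HasFDerivAt (fun y ↦ fderiv ℝ Φ (s₀, y)) _ y₀ := hdd.comp y₀ hy
  have d3 := (d1.clm_apply (hasFDerivAt_const ((0 : E₁), w) s₀)).fderiv
  have d4 := (d2.clm_apply (hasFDerivAt_const (e, (0 : E₂)) y₀)).fderiv
  rw [d3, d4]
  have hsymm := (hΦ.isSymmSndFDerivAt (by rw [minSmoothness_of_isRCLikeNormedField]; norm_cast)).eq (e, 0) (0, w)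
  simpa using hsymm

theorem mlieBracket_fundMap_of_invariant [LieGroup 𝓘(ℝ, EG) ∞ G]
    [ContMDiffSMul 𝓘(ℝ, EG) 𝓘(ℝ, E) ∞ G M] {Z : VField E M} (hZ : IsSmoothVField Z)
    (hZi : VFieldInvariant G Z) (e : GroupLieAlgebra 𝓘(ℝ, EG) G) (x : M) :
    mlieBracket 𝓘(ℝ, E) (fun y : M ↦ fundMap y e) Z x = 0 := by
  obtain ⟨φ, hφ, hφx⟩ := exists_contMDiff_mvfderiv_eq_id (E := E) x
  have hV : IsSmoothVField (E := E) (fun y : M ↦ fundMap y e) := isSmoothVField_fundMap e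
  have h0 := (hφx _).symm.trans (mvfderiv_mlieBracket hφ hV hZ x)
  refine h0.trans (sub_eq_zero.2 ?_)
  let k := extChartAt 𝓘(ℝ, E) x
  let l := extChartAt 𝓘(ℝ, EG) (1 : G)
  let Φ : EG × E → E := fun q ↦ φ (l.symm q.1 • k.symm q.2)
  have hφd (z : M) : MDifferentiableAt 𝓘(ℝ, E) 𝓘(ℝ, E) φ z := (hφ z).mdifferentiableAt (by simp)
  have hΦ : ContDiffAt ℝ ∞ Φ (l 1, k x) := by
    have h1 : ContMDiffAt 𝓘(ℝ, EG) 𝓘(ℝ, EG) ∞ l.symm (l 1) :=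
      (contMDiffOn_extChartAt_symm (1 : G)).contMDiffAt (extChartAt_target_mem_nhds (1 : G))
    have h2 : ContMDiffAt 𝓘(ℝ, E) 𝓘(ℝ, E) ∞ k.symm (k x) :=
      (contMDiffOn_extChartAt_symm x).contMDiffAt (extChartAt_target_mem_nhds x)
    have h3 : ContMDiffAt 𝓘(ℝ, EG × E) 𝓘(ℝ, E) ∞ Φ (l 1, k x) := by
      refine (hφ _).comp _ ?_
      refine (contMDiff_smul (I := 𝓘(ℝ, EG)) (I' := 𝓘(ℝ, E)) (G := G) (M := M) (n := ∞) _).comp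
        (f := fun q : EG × E ↦ (l.symm q.1, k.symm q.2)) (l 1, k x) ?_
      refine ContMDiffAt.prodMk ?_ ?_
      · exact ContMDiffAt.comp (I' := 𝓘(ℝ, EG)) (g := l.symm) (l 1, k x) h1
          contDiff_fst.contDiffAt.contMDiffAt
      · exact ContMDiffAt.comp (I' := 𝓘(ℝ, E)) (g := k.symm) (l 1, k x) h2
          contDiff_snd.contDiffAt.contMDiffAt
    exact h3.contDiffAt
  have hk : k.symm (k x) = x := extChartAt_to_inv x
  have hl : l.symm (l 1) = 1 := extChartAt_to_inv (1 : G)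
  have e1 : mvfderiv 𝓘(ℝ, E) (fun z ↦ mvfderiv 𝓘(ℝ, E) φ z (Z z)) x (fundMap x e)
      = fderiv ℝ (fun s ↦ fderiv ℝ (fun y ↦ Φ (s, y)) (k x) (Z x : E)) (l 1) e := by
    have hs : ContMDiff 𝓘(ℝ, E) 𝓘(ℝ, E) ∞ (fun z ↦ mvfderiv 𝓘(ℝ, E) φ z (Z z)) :=
      covSmooth_mvfderiv hφ Z hZ
    have hs' : ContMDiff 𝓘(ℝ, EG) 𝓘(ℝ, E) ∞
        (fun a : G ↦ mvfderiv 𝓘(ℝ, E) φ (a • x) (Z (a • x))) :=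
      hs.comp (contMDiff_smul_right E EG x)
    have h1 := mvfderiv_comp_mfderiv (x := (1 : G)) (p := fun a : G ↦ a • x)
      ((hs _).mdifferentiableAt (by simp))
      ((contMDiff_smul_right E EG x 1).mdifferentiableAt (by simp)) e
    have h2 (y : M) (hy : y = x) : (mvfderiv 𝓘(ℝ, E) (fun z ↦ mvfderiv 𝓘(ℝ, E) φ z (Z z)) y :
        E →L[ℝ] E) (fundMap x e) = mvfderiv 𝓘(ℝ, E) (fun z ↦ mvfderiv 𝓘(ℝ, E) φ z (Z z)) x
          (fundMap x e) := by subst hy; rfl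
    refine (h2 _ (one_smul G x)).symm.trans (h1.symm.trans ?_)
    refine (mvfderiv_eq_fderiv (E := EG) ((hs' 1).mdifferentiableAt (by simp)) e).trans ?_
    refine congrArg (fun f : EG → E ↦ fderiv ℝ f (l 1) e) (funext fun s ↦ ?_)
    have h3 : ContMDiff 𝓘(ℝ, E) 𝓘(ℝ, E) ∞ fun y ↦ φ (l.symm s • y) :=
      hφ.comp (contMDiff_smul_left E EG _)
    refine Eq.trans ?_ (mvfderiv_eq_fderiv ((h3 x).mdifferentiableAt (by simp)) (Z x))
    have h4 := mvfderiv_comp_mfderiv (x := x) (p := fun y : M ↦ l.symm s • y) (hφd _)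
      ((contMDiff_smul_left E EG (l.symm s) x).mdifferentiableAt (by simp)) (Z x)
    refine Eq.trans ?_ h4.symm
    exact congrArg (mvfderiv 𝓘(ℝ, E) φ (l.symm s • x)) (hZi (l.symm s) x).symm
  have e2 : mvfderiv 𝓘(ℝ, E) (fun z ↦ mvfderiv 𝓘(ℝ, E) φ z (fundMap z e)) x (Z x)
      = fderiv ℝ (fun y ↦ fderiv ℝ (fun s ↦ Φ (s, y)) (l 1) (e : EG)) (k x) (Z x) := by
    have hs : ContMDiff 𝓘(ℝ, E) 𝓘(ℝ, E) ∞ (fun z ↦ mvfderiv 𝓘(ℝ, E) φ z (fundMap z e)) :=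
      covSmooth_mvfderiv hφ _ hV
    refine (mvfderiv_eq_fderiv ((hs x).mdifferentiableAt (by simp)) (Z x)).trans ?_
    refine congrArg (fun f : E → E ↦ fderiv ℝ f (k x) (Z x)) (funext fun y ↦ ?_)
    have h3 : ContMDiff 𝓘(ℝ, EG) 𝓘(ℝ, E) ∞ fun a : G ↦ φ (a • k.symm y) :=
      hφ.comp (contMDiff_smul_right E EG _)
    refine Eq.trans ?_ (mvfderiv_eq_fderiv (E := EG) ((h3 1).mdifferentiableAt (by simp)) e)
    have h4 := mvfderiv_comp_mfderiv (x := (1 : G)) (p := fun a : G ↦ a • k.symm y) (hφd _)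
      ((contMDiff_smul_right E EG (k.symm y) 1).mdifferentiableAt (by simp)) e
    refine Eq.trans ?_ h4.symm
    have h2 (z : M) (hz : z = k.symm y) : (mvfderiv 𝓘(ℝ, E) φ (k.symm y) : E →L[ℝ] E)
        (fundMap (k.symm y) e) = (mvfderiv 𝓘(ℝ, E) φ z : E →L[ℝ] E) (fundMap (k.symm y) e) := by
      subst hz; rfl
    exact h2 _ (one_smul G _)
  exact e1.trans ((fderiv_fderiv_prod_comm hΦ (e : EG) (Z x : E)).trans e2.symm)

end InvariantFields

section CourantAlgebra

set_option linter.unusedSectionVars false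

variable {E : Type*} [NormedAddCommGroup E] [NormedSpace ℝ E] [FiniteDimensional ℝ E]
  {M : Type*} [TopologicalSpace M] [ChartedSpace E M] [IsManifold 𝓘(ℝ, E) ∞ M] [T2Space M]

attribute [local instance] isManifold_one isManifold_two

variable (E M) in
/-- Sections of the generalized tangent bundle. -/
abbrev GenSection : Type _ := Π x : M, GenTangent (E := E) x

/-- Smoothness of a section of the generalized tangent bundle. -/
structure IsSmoothGen (A : GenSection E M) : Prop where
  vec : IsSmoothVField fun x ↦ (A x).1
  cov : CovSmooth fun x ↦ (A x).2

/-- The trilinear expression `⟨[A, B]_H, C⟩`. -/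
def courantTriple (H : Form E M 3) (A B C : GenSection E M) (x : M) : ℝ :=
  pairing (courantBracket H A B x) (C x)

theorem alternating_swap₀₁ {V : Type*} [AddCommGroup V] [Module ℝ V] [TopologicalSpace V]
    (σ : V [⋀^Fin 3]→L[ℝ] ℝ) (u v w : V) : σ ![v, u, w] = - σ ![u, v, w] := by
  have h := σ.map_swap ![u, v, w] (i := 0) (j := 1) (by decide)
  refine Eq.trans (congrArg σ ?_) h
  ext i
  fin_cases i <;> rfl

theorem alternating_swap₁₂ {V : Type*} [AddCommGroup V] [Module ℝ V] [TopologicalSpace V]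
    (σ : V [⋀^Fin 3]→L[ℝ] ℝ) (u v w : V) : σ ![u, w, v] = - σ ![u, v, w] := by
  have h := σ.map_swap ![u, v, w] (i := 1) (j := 2) (by decide)
  refine Eq.trans (congrArg σ ?_) h
  ext i
  fin_cases i <;> rfl

theorem pairing_comm {x : M} (A B : GenTangent (E := E) x) : pairing A B = pairing B A :=
  add_comm _ _

theorem pairing_add_left {x : M} (A A' B : GenTangent (E := E) x) :
    pairing (A + A') B = pairing A B + pairing A' B := by
  simp only [pairing, Prod.fst_add, Prod.snd_add, add_apply, map_add]
  ring

theorem pairing_smul_left {x : M} (c : ℝ) (A B : GenTangent (E := E) x) :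
    pairing (c • A) B = c * pairing A B := by
  simp only [pairing, Prod.smul_fst, Prod.smul_snd, smul_apply, map_smul, smul_eq_mul]
  ring

theorem pairing_add_right {x : M} (A B B' : GenTangent (E := E) x) :
    pairing A (B + B') = pairing A B + pairing A B' := by
  rw [pairing_comm, pairing_add_left, pairing_comm B, pairing_comm B']

theorem pairing_smul_right {x : M} (c : ℝ) (A B : GenTangent (E := E) x) :
    pairing A (c • B) = c * pairing A B := by
  rw [pairing_comm, pairing_smul_left, pairing_comm B]

variable {H : Form E M 3} {A A' B B' C C' : GenSection E M}

theorem IsSmoothGen.contMDiff_cov_apply (hA : IsSmoothGen A) (hB : IsSmoothGen B) :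
    ContMDiff 𝓘(ℝ, E) 𝓘(ℝ, ℝ) ∞ fun x ↦ (A x).2 (B x).1 := hA.cov _ hB.vec

theorem IsSmoothGen.mdifferentiableAt_cov_apply (hA : IsSmoothGen A) (hB : IsSmoothGen B) (x : M) :
    MDifferentiableAt 𝓘(ℝ, E) 𝓘(ℝ, ℝ) (fun x ↦ (A x).2 (B x).1) x :=
  (hA.contMDiff_cov_apply hB x).mdifferentiableAt (by simp)

theorem IsSmoothGen.contMDiff_pairing (hA : IsSmoothGen A) (hB : IsSmoothGen B) :
    ContMDiff 𝓘(ℝ, E) 𝓘(ℝ, ℝ) ∞ fun x ↦ pairing (A x) (B x) :=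
  (hA.contMDiff_cov_apply hB).add (hB.contMDiff_cov_apply hA)

theorem IsSmoothGen.mdifferentiableAt_pairing (hA : IsSmoothGen A) (hB : IsSmoothGen B) (x : M) :
    MDifferentiableAt 𝓘(ℝ, E) 𝓘(ℝ, ℝ) (fun x ↦ pairing (A x) (B x)) x :=
  (hA.contMDiff_pairing hB x).mdifferentiableAt (by simp)

theorem IsSmoothGen.mvfderiv_pairing (hA : IsSmoothGen A) (hB : IsSmoothGen B) (x : M)
    (u : TangentSpace 𝓘(ℝ, E) x) :
    mvfderiv 𝓘(ℝ, E) (fun y ↦ pairing (A y) (B y)) x u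
      = mvfderiv 𝓘(ℝ, E) (fun y ↦ (A y).2 (B y).1) x u
        + mvfderiv 𝓘(ℝ, E) (fun y ↦ (B y).2 (A y).1) x u :=
  DFunLike.congr_fun (mvfderiv_add (hA.mdifferentiableAt_cov_apply hB x)
    (hB.mdifferentiableAt_cov_apply hA x)) u

theorem isSmoothVField_add {X Y : VField E M} (hX : IsSmoothVField X) (hY : IsSmoothVField Y) :
    IsSmoothVField fun x ↦ X x + Y x := isSmoothVField_of_push fun x ↦ by
  simp only [map_add]
  exact (hX.contMDiffAt_push (mem_chart_source E x)).add
    (hY.contMDiffAt_push (mem_chart_source E x))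

theorem isSmoothVField_smul {X : VField E M} (c : ℝ) (hX : IsSmoothVField X) :
    IsSmoothVField fun x ↦ c • X x := isSmoothVField_of_push fun x ↦ by
  simp only [map_smul]
  exact ContMDiffAt.comp (g := fun v : E ↦ c • v) x (contDiff_const_smul c).contDiffAt.contMDiffAt
    (hX.contMDiffAt_push (mem_chart_source E x))

theorem IsSmoothGen.add (hA : IsSmoothGen A) (hB : IsSmoothGen B) : IsSmoothGen (A + B) where
  vec := isSmoothVField_add hA.vec hB.vec
  cov X hX := (hA.cov X hX).add (hB.cov X hX)

theorem IsSmoothGen.smul (c : ℝ) (hA : IsSmoothGen A) : IsSmoothGen (c • A) where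
  vec := isSmoothVField_smul c hA.vec
  cov X hX := ContMDiff.comp (g := fun v : ℝ ↦ c • v) (contDiff_const_smul c).contMDiff (hA.cov X hX)

theorem courantTriple_eq (hA : IsSmoothGen A) (hB : IsSmoothGen B) (hC : IsSmoothGen C) (x : M) :
    courantTriple H A B C x
      = (C x).2 (mlieBracket 𝓘(ℝ, E) (fun y ↦ (A y).1) (fun y ↦ (B y).1) x)
        + (A x).2 (mlieBracket 𝓘(ℝ, E) (fun y ↦ (B y).1) (fun y ↦ (C y).1) x)
        - (B x).2 (mlieBracket 𝓘(ℝ, E) (fun y ↦ (A y).1) (fun y ↦ (C y).1) x)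
        + mvfderiv 𝓘(ℝ, E) (fun y ↦ (B y).2 (C y).1) x (A x).1
        - mvfderiv 𝓘(ℝ, E) (fun y ↦ (A y).2 (C y).1) x (B x).1
        + mvfderiv 𝓘(ℝ, E) (fun y ↦ (A y).2 (B y).1) x (C x).1
        + H x ![(A x).1, (B x).1, (C x).1] := by
  have h1 := covD_apply hB.cov hA.vec hC.vec x
  have h2 := covD_apply hA.cov hB.vec hC.vec x
  have h3 := formD_covToForm hB.cov x (A x).1 (C x).1
  have h4 := formD_covToForm hA.cov x (B x).1 (C x).1
  simp only [courantTriple, pairing, courantBracket, lieDerivCov, add_apply, sub_apply,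
    contract₂_apply, contract₃_apply]
  rw [h3, h4, h1, h2]
  ring

theorem courantTriple_add_swap₁₂ (hA : IsSmoothGen A) (hB : IsSmoothGen B) (hC : IsSmoothGen C)
    (x : M) : courantTriple H A B C x + courantTriple H A C B x
      = mvfderiv 𝓘(ℝ, E) (fun y ↦ pairing (B y) (C y)) x (A x).1 := by
  rw [courantTriple_eq hA hB hC, courantTriple_eq hA hC hB, hB.mvfderiv_pairing hC,
    mlieBracket_swap_apply (V := fun y ↦ (C y).1), map_neg, alternating_swap₁₂]
  ring

theorem courantTriple_add_swap₀₁ (hA : IsSmoothGen A) (hB : IsSmoothGen B) (hC : IsSmoothGen C)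
    (x : M) : courantTriple H A B C x + courantTriple H B A C x
      = mvfderiv 𝓘(ℝ, E) (fun y ↦ pairing (A y) (B y)) x (C x).1 := by
  rw [courantTriple_eq hA hB hC, courantTriple_eq hB hA hC, hA.mvfderiv_pairing hB,
    mlieBracket_swap_apply (V := fun y ↦ (B y).1) (W := fun y ↦ (A y).1), map_neg,
    alternating_swap₀₁]
  ring

theorem courantTriple_add₂ (x : M) : courantTriple H A B (C + C') x
    = courantTriple H A B C x + courantTriple H A B C' x := pairing_add_right _ _ _

theorem courantTriple_smul₂ (c : ℝ) (x : M) : courantTriple H A B (c • C) x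
    = c * courantTriple H A B C x := pairing_smul_right _ _ _

theorem courantTriple_congr₂ {x : M} (h : C x = C' x) : courantTriple H A B C x
    = courantTriple H A B C' x := by rw [courantTriple, h, courantTriple]

theorem courantTriple_add₁ (hA : IsSmoothGen A) (hB : IsSmoothGen B) (hB' : IsSmoothGen B')
    (hC : IsSmoothGen C) (x : M) : courantTriple H A (B + B') C x
    = courantTriple H A B C x + courantTriple H A B' C x := by
  have h1 := courantTriple_add_swap₁₂ (H := H) hA (hB.add hB') hC x
  have h2 := courantTriple_add_swap₁₂ (H := H) hA hB hC x
  have h3 := courantTriple_add_swap₁₂ (H := H) hA hB' hC x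
  have h4 : mvfderiv 𝓘(ℝ, E) (fun y ↦ pairing ((B + B') y) (C y)) x (A x).1
      = mvfderiv 𝓘(ℝ, E) (fun y ↦ pairing (B y) (C y)) x (A x).1
      + mvfderiv 𝓘(ℝ, E) (fun y ↦ pairing (B' y) (C y)) x (A x).1 := by
    refine Eq.trans ?_ (DFunLike.congr_fun (mvfderiv_add (hB.mdifferentiableAt_pairing hC x)
      (hB'.mdifferentiableAt_pairing hC x)) _)
    exact congrArg (fun f ↦ mvfderiv 𝓘(ℝ, E) f x (A x).1)
      (funext fun y ↦ pairing_add_left _ _ _)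
  rw [courantTriple_add₂] at h1
  linarith

theorem courantTriple_smul₁ (hA : IsSmoothGen A) (c : ℝ) (hB : IsSmoothGen B)
    (hC : IsSmoothGen C) (x : M) : courantTriple H A (c • B) C x
    = c * courantTriple H A B C x := by
  have h1 := courantTriple_add_swap₁₂ (H := H) hA (hB.smul c) hC x
  have h2 := courantTriple_add_swap₁₂ (H := H) hA hB hC x
  have h4 : mvfderiv 𝓘(ℝ, E) (fun y ↦ pairing ((c • B) y) (C y)) x (A x).1
      = c * mvfderiv 𝓘(ℝ, E) (fun y ↦ pairing (B y) (C y)) x (A x).1 := by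
    have h5 := DFunLike.congr_fun (mvfderiv_mul (f := fun _ ↦ c) mdifferentiableAt_const
      (hB.mdifferentiableAt_pairing hC x)) (A x).1
    rw [mvfderiv_const, smul_zero, add_zero] at h5
    refine Eq.trans ?_ h5
    exact congrArg (fun f ↦ mvfderiv 𝓘(ℝ, E) f x (A x).1)
      (funext fun y ↦ pairing_smul_left _ _ _)
  rw [courantTriple_smul₂] at h1
  linear_combination h1 - c * h2 + h4

theorem courantTriple_add₀ (hA : IsSmoothGen A) (hA' : IsSmoothGen A') (hB : IsSmoothGen B)
    (hC : IsSmoothGen C) (x : M) : courantTriple H (A + A') B C x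
    = courantTriple H A B C x + courantTriple H A' B C x := by
  have h1 := courantTriple_add_swap₀₁ (H := H) (hA.add hA') hB hC x
  have h2 := courantTriple_add_swap₀₁ (H := H) hA hB hC x
  have h3 := courantTriple_add_swap₀₁ (H := H) hA' hB hC x
  have h4 : mvfderiv 𝓘(ℝ, E) (fun y ↦ pairing ((A + A') y) (B y)) x (C x).1
      = mvfderiv 𝓘(ℝ, E) (fun y ↦ pairing (A y) (B y)) x (C x).1
      + mvfderiv 𝓘(ℝ, E) (fun y ↦ pairing (A' y) (B y)) x (C x).1 := by
    refine Eq.trans ?_ (DFunLike.congr_fun (mvfderiv_add (hA.mdifferentiableAt_pairing hB x)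
      (hA'.mdifferentiableAt_pairing hB x)) _)
    exact congrArg (fun f ↦ mvfderiv 𝓘(ℝ, E) f x (C x).1)
      (funext fun y ↦ pairing_add_left _ _ _)
  rw [courantTriple_add₁ hB hA hA' hC] at h1
  linarith

theorem courantTriple_smul₀ (c : ℝ) (hA : IsSmoothGen A) (hB : IsSmoothGen B)
    (hC : IsSmoothGen C) (x : M) : courantTriple H (c • A) B C x
    = c * courantTriple H A B C x := by
  have h1 := courantTriple_add_swap₀₁ (H := H) (hA.smul c) hB hC x
  have h2 := courantTriple_add_swap₀₁ (H := H) hA hB hC x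
  have h4 : mvfderiv 𝓘(ℝ, E) (fun y ↦ pairing ((c • A) y) (B y)) x (C x).1
      = c * mvfderiv 𝓘(ℝ, E) (fun y ↦ pairing (A y) (B y)) x (C x).1 := by
    have h5 := DFunLike.congr_fun (mvfderiv_mul (f := fun _ ↦ c) mdifferentiableAt_const
      (hA.mdifferentiableAt_pairing hB x)) (C x).1
    rw [mvfderiv_const, smul_zero, add_zero] at h5
    refine Eq.trans ?_ h5
    exact congrArg (fun f ↦ mvfderiv 𝓘(ℝ, E) f x (C x).1)
      (funext fun y ↦ pairing_smul_left _ _ _)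
  rw [courantTriple_smul₁ hB c hA hC] at h1
  linear_combination h1 - c * h2 + h4

end CourantAlgebra

section BasicSections

set_option linter.unusedSectionVars false

variable {E : Type*} [NormedAddCommGroup E] [NormedSpace ℝ E] [FiniteDimensional ℝ E]
  {EG : Type*} [NormedAddCommGroup EG] [NormedSpace ℝ EG] [FiniteDimensional ℝ EG]
  {M : Type*} [TopologicalSpace M] [ChartedSpace E M] [IsManifold 𝓘(ℝ, E) ∞ M] [T2Space M]
  {G : Type*} [TopologicalSpace G] [ChartedSpace EG G] [Group G] [MulAction G M]
  [LieGroup 𝓘(ℝ, EG) ∞ G] [ContMDiffSMul 𝓘(ℝ, EG) 𝓘(ℝ, E) ∞ G M]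
  {H : Form E M 3} {ξ : GroupLieAlgebra 𝓘(ℝ, EG) G →ₗ[ℝ] CovField E M}

attribute [local instance] isManifold_one isManifold_two

variable (ξ) in
/-- The invariant smooth sections of `K^⊥`. -/
structure IsBasicGen (A : GenSection E M) : Prop extends IsSmoothGen A where
  vec_invariant : VFieldInvariant G fun x ↦ (A x).1
  cov_invariant : ∀ (a : G) (x : M) (u : TangentSpace 𝓘(ℝ, E) x),
    (A (a • x)).2 (actDeriv E a x u) = (A x).2 u
  perp : ∀ (x : M) (e : GroupLieAlgebra 𝓘(ℝ, EG) G), pairing (A x) (fundMap x e, ξ e x) = 0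

variable {A B C κ : GenSection E M}

theorem IsBasicGen.add (hA : IsBasicGen ξ A) (hB : IsBasicGen ξ B) : IsBasicGen ξ (A + B) where
  toIsSmoothGen := hA.toIsSmoothGen.add hB.toIsSmoothGen
  vec_invariant a x := by
    refine (map_add (actDeriv E a x) (A x).1 (B x).1).trans ?_
    rw [hA.vec_invariant a x, hB.vec_invariant a x]
    rfl
  cov_invariant a x u := congrArg₂ (· + ·) (hA.cov_invariant a x u) (hB.cov_invariant a x u)
  perp x e := by
    rw [Pi.add_apply, pairing_add_left, hA.perp, hB.perp, add_zero]

theorem IsBasicGen.smul (c : ℝ) (hA : IsBasicGen ξ A) : IsBasicGen ξ (c • A) where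
  toIsSmoothGen := hA.toIsSmoothGen.smul c
  vec_invariant a x := by
    refine (map_smul (actDeriv E a x) c (A x).1).trans ?_
    rw [hA.vec_invariant a x]
    rfl
  cov_invariant a x u := congrArg (c • ·) (hA.cov_invariant a x u)
  perp x e := by
    rw [Pi.smul_apply, pairing_smul_left, hA.perp, mul_zero]

theorem isSmoothGen_generator (hξ : IsClosedEquivariantExtension H ξ)
    (e : GroupLieAlgebra 𝓘(ℝ, EG) G) :
    IsSmoothGen (E := E) (M := M) fun x ↦ (fundMap x e, ξ e x) where
  vec := isSmoothVField_fundMap e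
  cov := covSmooth_of_formSmooth (hξ.smooth e)

theorem mvfderiv_fundMap_of_invariant {f : M → ℝ} (hf : ContMDiff 𝓘(ℝ, E) 𝓘(ℝ, ℝ) ∞ f)
    (hfi : ∀ (a : G) x, f (a • x) = f x) (x : M) (e : GroupLieAlgebra 𝓘(ℝ, EG) G) :
    mvfderiv 𝓘(ℝ, E) f x (fundMap x e) = 0 :=
  mfderiv_fundMap_of_invariant hfi (hf.mdifferentiable (by simp)) x e

theorem IsBasicGen.cov_apply_invariant (hA : IsBasicGen ξ A) (hB : IsBasicGen ξ B) (a : G)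
    (x : M) : (A (a • x)).2 (B (a • x)).1 = (A x).2 (B x).1 := by
  rw [← hA.cov_invariant a x, hB.vec_invariant a x]

theorem IsBasicGen.courantTriple_generator₀ (hξ : IsClosedEquivariantExtension H ξ)
    (hA : IsBasicGen ξ A) (hB : IsBasicGen ξ B) (e : GroupLieAlgebra 𝓘(ℝ, EG) G) (x : M) :
    courantTriple H (fun x ↦ (fundMap x e, ξ e x)) A B x = 0 := by
  have hk := isSmoothGen_generator hξ e
  rw [courantTriple_eq hk hA.toIsSmoothGen hB.toIsSmoothGen]
  have h1 := covD_apply hk.cov hA.vec hB.vec x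
  have h2 := (formD_covToForm hk.cov x (A x).1 (B x).1).symm.trans (hξ.degree_two e x _ _)
  have h3 : mlieBracket 𝓘(ℝ, E) (fun y : M ↦ fundMap y e) (fun y ↦ (A y).1) x = 0 :=
    mlieBracket_fundMap_of_invariant hA.vec hA.vec_invariant e x
  have h4 : mlieBracket 𝓘(ℝ, E) (fun y : M ↦ fundMap y e) (fun y ↦ (B y).1) x = 0 :=
    mlieBracket_fundMap_of_invariant hB.vec hB.vec_invariant e x
  have h5 := mvfderiv_fundMap_of_invariant
    (hA.toIsSmoothGen.contMDiff_cov_apply hB.toIsSmoothGen) (hA.cov_apply_invariant hB) x e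
  simp only at h1 h2 ⊢
  rw [h3, h4, h5, map_zero, map_zero]
  linarith

theorem IsBasicGen.courantTriple_generator₁ (hξ : IsClosedEquivariantExtension H ξ)
    (hA : IsBasicGen ξ A) (hB : IsBasicGen ξ B) (e : GroupLieAlgebra 𝓘(ℝ, EG) G) (x : M) :
    courantTriple H A (fun x ↦ (fundMap x e, ξ e x)) B x = 0 := by
  have h1 := courantTriple_add_swap₀₁ (H := H) (isSmoothGen_generator hξ e) hA.toIsSmoothGen
    hB.toIsSmoothGen x
  rw [hA.courantTriple_generator₀ hξ hB, zero_add] at h1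
  refine h1.trans ?_
  have h2 : (fun y ↦ pairing ((fundMap y e, ξ e y) : GenTangent (E := E) y) (A y)) = fun _ ↦ 0 :=
    funext fun y ↦ (pairing_comm _ _).trans (hA.perp y e)
  rw [h2, mvfderiv_const]
  rfl

theorem IsBasicGen.courantTriple_of_mem₂ (hξ : IsClosedEquivariantExtension H ξ)
    (hA : IsBasicGen ξ A) (hB : IsBasicGen ξ B) {x : M} (hκ : κ x ∈ subbundleK ξ x) :
    courantTriple H A B κ x = 0 := by
  obtain ⟨e, he⟩ := hκ
  refine (courantTriple_congr₂ (C' := fun x ↦ (fundMap x e, ξ e x)) he.symm).trans ?_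
  have h1 := courantTriple_add_swap₁₂ (H := H) hA.toIsSmoothGen hB.toIsSmoothGen
    (isSmoothGen_generator hξ e) x
  rw [hA.courantTriple_generator₁ hξ hB, add_zero] at h1
  refine h1.trans ?_
  have h2 : (fun y ↦ pairing (B y) ((fundMap y e, ξ e y) : GenTangent (E := E) y)) = fun _ ↦ 0 :=
    funext fun y ↦ hB.perp y e
  rw [h2, mvfderiv_const]
  rfl

theorem IsBasicGen.pairing_of_mem (hA : IsBasicGen ξ A) {x : M} {k : GenTangent (E := E) x}
    (hk : k ∈ subbundleK ξ x) : pairing (A x) k = 0 := by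
  obtain ⟨e, rfl⟩ := hk
  exact hA.perp x e

theorem IsBasicGen.courantTriple_of_mem₁ (hξ : IsClosedEquivariantExtension H ξ)
    (hA : IsBasicGen ξ A) (hB : IsBasicGen ξ B) (hκs : IsSmoothGen κ)
    (hκ : ∀ x, κ x ∈ subbundleK ξ x) (x : M) :
    courantTriple H A κ B x = 0 := by
  have h1 := courantTriple_add_swap₁₂ (H := H) hA.toIsSmoothGen hκs hB.toIsSmoothGen x
  rw [hA.courantTriple_of_mem₂ hξ hB (hκ x), add_zero] at h1
  refine h1.trans ?_
  have h2 : (fun y ↦ pairing (κ y) (B y)) = fun _ ↦ 0 :=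
    funext fun y ↦ (pairing_comm _ _).trans (hB.pairing_of_mem (hκ y))
  rw [h2, mvfderiv_const]
  rfl

theorem IsBasicGen.courantTriple_of_mem₀ (hξ : IsClosedEquivariantExtension H ξ)
    (hA : IsBasicGen ξ A) (hB : IsBasicGen ξ B) (hκs : IsSmoothGen κ)
    (hκ : ∀ x, κ x ∈ subbundleK ξ x) (x : M) :
    courantTriple H κ A B x = 0 := by
  have h1 := courantTriple_add_swap₀₁ (H := H) hκs hA.toIsSmoothGen hB.toIsSmoothGen x
  rw [hA.courantTriple_of_mem₁ hξ hB hκs hκ, add_zero] at h1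
  refine h1.trans ?_
  have h2 : (fun y ↦ pairing (κ y) (A y)) = fun _ ↦ 0 :=
    funext fun y ↦ (pairing_comm _ _).trans (hA.pairing_of_mem (hκ y))
  rw [h2, mvfderiv_const]
  rfl

theorem isSmoothGen_combination (hξ : IsClosedEquivariantExtension H ξ) {ψ : M → EG}
    (hψ : ContMDiff 𝓘(ℝ, E) 𝓘(ℝ, EG) ∞ ψ) :
    IsSmoothGen (E := E) (M := M) fun x ↦ (fundMap (EG := EG) (G := G) x (ψ x), ξ (ψ x) x) where
  vec := isSmoothVField_of_push fun x ↦ by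
    let L : M → EG →L[ℝ] E := fun z ↦
      (chartPush x z).comp (fundMap (E := E) (EG := EG) (G := G) z)
    have hL : ContMDiffAt 𝓘(ℝ, E) 𝓘(ℝ, EG →L[ℝ] E) ∞ L x := contMDiffAt_clm_of_apply fun e ↦
      (isSmoothVField_fundMap (E := E) (G := G) (EG := EG) e).contMDiffAt_push
        (mem_chart_source E x)
    exact hL.clm_apply (hψ x)
  cov X hX x := by
    let L : M → EG →L[ℝ] ℝ := fun z ↦ LinearMap.toContinuousLinearMap
      { toFun e := ξ e z (X z)
        map_add' e f := by
          have : ξ (e + f) z = ξ e z + ξ f z := congrFun (map_add ξ e f) z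
          exact congrArg (fun l ↦ l (X z)) this
        map_smul' c e := by
          have : ξ (c • e) z = c • ξ e z := congrFun (map_smul ξ c e) z
          exact congrArg (fun l ↦ l (X z)) this }
    have hL : ContMDiffAt 𝓘(ℝ, E) 𝓘(ℝ, EG →L[ℝ] ℝ) ∞ L x := contMDiffAt_clm_of_apply fun e ↦
      covSmooth_of_formSmooth (hξ.smooth e) X hX x
    exact hL.clm_apply (hψ x)

end BasicSections

section MetricOfForm

set_option linter.unusedSectionVars false

variable {E : Type*} [NormedAddCommGroup E] [NormedSpace ℝ E] [FiniteDimensional ℝ E]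
  {M : Type*} [TopologicalSpace M] [ChartedSpace E M] [IsManifold 𝓘(ℝ, E) ∞ M] [T2Space M]

attribute [local instance] isManifold_one isManifold_two

theorem isVonNBounded_of_pos (B : E →L[ℝ] E →L[ℝ] ℝ) (hB : ∀ v, v ≠ 0 → 0 < B v v) :
    Bornology.IsVonNBounded ℝ {v : E | B v v < 1} := by
  rcases subsingleton_or_nontrivial E with hE | hE
  · exact (NormedSpace.isVonNBounded_ball ℝ E 1).subset fun v _ ↦ by
      simp [Subsingleton.elim v 0]
  have hc : Continuous fun v ↦ B v v := B.continuous.clm_apply continuous_id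
  obtain ⟨v₀, hv₀, hmin⟩ := (isCompact_sphere (0 : E) 1).exists_isMinOn
    (NormedSpace.sphere_nonempty.2 zero_le_one) hc.continuousOn
  have hv₀' : v₀ ≠ 0 := by
    rintro rfl
    simp at hv₀
  have hpos := hB v₀ hv₀'
  refine (NormedSpace.isVonNBounded_closedBall ℝ E (1 + 1 / B v₀ v₀)).subset fun v hv ↦ ?_
  rw [mem_closedBall_zero_iff]
  by_cases h0 : v = 0
  · rw [h0, norm_zero]; positivity
  have hn : 0 < ‖v‖ := norm_pos_iff.2 h0
  have h1 : B v₀ v₀ ≤ B (‖v‖⁻¹ • v) (‖v‖⁻¹ • v) := hmin (by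
    rw [mem_sphere_zero_iff_norm, norm_smul, norm_inv, norm_norm, inv_mul_cancel₀ hn.ne'])
  simp only [map_smul, smul_apply, smul_eq_mul] at h1
  have hv' : B v v < 1 := hv
  have h2 : B v₀ v₀ * ‖v‖ ^ 2 < 1 := by
    have : ‖v‖⁻¹ * (‖v‖⁻¹ * B v v) * ‖v‖ ^ 2 = B v v := by field_simp
    calc _ ≤ ‖v‖⁻¹ * (‖v‖⁻¹ * B v v) * ‖v‖ ^ 2 := by gcongr
      _ < 1 := by rw [this]; exact hv'
  have h3 : ‖v‖ ^ 2 < 1 / B v₀ v₀ := by rw [lt_div_iff₀ hpos]; linarith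
  nlinarith [sq_nonneg (‖v‖ - 1)]

theorem exists_rMetric_of_smooth
    (β : Π x : M, TangentSpace 𝓘(ℝ, E) x →L[ℝ] TangentSpace 𝓘(ℝ, E) x →L[ℝ] ℝ)
    (hsymm : ∀ x v w, β x v w = β x w v) (hpos : ∀ x v, v ≠ 0 → 0 < β x v v)
    (hsmooth : ∀ X Y : VField E M, IsSmoothVField X → IsSmoothVField Y →
      ContMDiff 𝓘(ℝ, E) 𝓘(ℝ, ℝ) ∞ fun x ↦ β x (X x) (Y x)) :
    ∃ h : RMetric E M, h.inner = β := by
  refine ⟨⟨β, hsymm, hpos, fun x ↦ isVonNBounded_of_pos (E := E) (β x) (hpos x), ?_⟩, rfl⟩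
  intro x₀
  rw [contMDiffAt_hom_bundle]
  refine ⟨contMDiffAt_id, ?_⟩
  refine contMDiffAt_clm_of_apply fun v ↦ contMDiffAt_clm_of_apply fun w ↦ ?_
  obtain ⟨V, hV, hVx⟩ := exists_isSmoothVField_eq_chartPull (mem_chart_source E x₀) v
  obtain ⟨W, hW, hWx⟩ := exists_isSmoothVField_eq_chartPull (mem_chart_source E x₀) w
  refine (hsmooth V W hV hW x₀).congr_of_eventuallyEq ?_
  filter_upwards [hVx, hWx, (chartAt E x₀).open_source.mem_nhds (mem_chart_source E x₀)]
    with x h1 h2 hx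
  have hb : x ∈ (trivializationAt E (TangentSpace 𝓘(ℝ, E)) x₀).baseSet := by simpa using hx
  have hs (u : E) : (trivializationAt E (TangentSpace 𝓘(ℝ, E)) x₀).symm x u
      = chartPull x₀ x u := by
    have := TangentBundle.symmL_trivializationAt (I := 𝓘(ℝ, E)) hx
    simp only [modelWithCornersSelf_coe, range_id, mfderivWithin_univ] at this
    exact (Trivialization.symmL_apply (R := ℝ) _ hb u).symm.trans (DFunLike.congr_fun this u)
  refine (inCoordinates_apply_eq₂ (F₃ := ℝ) (E₃ := Bundle.Trivial M ℝ) hb hb (mem_univ _)).trans ?_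
  rw [h1, h2, ← hs, ← hs]
  simp

end MetricOfForm

section ReducedMetric

set_option linter.unusedSectionVars false

variable {E : Type*} [NormedAddCommGroup E] [NormedSpace ℝ E] [FiniteDimensional ℝ E]
  {EG : Type*} [NormedAddCommGroup EG] [NormedSpace ℝ EG] [FiniteDimensional ℝ EG]
  {EN : Type*} [NormedAddCommGroup EN] [NormedSpace ℝ EN] [FiniteDimensional ℝ EN]
  {M : Type*} [TopologicalSpace M] [ChartedSpace E M] [IsManifold 𝓘(ℝ, E) ∞ M] [T2Space M]
  {N : Type*} [TopologicalSpace N] [ChartedSpace EN N] [IsManifold 𝓘(ℝ, EN) ∞ N] [T2Space N]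
  {G : Type*} [TopologicalSpace G] [ChartedSpace EG G] [Group G] [MulAction G M]
  {p : M → N} {g : RMetric E M} {H : Form E M 3}
  {ξ : GroupLieAlgebra 𝓘(ℝ, EG) G →ₗ[ℝ] CovField E M}
  [CompactSpace G] [LieGroup 𝓘(ℝ, EG) ∞ G] [ContMDiffSMul 𝓘(ℝ, EG) 𝓘(ℝ, E) ∞ G M]
  {s : ℝ}

attribute [local instance] isManifold_one isManifold_two

namespace IsReduction

theorem inner_horLift_eq_of_proj_eq (S : IsReduction EN p g H ξ) {x y : M} (hxy : p x = p y)
    (a b : EN) :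
    g.inner x (horLift p g ξ s x a) (horLift p g ξ s x b)
      = g.inner y (horLift p g ξ s y a) (horLift p g ξ s y b) := by
  obtain ⟨c, rfl⟩ := S.exists_smul hxy
  rw [← S.metric c y]
  have ha : actDeriv E c y (horLift p g ξ s y a) = horLift p g ξ s (c • y) a :=
    S.actDeriv_horLift (fun _ ↦ a) c y
  have hb : actDeriv E c y (horLift p g ξ s y b) = horLift p g ξ s (c • y) b :=
    S.actDeriv_horLift (fun _ ↦ b) c y
  rw [ha, hb]

theorem exists_horLift_neg_eq (S : IsReduction EN p g H ξ) (x : M)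
    (a : TangentSpace 𝓘(ℝ, EN) (p x)) : ∃ e : GroupLieAlgebra 𝓘(ℝ, EG) G,
      horLift p g ξ (-1) x a = horLift p g ξ 1 x a + fundMap x e := by
  have h : mfderiv 𝓘(ℝ, E) 𝓘(ℝ, EN) p x (horLift p g ξ (-1) x a - horLift p g ξ 1 x a) = 0 := by
    rw [map_sub, S.mfderiv_horLift, S.mfderiv_horLift, sub_self]
  obtain ⟨e, he⟩ := S.mfderiv_eq_zero_iff.1 h
  exact ⟨e, by rw [he, add_sub_cancel]⟩

theorem inner_horLift_neg (S : IsReduction EN p g H ξ) (x : M)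
    (a b : TangentSpace 𝓘(ℝ, EN) (p x)) :
    g.inner x (horLift p g ξ (-1) x a) (horLift p g ξ (-1) x b)
      = g.inner x (horLift p g ξ 1 x a) (horLift p g ξ 1 x b) := by
  obtain ⟨e, he⟩ := S.exists_horLift_neg_eq x a
  obtain ⟨e', he'⟩ := S.exists_horLift_neg_eq x b
  have h1 := S.horLift_mem (s := -1) a e'
  have h2 := S.horLift_mem (s := 1) b e
  have h3 := S.horLift_mem (s := -1) b e
  have h4 := S.horLift_mem (s := 1) a e'
  have h5 := S.extension.antisymm e e' x
  rw [he] at h1 ⊢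
  rw [he'] at h3 ⊢
  simp only [map_add, add_apply] at h1 h3 ⊢
  have h6 := g.symm x (fundMap x e) (horLift p g ξ 1 x b)
  have h7 := g.symm x (fundMap x e) (fundMap x e')
  linarith

/-- The lift to `τ_s` as a continuous linear map. -/
def horLiftCLM (S : IsReduction EN p g H ξ) (s : ℝ) (x : M) : EN →L[ℝ] E :=
  LinearMap.toContinuousLinearMap (𝕜 := ℝ) (E := EN) (F' := E)
    { toFun := fun a ↦ horLift p g ξ s x a
      map_add' := fun a a' ↦ S.horLift_add (s := s) (x := x) a a'
      map_smul' := fun c a ↦ S.horLift_smul (s := s) (x := x) c a }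

theorem exists_reducedMetric (S : IsReduction EN p g H ξ) : ∃ h : RMetric EN N,
    ∀ x, ∀ a b : TangentSpace 𝓘(ℝ, EN) (p x),
      h.inner (p x) a b = g.inner x (horLift p g ξ 1 x a) (horLift p g ξ 1 x b) := by
  let q := Function.surjInv S.surjective
  have hq (n : N) : p (q n) = n := Function.surjInv_eq S.surjective n
  let B (x : M) : E →L[ℝ] E →L[ℝ] ℝ := g.inner x
  let β (n : N) : EN →L[ℝ] EN →L[ℝ] ℝ :=
    (B (q n)).bilinearComp (S.horLiftCLM 1 (q n)) (S.horLiftCLM 1 (q n))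
  have hβ (x : M) (a b : EN) :
      β (p x) a b = g.inner x (horLift p g ξ 1 x a) (horLift p g ξ 1 x b) :=
    S.inner_horLift_eq_of_proj_eq (hq (p x)) a b
  have hsymm (n : N) (v w : EN) : β n v w = β n w v := g.symm _ _ _
  have hpos (n : N) (v : EN) (hv : v ≠ 0) : 0 < β n v v := by
    refine g.pos (q n) _ fun h0 ↦ hv ?_
    have h1 := S.mfderiv_horLift (s := 1) (x := q n) (v : EN)
    have h2 : (mfderiv 𝓘(ℝ, E) 𝓘(ℝ, EN) p (q n)) (horLift p g ξ 1 (q n) (v : EN)) = (0 : EN) :=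
      (congrArg (mfderiv 𝓘(ℝ, E) 𝓘(ℝ, EN) p (q n)) h0).trans (map_zero _)
    exact h1.symm.trans h2
  obtain ⟨h, hh⟩ := exists_rMetric_of_smooth (E := EN) (M := N) β hsymm hpos fun X Y hX hY ↦ by
    refine contMDiff_of_comp_submersion S.submersion S.surjective ?_
    refine (contMDiff_inner_apply g (S.isSmoothVField_horLift (s := 1) hX)
      (S.isSmoothVField_horLift (s := 1) hY)).congr fun x ↦ hβ x _ _
  exact ⟨h, fun x a b ↦ by rw [hh]; exact hβ x a b⟩

end IsReduction

end ReducedMetric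

section LiftedSections

set_option linter.unusedSectionVars false

variable {E : Type*} [NormedAddCommGroup E] [NormedSpace ℝ E] [FiniteDimensional ℝ E]
  {EG : Type*} [NormedAddCommGroup EG] [NormedSpace ℝ EG] [FiniteDimensional ℝ EG]
  {EN : Type*} [NormedAddCommGroup EN] [NormedSpace ℝ EN] [FiniteDimensional ℝ EN]
  {M : Type*} [TopologicalSpace M] [ChartedSpace E M] [IsManifold 𝓘(ℝ, E) ∞ M] [T2Space M]
  {N : Type*} [TopologicalSpace N] [ChartedSpace EN N] [IsManifold 𝓘(ℝ, EN) ∞ N] [T2Space N]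
  {G : Type*} [TopologicalSpace G] [ChartedSpace EG G] [Group G] [MulAction G M]
  [CompactSpace G] [LieGroup 𝓘(ℝ, EG) ∞ G] [ContMDiffSMul 𝓘(ℝ, EG) 𝓘(ℝ, E) ∞ G M]

attribute [local instance] isManifold_one isManifold_two

section

/-- The lift of a vector field to a section of an eigenbundle of the generalized metric. -/
def liftSec (p : M → N) (g : RMetric E M)
    (ξ : GroupLieAlgebra 𝓘(ℝ, EG) G →ₗ[ℝ] CovField E M) (s : ℝ) (X : VField EN N) :
    GenSection E M := fun x ↦ genLift p g ξ s x (X (p x))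

/-- The pull-back of the `1`-form dual to a vector field, as a section of `T*M`. -/
def dualSec (p : M → N) (h : RMetric EN N) (X : VField EN N) : GenSection E M := fun x ↦
  (0, (h.inner (p x) (X (p x))).comp (mfderiv 𝓘(ℝ, E) 𝓘(ℝ, EN) p x))

/-- The section of `K` given by a connection form and a vector field. -/
def vertSec (ξ : GroupLieAlgebra 𝓘(ℝ, EG) G →ₗ[ℝ] CovField E M)
    (θ : Π x : M, TangentSpace 𝓘(ℝ, E) x →L[ℝ] GroupLieAlgebra 𝓘(ℝ, EG) G) (X : VField E M) :
    GenSection E M := fun x ↦ (fundMap x (θ x (X x)), ξ (θ x (X x)) x)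

end

variable {p : M → N} {g : RMetric E M} {H : Form E M 3}
  {ξ : GroupLieAlgebra 𝓘(ℝ, EG) G →ₗ[ℝ] CovField E M} {s : ℝ} {h : RMetric EN N}
  {ι : Type*} [Fintype ι] (b : Module.Basis ι ℝ (GroupLieAlgebra 𝓘(ℝ, EG) G))
  {X Y Z : VField EN N} {A B C : GenSection E M}

theorem liftSec_fst (x : M) : (liftSec p g ξ s X x).1 = horLift p g ξ s x (X (p x)) := rfl

theorem liftSec_snd (x : M) (v : TangentSpace 𝓘(ℝ, E) x) : (liftSec p g ξ s X x).2 v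
    = s * g.inner x (horLift p g ξ s x (X (p x))) v := rfl

theorem dualSec_snd (x : M) (v : TangentSpace 𝓘(ℝ, E) x) : (dualSec p h X x).2 v
    = h.inner (p x) (X (p x)) (mfderiv 𝓘(ℝ, E) 𝓘(ℝ, EN) p x v) := rfl

theorem vertSec_mem {θ : Π x : M, TangentSpace 𝓘(ℝ, E) x →L[ℝ] GroupLieAlgebra 𝓘(ℝ, EG) G}
    {X : VField E M} (x : M) : vertSec ξ θ X x ∈ subbundleK ξ x := ⟨_, rfl⟩

namespace IsReduction

theorem isBasicGen_liftSec (S : IsReduction EN p g H ξ) (hX : IsSmoothVField X)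
    (hs : s = 1 ∨ s = -1) : IsBasicGen ξ (liftSec p g ξ s X) where
  vec := S.isSmoothVField_horLift hX
  cov Y hY := contMDiff_const.mul (contMDiff_inner_apply g (S.isSmoothVField_horLift hX) hY)
  vec_invariant a x := S.actDeriv_horLift X a x
  cov_invariant a x u := by
    rw [liftSec_snd, liftSec_snd, ← S.actDeriv_horLift, S.metric]
  perp x e := by
    have h1 := S.horLift_mem (s := s) (X (p x)) e
    change s * g.inner x (horLift p g ξ s x (X (p x))) (fundMap x e)
      + ξ e x (horLift p g ξ s x (X (p x))) = 0
    rcases hs with rfl | rfl <;> linarith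

theorem fundMap_connForm_horLift (S : IsReduction EN p g H ξ) (x : M)
    (a : TangentSpace 𝓘(ℝ, EN) (p x)) :
    horLift p g ξ (-1) x a = horLift p g ξ 1 x a
      + fundMap x (connForm g ξ b 1 x (horLift p g ξ (-1) x a)) := by
  refine sub_eq_iff_eq_add.1 (S.horLift_eq ?_ ?_).symm
  · exact sub_fundMap_connForm_mem_tau b S.extension (S.injective x) _
  · rw [map_sub, S.mfderiv_fundMap, S.mfderiv_horLift, sub_zero]

theorem eq_horLift_add_fundMap (S : IsReduction EN p g H ξ) (x : M)
    (u : TangentSpace 𝓘(ℝ, E) x) :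
    u = horLift p g ξ 1 x (mfderiv 𝓘(ℝ, E) 𝓘(ℝ, EN) p x u)
      + fundMap x (connForm g ξ b 1 x u) := by
  refine sub_eq_iff_eq_add.1 (S.horLift_eq ?_ ?_).symm
  · exact sub_fundMap_connForm_mem_tau b S.extension (S.injective x) _
  · rw [map_sub, S.mfderiv_fundMap, sub_zero]

theorem liftSec_neg_eq (S : IsReduction EN p g H ξ)
    (hh : ∀ x, ∀ a b : TangentSpace 𝓘(ℝ, EN) (p x),
      h.inner (p x) a b = g.inner x (horLift p g ξ 1 x a) (horLift p g ξ 1 x b)) :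
    liftSec p g ξ (-1) X = liftSec p g ξ 1 X + ((-2 : ℝ) • dualSec p h X
      + vertSec ξ (connForm g ξ b 1) fun x ↦ horLift p g ξ (-1) x (X (p x))) := by
  funext x
  have h1 := S.fundMap_connForm_horLift b x (X (p x))
  refine Prod.ext ?_ (ContinuousLinearMap.ext fun v ↦ ?_)
  · refine h1.trans ?_
    change _ = horLift p g ξ 1 x (X (p x)) + ((-2 : ℝ) • (0 : TangentSpace 𝓘(ℝ, E) x) + _)
    rw [smul_zero, zero_add]
    rfl
  · set ψ := connForm g ξ b 1 x (horLift p g ξ (-1) x (X (p x)))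
    change -1 * g.inner x (horLift p g ξ (-1) x (X (p x))) v
      = 1 * g.inner x (horLift p g ξ 1 x (X (p x))) v
        + (-2 * h.inner (p x) (X (p x)) (mfderiv 𝓘(ℝ, E) 𝓘(ℝ, EN) p x v) + ξ ψ x v)
    rw [hh]
    have h2 := S.eq_horLift_add_fundMap b x v
    set w := horLift p g ξ 1 x (mfderiv 𝓘(ℝ, E) 𝓘(ℝ, EN) p x v) with hw
    set e := connForm g ξ b 1 x v
    have h3 := S.horLift_mem (s := -1) (X (p x)) e
    have h4 := S.horLift_mem (s := 1) (X (p x)) e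
    have h5 := S.horLift_mem (s := 1) (mfderiv 𝓘(ℝ, E) 𝓘(ℝ, EN) p x v) ψ
    have h6 := S.extension.antisymm e ψ x
    rw [← hw] at h5
    rw [h1] at h3 ⊢
    rw [h2]
    simp only [map_add, add_apply] at h3 ⊢
    have h7 := g.symm x (fundMap x ψ) w
    linarith

theorem isSmoothGen_vertSec (S : IsReduction EN p g H ξ) {X : VField E M} (hX : IsSmoothVField X) :
    IsSmoothGen (vertSec ξ (connForm g ξ b s) X) :=
  isSmoothGen_combination S.extension (S.covSmooth_connForm b X hX)

theorem dualSec_eq (S : IsReduction EN p g H ξ)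
    (hh : ∀ x, ∀ a b : TangentSpace 𝓘(ℝ, EN) (p x),
      h.inner (p x) a b = g.inner x (horLift p g ξ 1 x a) (horLift p g ξ 1 x b)) :
    dualSec p h X = (1 / 2 : ℝ) • (liftSec p g ξ 1 X + ((-1 : ℝ) • liftSec p g ξ (-1) X
      + vertSec ξ (connForm g ξ b 1) fun x ↦ horLift p g ξ (-1) x (X (p x)))) := by
  rw [S.liftSec_neg_eq b hh]
  module

theorem isBasicGen_dualSec (S : IsReduction EN p g H ξ)
    (hh : ∀ x, ∀ a b : TangentSpace 𝓘(ℝ, EN) (p x),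
      h.inner (p x) a b = g.inner x (horLift p g ξ 1 x a) (horLift p g ξ 1 x b))
    (hX : IsSmoothVField X) : IsBasicGen (E := E) ξ (dualSec p h X) where
  toIsSmoothGen := by
    let b := Module.finBasis ℝ EG
    rw [S.dualSec_eq (G := G) (EG := EG) b hh]
    exact ((S.isBasicGen_liftSec hX (.inl rfl)).toIsSmoothGen.add
      (((S.isBasicGen_liftSec hX (.inr rfl)).toIsSmoothGen.smul _).add
      (S.isSmoothGen_vertSec b (S.isSmoothVField_horLift hX)))).smul _
  vec_invariant a x := map_zero (actDeriv E a x)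
  cov_invariant a x u := by
    have h1 : (mfderiv 𝓘(ℝ, E) 𝓘(ℝ, EN) p (a • x) (actDeriv E a x u) : EN)
      = mfderiv 𝓘(ℝ, E) 𝓘(ℝ, EN) p x u :=
        mfderiv_actDeriv_of_invariant EG S.proj_smul S.mdifferentiable a x u
    have h2 (n n' : N) (hn : n = n') (c c' : EN) (hc : c = c') :
      h.inner n (X n) c = h.inner n' (X n') c' := by subst hn hc; rfl
    exact h2 _ _ (S.proj_smul a x) _ _ h1
  perp x e := by
    change h.inner (p x) (X (p x)) (mfderiv 𝓘(ℝ, E) 𝓘(ℝ, EN) p x (fundMap x e)) + ξ e x 0 = 0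
    rw [S.mfderiv_fundMap, map_zero, map_zero, add_zero]

end IsReduction

end LiftedSections

section LiftedTriples

set_option linter.unusedSectionVars false

variable {E : Type*} [NormedAddCommGroup E] [NormedSpace ℝ E] [FiniteDimensional ℝ E]
  {EG : Type*} [NormedAddCommGroup EG] [NormedSpace ℝ EG] [FiniteDimensional ℝ EG]
  {EN : Type*} [NormedAddCommGroup EN] [NormedSpace ℝ EN] [FiniteDimensional ℝ EN]
  {M : Type*} [TopologicalSpace M] [ChartedSpace E M] [IsManifold 𝓘(ℝ, E) ∞ M] [T2Space M]
  {N : Type*} [TopologicalSpace N] [ChartedSpace EN N] [IsManifold 𝓘(ℝ, EN) ∞ N] [T2Space N]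
  {G : Type*} [TopologicalSpace G] [ChartedSpace EG G] [Group G] [MulAction G M]
  [CompactSpace G] [LieGroup 𝓘(ℝ, EG) ∞ G] [ContMDiffSMul 𝓘(ℝ, EG) 𝓘(ℝ, E) ∞ G M]
  {p : M → N} {g : RMetric E M} {H : Form E M 3}
  {ξ : GroupLieAlgebra 𝓘(ℝ, EG) G →ₗ[ℝ] CovField E M} {s : ℝ} {h : RMetric EN N}
  {X Y Z : VField EN N} {A B C : GenSection E M}

attribute [local instance] isManifold_one isManifold_two

theorem mvfderiv_inner_comp (hp : ContMDiff 𝓘(ℝ, E) 𝓘(ℝ, EN) ∞ p) (hX : IsSmoothVField X)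
    (hY : IsSmoothVField Y) (x : M) (v : TangentSpace 𝓘(ℝ, E) x) :
    mvfderiv 𝓘(ℝ, E) (fun y ↦ h.inner (p y) (X (p y)) (Y (p y))) x v
      = mvfderiv 𝓘(ℝ, EN) (fun n ↦ h.inner n (X n) (Y n)) (p x)
          (mfderiv 𝓘(ℝ, E) 𝓘(ℝ, EN) p x v) :=
  mvfderiv_comp_mfderiv (f := fun n ↦ h.inner n (X n) (Y n))
    ((contMDiff_inner_apply h hX hY _).mdifferentiableAt (by simp))
    ((hp x).mdifferentiableAt (by simp)) v

theorem courantTriple_dualSec₀ (hp : ContMDiff 𝓘(ℝ, E) 𝓘(ℝ, EN) ∞ p)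
    (hX : IsSmoothVField X) (hY : IsSmoothVField Y) (hZ : IsSmoothVField Z)
    (hA : IsSmoothGen (dualSec (E := E) p h X)) (hB : IsSmoothGen B) (hC : IsSmoothGen C)
    (hBY : ∀ x, mfderiv 𝓘(ℝ, E) 𝓘(ℝ, EN) p x (B x).1 = Y (p x))
    (hCZ : ∀ x, mfderiv 𝓘(ℝ, E) 𝓘(ℝ, EN) p x (C x).1 = Z (p x)) (x : M) :
    courantTriple H (dualSec p h X) B C x
      = h.inner (p x) (X (p x)) (mlieBracket 𝓘(ℝ, EN) Y Z (p x))
        - mvfderiv 𝓘(ℝ, EN) (fun n ↦ h.inner n (X n) (Z n)) (p x) (Y (p x))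
        + mvfderiv 𝓘(ℝ, EN) (fun n ↦ h.inner n (X n) (Y n)) (p x) (Z (p x)) := by
  rw [courantTriple_eq hA hB hC]
  have e1 (W : VField E M) : mlieBracket 𝓘(ℝ, E) (fun y ↦ (dualSec (E := E) p h X y).1) W x = 0 := by
    change mlieBracket 𝓘(ℝ, E) (0 : VField E M) W x = 0
    rw [mlieBracket_zero_left]; rfl
  have e2 : (fun y ↦ (dualSec (E := E) p h X y).2 (B y).1)
      = fun y ↦ h.inner (p y) (X (p y)) (Y (p y)) := funext fun y ↦ by rw [dualSec_snd, hBY]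
  have e3 : (fun y ↦ (dualSec (E := E) p h X y).2 (C y).1)
      = fun y ↦ h.inner (p y) (X (p y)) (Z (p y)) := funext fun y ↦ by rw [dualSec_snd, hCZ]
  have e4 : (dualSec (E := E) p h X x).1 = 0 := rfl
  rw [e1, e1, e2, e3, e4, mvfderiv_inner_comp hp hX hZ, mvfderiv_inner_comp hp hX hY, hBY, hCZ,
    dualSec_snd, mfderiv_mlieBracket_of_related hp hB.vec hC.vec hY hZ hBY hCZ, map_zero, map_zero,
    map_zero]
  have e5 : H x ![0, (B x).1, (C x).1] = 0 := (H x).map_coord_zero 0 rfl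
  rw [e5]
  ring

theorem courantTriple_dualSec₁ (hp : ContMDiff 𝓘(ℝ, E) 𝓘(ℝ, EN) ∞ p)
    (hX : IsSmoothVField X) (hY : IsSmoothVField Y) (hZ : IsSmoothVField Z)
    (hA : IsSmoothGen A) (hB : IsSmoothGen (dualSec (E := E) p h Y)) (hC : IsSmoothGen C)
    (hAX : ∀ x, mfderiv 𝓘(ℝ, E) 𝓘(ℝ, EN) p x (A x).1 = X (p x))
    (hCZ : ∀ x, mfderiv 𝓘(ℝ, E) 𝓘(ℝ, EN) p x (C x).1 = Z (p x)) (x : M) :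
    courantTriple H A (dualSec p h Y) C x
      = mvfderiv 𝓘(ℝ, EN) (fun n ↦ h.inner n (Y n) (Z n)) (p x) (X (p x))
        - h.inner (p x) (Y (p x)) (mlieBracket 𝓘(ℝ, EN) X Z (p x)) := by
  have h1 := courantTriple_add_swap₀₁ (H := H) hB hA hC x
  rw [courantTriple_dualSec₀ hp hY hX hZ hB hA hC hAX hCZ] at h1
  have e2 : (fun y ↦ pairing (dualSec (E := E) p h Y y) (A y))
      = fun y ↦ h.inner (p y) (Y (p y)) (X (p y)) := funext fun y ↦ by
    change (dualSec (E := E) p h Y y).2 (A y).1 + (A y).2 0 = _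
    rw [dualSec_snd, hAX, map_zero, add_zero]
  rw [e2, mvfderiv_inner_comp hp hY hX, hCZ] at h1
  linarith

theorem courantTriple_dualSec₂ (hp : ContMDiff 𝓘(ℝ, E) 𝓘(ℝ, EN) ∞ p)
    (hX : IsSmoothVField X) (hY : IsSmoothVField Y)
    (hA : IsSmoothGen A) (hB : IsSmoothGen B)
    (hAX : ∀ x, mfderiv 𝓘(ℝ, E) 𝓘(ℝ, EN) p x (A x).1 = X (p x))
    (hBY : ∀ x, mfderiv 𝓘(ℝ, E) 𝓘(ℝ, EN) p x (B x).1 = Y (p x)) (x : M) :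
    courantTriple H A B (dualSec p h Z) x
      = h.inner (p x) (Z (p x)) (mlieBracket 𝓘(ℝ, EN) X Y (p x)) := by
  rw [← mfderiv_mlieBracket_of_related hp hA.vec hB.vec hX hY hAX hBY]
  exact (congrArg (_ + ·) (dualSec_snd (p := p) (h := h) (X := Z) x _)).trans
    ((congrArg (· + _) (map_zero _)).trans (zero_add _))

variable (H ξ) in
/-- The expression `H + dθ ∧ ξ`. -/
def redForm (θ : Π x : M, TangentSpace 𝓘(ℝ, E) x →L[ℝ] GroupLieAlgebra 𝓘(ℝ, EG) G) (x : M)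
    (u v w : TangentSpace 𝓘(ℝ, E) x) : ℝ :=
  H x ![u, v, w] + ξ (covD (F := EG) θ x u v) x w + ξ (covD (F := EG) θ x v w) x u
    - ξ (covD (F := EG) θ x u w) x v

variable {ι : Type*} [Fintype ι] (b : Module.Basis ι ℝ (GroupLieAlgebra 𝓘(ℝ, EG) G))

namespace IsReduction

theorem covD_connForm_horLift (S : IsReduction EN p g H ξ) (hX : IsSmoothVField X)
    (hY : IsSmoothVField Y) (x : M) :
    covD (F := EG) (connForm g ξ b 1) x (horLift p g ξ 1 x (X (p x))) (horLift p g ξ 1 x (Y (p x)))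
      = - connForm g ξ b 1 x (mlieBracket 𝓘(ℝ, E) (fun y ↦ horLift p g ξ 1 y (X (p y)))
          (fun y ↦ horLift p g ξ 1 y (Y (p y))) x) := by
  have h1 := covD_apply (F := EG) (S.covSmooth_connForm (s := 1) b)
    (S.isSmoothVField_horLift (s := 1) hX) (S.isSmoothVField_horLift (s := 1) hY) x
  have h0 (X : VField EN N) : (fun y ↦ connForm g ξ b 1 y (horLift p g ξ 1 y (X (p y))) : M → EG)
      = fun _ ↦ 0 :=
    funext fun y ↦ (connForm_eq_zero_iff b S.extension (S.injective y)).2 (S.horLift_mem _)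
  have h2 (X : VField EN N) (v : TangentSpace 𝓘(ℝ, E) x) := congrArg
    (fun f : M → EG ↦ mvfderiv 𝓘(ℝ, E) f x v) (h0 X)
  have h3 (v : TangentSpace 𝓘(ℝ, E) x) : mvfderiv 𝓘(ℝ, E) (fun _ : M ↦ (0 : EG)) x v = 0 := by
    rw [mvfderiv_const]; rfl
  refine h1.trans ?_
  refine (congrArg₂ (fun u v : EG ↦ u - v - _) ((h2 Y _).trans (h3 _))
    ((h2 X _).trans (h3 _))).trans ?_
  rw [sub_zero]
  exact zero_sub (G := EG) _

theorem inner_horLift_mlieBracket (S : IsReduction EN p g H ξ)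
    (hh : ∀ x, ∀ a b : TangentSpace 𝓘(ℝ, EN) (p x),
      h.inner (p x) a b = g.inner x (horLift p g ξ 1 x a) (horLift p g ξ 1 x b))
    (hX : IsSmoothVField X) (hY : IsSmoothVField Y) (x : M) (a : TangentSpace 𝓘(ℝ, EN) (p x)) :
    g.inner x (horLift p g ξ 1 x a) (mlieBracket 𝓘(ℝ, E) (fun y ↦ horLift p g ξ 1 y (X (p y)))
          (fun y ↦ horLift p g ξ 1 y (Y (p y))) x)
      = h.inner (p x) a (mlieBracket 𝓘(ℝ, EN) X Y (p x))
        + ξ (covD (F := EG) (connForm g ξ b 1) x (horLift p g ξ 1 x (X (p x)))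
            (horLift p g ξ 1 x (Y (p x)))) x (horLift p g ξ 1 x a) := by
  have h1 := S.eq_horLift_add_fundMap b x (mlieBracket 𝓘(ℝ, E)
    (fun y ↦ horLift p g ξ 1 y (X (p y))) (fun y ↦ horLift p g ξ 1 y (Y (p y))) x)
  have h2 := mfderiv_mlieBracket_of_related S.submersion.contMDiff
    (S.isSmoothVField_horLift (s := 1) hX) (S.isSmoothVField_horLift (s := 1) hY) hX hY
    (fun y ↦ S.mfderiv_horLift (X (p y))) (fun y ↦ S.mfderiv_horLift (Y (p y))) x
  have h3 := S.covD_connForm_horLift b hX hY x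
  have h4 (e : GroupLieAlgebra 𝓘(ℝ, EG) G) (v : TangentSpace 𝓘(ℝ, E) x) :
      ξ (-e) x v = - ξ e x v := by
    have : ξ (-e) x = - ξ e x := congrFun (map_neg ξ e) x
    rw [this]; rfl
  rw [h3, h4]
  set u := mlieBracket 𝓘(ℝ, E)
    (fun y ↦ horLift p g ξ 1 y (X (p y))) (fun y ↦ horLift p g ξ 1 y (Y (p y))) x
  rw [h2] at h1
  have h5 := S.horLift_mem (s := 1) a (connForm g ξ b 1 x u)
  have h6 := congrArg (g.inner x (horLift p g ξ 1 x a)) h1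
  rw [map_add] at h6
  rw [hh]
  linarith

theorem courantTriple_liftSec (S : IsReduction EN p g H ξ)
    (hh : ∀ x, ∀ a b : TangentSpace 𝓘(ℝ, EN) (p x),
      h.inner (p x) a b = g.inner x (horLift p g ξ 1 x a) (horLift p g ξ 1 x b))
    (hX : IsSmoothVField X) (hY : IsSmoothVField Y) (hZ : IsSmoothVField Z) (x : M) :
    courantTriple H (liftSec p g ξ 1 X) (liftSec p g ξ 1 Y) (liftSec p g ξ 1 Z) x
      = h.inner (p x) (Z (p x)) (mlieBracket 𝓘(ℝ, EN) X Y (p x))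
        + h.inner (p x) (X (p x)) (mlieBracket 𝓘(ℝ, EN) Y Z (p x))
        - h.inner (p x) (Y (p x)) (mlieBracket 𝓘(ℝ, EN) X Z (p x))
        + mvfderiv 𝓘(ℝ, EN) (fun n ↦ h.inner n (Y n) (Z n)) (p x) (X (p x))
        - mvfderiv 𝓘(ℝ, EN) (fun n ↦ h.inner n (X n) (Z n)) (p x) (Y (p x))
        + mvfderiv 𝓘(ℝ, EN) (fun n ↦ h.inner n (X n) (Y n)) (p x) (Z (p x))
        + redForm H ξ (connForm g ξ b 1) x (horLift p g ξ 1 x (X (p x)))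
            (horLift p g ξ 1 x (Y (p x))) (horLift p g ξ 1 x (Z (p x))) := by
  have hs (W : VField EN N) (hW : IsSmoothVField W) := (S.isBasicGen_liftSec hW (.inl rfl)).toIsSmoothGen
  rw [courantTriple_eq (hs X hX) (hs Y hY) (hs Z hZ)]
  have e (V W : VField EN N) : (fun y ↦ (liftSec p g ξ 1 V y).2 (liftSec p g ξ 1 W y).1)
      = fun y ↦ h.inner (p y) (V (p y)) (W (p y)) :=
    funext fun y ↦ by rw [hh, liftSec_snd, one_mul]; rfl
  rw [e, e, e, liftSec_snd, liftSec_snd, liftSec_snd, one_mul, one_mul, one_mul,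
    mvfderiv_inner_comp S.submersion.contMDiff hY hZ, mvfderiv_inner_comp S.submersion.contMDiff hX hZ,
    mvfderiv_inner_comp S.submersion.contMDiff hX hY]
  simp only [liftSec_fst, S.mfderiv_horLift]
  rw [S.inner_horLift_mlieBracket b hh hX hY, S.inner_horLift_mlieBracket b hh hX hZ,
    S.inner_horLift_mlieBracket b hh hY hZ, redForm]
  ring

end IsReduction

end LiftedTriples

section BismutConnection

set_option linter.unusedSectionVars false

variable {E : Type*} [NormedAddCommGroup E] [NormedSpace ℝ E] [FiniteDimensional ℝ E]
  {EG : Type*} [NormedAddCommGroup EG] [NormedSpace ℝ EG] [FiniteDimensional ℝ EG]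
  {EN : Type*} [NormedAddCommGroup EN] [NormedSpace ℝ EN] [FiniteDimensional ℝ EN]
  {M : Type*} [TopologicalSpace M] [ChartedSpace E M] [IsManifold 𝓘(ℝ, E) ∞ M] [T2Space M]
  {N : Type*} [TopologicalSpace N] [ChartedSpace EN N] [IsManifold 𝓘(ℝ, EN) ∞ N] [T2Space N]
  {G : Type*} [TopologicalSpace G] [ChartedSpace EG G] [Group G] [MulAction G M]
  [CompactSpace G] [LieGroup 𝓘(ℝ, EG) ∞ G] [ContMDiffSMul 𝓘(ℝ, EG) 𝓘(ℝ, E) ∞ G M]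
  {p : M → N} {g : RMetric E M} {H : Form E M 3}
  {ξ : GroupLieAlgebra 𝓘(ℝ, EG) G →ₗ[ℝ] CovField E M} {s : ℝ} {h : RMetric EN N}
  {X Y Z : VField EN N} {A B C : GenSection E M}
  {ι : Type*} [Fintype ι] (b : Module.Basis ι ℝ (GroupLieAlgebra 𝓘(ℝ, EG) G))

attribute [local instance] isManifold_one isManifold_two

namespace IsReduction

theorem pairing_genLift_self
    (hh : ∀ x, ∀ a b : TangentSpace 𝓘(ℝ, EN) (p x),
      h.inner (p x) a b = g.inner x (horLift p g ξ 1 x a) (horLift p g ξ 1 x b))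
    {x : M} (a c : TangentSpace 𝓘(ℝ, EN) (p x)) :
    pairing (genLift p g ξ 1 x a) (genLift p g ξ 1 x c) = 2 * h.inner (p x) a c := by
  rw [hh]
  change 1 * g.inner x (horLift p g ξ 1 x a) (horLift p g ξ 1 x c)
    + 1 * g.inner x (horLift p g ξ 1 x c) (horLift p g ξ 1 x a) = _
  rw [g.symm x (horLift p g ξ 1 x c)]
  ring

theorem pairing_genLift_neg {x : M} (a c : TangentSpace 𝓘(ℝ, EN) (p x)) :
    pairing (genLift p g ξ (-1) x a) (genLift p g ξ 1 x c) = 0 := by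
  change -1 * g.inner x (horLift p g ξ (-1) x a) (horLift p g ξ 1 x c)
    + 1 * g.inner x (horLift p g ξ 1 x c) (horLift p g ξ (-1) x a) = _
  rw [g.symm x (horLift p g ξ 1 x c)]
  ring

theorem pairing_genLift_fundMap (S : IsReduction EN p g H ξ) (hs : s = 1 ∨ s = -1)
    {x : M} (a : TangentSpace 𝓘(ℝ, EN) (p x)) (e : GroupLieAlgebra 𝓘(ℝ, EG) G) :
    pairing (genLift p g ξ s x a) (fundMap x e, ξ e x) = 0 := by
  have h1 := S.horLift_mem (s := s) a e
  change s * g.inner x (horLift p g ξ s x a) (fundMap x e) + ξ e x (horLift p g ξ s x a) = 0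
  rcases hs with rfl | rfl <;> linarith

theorem mem_subbundleK (S : IsReduction EN p g H ξ) {x : M} {c : GenTangent (E := E) x}
    (h₀ : mfderiv 𝓘(ℝ, E) 𝓘(ℝ, EN) p x c.1 = 0)
    (h₁ : ∀ e : GroupLieAlgebra 𝓘(ℝ, EG) G, pairing c (fundMap x e, ξ e x) = 0)
    (h₂ : ∀ a : TangentSpace 𝓘(ℝ, EN) (p x), pairing c (genLift p g ξ 1 x a) = 0) :
    c ∈ subbundleK ξ x := by
  let b := Module.finBasis ℝ EG
  obtain ⟨f, hf⟩ := S.mfderiv_eq_zero_iff.1 h₀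
  refine ⟨f, Prod.ext hf (ContinuousLinearMap.ext fun v ↦ ?_)⟩
  have h3 (e : GroupLieAlgebra 𝓘(ℝ, EG) G) : c.2 (fundMap x e) = ξ f x (fundMap x e) := by
    have h4 : c.2 (fundMap x e) + ξ e x c.1 = 0 := h₁ e
    have h5 := S.extension.antisymm e f x
    rw [hf] at h5
    linarith
  have h6 (a : TangentSpace 𝓘(ℝ, EN) (p x)) :
      c.2 (horLift p g ξ 1 x a) = ξ f x (horLift p g ξ 1 x a) := by
    have h7 : c.2 (horLift p g ξ 1 x a) + 1 * g.inner x (horLift p g ξ 1 x a) c.1 = 0 := h₂ a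
    have h8 := S.horLift_mem (s := 1) a f
    rw [hf] at h8
    linarith
  have h9 := S.eq_horLift_add_fundMap (EG := EG) (G := G) b x v
  rw [h9, map_add, map_add]
  exact (congrArg₂ (· + ·) (h6 _) (h3 _)).symm

theorem isReducedPlusBismut_iff (S : IsReduction EN p g H ξ)
    (hh : ∀ x, ∀ a b : TangentSpace 𝓘(ℝ, EN) (p x),
      h.inner (p x) a b = g.inner x (horLift p g ξ 1 x a) (horLift p g ξ 1 x b))
    {D : AffineConnection EN N} : IsReducedPlusBismut p g H ξ D ↔
      ∀ X Y Z : VField EN N, IsSmoothVField X → IsSmoothVField Y → IsSmoothVField Z → ∀ x : M,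
        courantTriple H (liftSec p g ξ (-1) X) (liftSec p g ξ 1 Y) (liftSec p g ξ 1 Z) x
          = 2 * h.inner (p x) (D Y (p x) (X (p x))) (Z (p x)) := by
  constructor
  · intro hD X Y Z hX hY hZ x
    obtain ⟨w, e, he⟩ := hD X Y hX hY x
    have h1 : courantBracket H (liftSec p g ξ (-1) X) (liftSec p g ξ 1 Y) x
        = (fundMap x e, ξ e x)
          + (genLift p g ξ 1 x (D Y (p x) (X (p x))) + genLift p g ξ (-1) x w) :=
      sub_eq_iff_eq_add.1 he.symm
    have h2 := S.pairing_genLift_fundMap (s := 1) (.inl rfl) (x := x) (Z (p x)) e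
    rw [courantTriple, h1, pairing_add_left, pairing_add_left, pairing_comm, liftSec, h2,
      pairing_genLift_neg, pairing_genLift_self hh]
    ring
  · intro hD X Y hX hY x
    obtain ⟨d, hd⟩ : ∃ d, d = D Y (p x) (X (p x)) := ⟨_, rfl⟩
    obtain ⟨w, hw⟩ : ∃ w, w = mfderiv 𝓘(ℝ, E) 𝓘(ℝ, EN) p x
      (courantBracket H (liftSec p g ξ (-1) X) (liftSec p g ξ 1 Y) x).1 - d := ⟨_, rfl⟩
    rw [← hd]
    refine ⟨w, S.mem_subbundleK ?_ ?_ ?_⟩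
    · change mfderiv 𝓘(ℝ, E) 𝓘(ℝ, EN) p x
        ((courantBracket H (liftSec p g ξ (-1) X) (liftSec p g ξ 1 Y) x).1
          - (horLift p g ξ 1 x d + horLift p g ξ (-1) x w)) = 0
      rw [map_sub, map_add, S.mfderiv_horLift, S.mfderiv_horLift, hw]
      abel
    · intro e
      have h1 : courantTriple H (liftSec p g ξ (-1) X) (liftSec p g ξ 1 Y)
          (fun x ↦ (fundMap x e, ξ e x)) x = 0 :=
        (S.isBasicGen_liftSec hX (.inr rfl)).courantTriple_of_mem₂ S.extension
          (S.isBasicGen_liftSec hY (.inl rfl)) ⟨e, rfl⟩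
      have h2 : pairing (courantBracket H (liftSec p g ξ (-1) X) (liftSec p g ξ 1 Y) x)
        (fundMap x e, ξ e x) = 0 := h1
      have h3 := S.pairing_genLift_fundMap (s := 1) (.inl rfl) (x := x) d e
      have h4 := S.pairing_genLift_fundMap (s := -1) (.inr rfl) (x := x) w e
      refine (congrArg (fun c ↦ pairing c (fundMap x e, ξ e x)) (sub_eq_add_neg _ _)).trans ?_
      rw [pairing_add_left, ← neg_one_smul ℝ (_ + _), pairing_smul_left, pairing_add_left, h3, h4]
      refine (congrArg (· + _) h2).trans ?_
      ring
    · intro a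
      obtain ⟨Z, hZ, hZa⟩ := exists_isSmoothVField_eq (E := EN) (M := N) (p x) a
      have h1 : pairing (courantBracket H (liftSec p g ξ (-1) X) (liftSec p g ξ 1 Y) x)
          (genLift p g ξ 1 x (Z (p x))) = 2 * h.inner (p x) d (Z (p x)) := by
        rw [hd]
        exact hD X Y Z hX hY hZ x
      rw [hZa] at h1
      refine (congrArg (fun c ↦ pairing c (genLift p g ξ 1 x a)) (sub_eq_add_neg _ _)).trans ?_
      rw [pairing_add_left, ← neg_one_smul ℝ (_ + _), pairing_smul_left, pairing_add_left,
        pairing_genLift_neg, pairing_genLift_self hh]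
      refine (congrArg (· + _) h1).trans ?_
      ring

theorem courantTriple_liftSec_neg (S : IsReduction EN p g H ξ)
    (hh : ∀ x, ∀ a b : TangentSpace 𝓘(ℝ, EN) (p x),
      h.inner (p x) a b = g.inner x (horLift p g ξ 1 x a) (horLift p g ξ 1 x b))
    (hX : IsSmoothVField X) (hY : IsSmoothVField Y) (hZ : IsSmoothVField Z) (x : M) :
    courantTriple H (liftSec p g ξ (-1) X) (liftSec p g ξ 1 Y) (liftSec p g ξ 1 Z) x
      = h.inner (p x) (Z (p x)) (mlieBracket 𝓘(ℝ, EN) X Y (p x))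
        - h.inner (p x) (X (p x)) (mlieBracket 𝓘(ℝ, EN) Y Z (p x))
        - h.inner (p x) (Y (p x)) (mlieBracket 𝓘(ℝ, EN) X Z (p x))
        + mvfderiv 𝓘(ℝ, EN) (fun n ↦ h.inner n (Y n) (Z n)) (p x) (X (p x))
        + mvfderiv 𝓘(ℝ, EN) (fun n ↦ h.inner n (X n) (Z n)) (p x) (Y (p x))
        - mvfderiv 𝓘(ℝ, EN) (fun n ↦ h.inner n (X n) (Y n)) (p x) (Z (p x))
        + redForm H ξ (connForm g ξ b 1) x (horLift p g ξ 1 x (X (p x)))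
            (horLift p g ξ 1 x (Y (p x))) (horLift p g ξ 1 x (Z (p x))) := by
  have hs (W : VField EN N) (hW : IsSmoothVField W) := S.isBasicGen_liftSec hW (s := 1) (.inl rfl)
  have hρ := S.isBasicGen_dualSec hh hX
  have hκ := S.isSmoothGen_vertSec (s := 1) b (S.isSmoothVField_horLift (s := -1) hX)
  have hY' := (hs Y hY).toIsSmoothGen
  have hZ' := (hs Z hZ).toIsSmoothGen
  rw [S.liftSec_neg_eq b hh, courantTriple_add₀ (hs X hX).toIsSmoothGen
    ((hρ.toIsSmoothGen.smul _).add hκ) hY' hZ',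
    courantTriple_add₀ (hρ.toIsSmoothGen.smul _) hκ hY' hZ',
    courantTriple_smul₀ _ hρ.toIsSmoothGen hY' hZ',
    (hs Y hY).courantTriple_of_mem₀ S.extension (hs Z hZ) hκ fun x ↦ vertSec_mem x,
    S.courantTriple_liftSec b hh hX hY hZ,
    courantTriple_dualSec₀ S.submersion.contMDiff hX hY hZ hρ.toIsSmoothGen hY' hZ'
      (fun y ↦ S.mfderiv_horLift _) (fun y ↦ S.mfderiv_horLift _)]
  ring

theorem metricSplitting_eq (S : IsReduction EN p g H ξ)
    (hh : ∀ x, ∀ a b : TangentSpace 𝓘(ℝ, EN) (p x),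
      h.inner (p x) a b = g.inner x (horLift p g ξ 1 x a) (horLift p g ξ 1 x b)) :
    metricSplitting p g ξ X = liftSec p g ξ 1 X + ((-1 : ℝ) • dualSec p h X
      + (1 / 2 : ℝ) • vertSec ξ (connForm g ξ b 1) fun x ↦ horLift p g ξ (-1) x (X (p x))) := by
  have h1 : metricSplitting p g ξ X
      = (1 / 2 : ℝ) • (liftSec p g ξ 1 X + liftSec p g ξ (-1) X) := rfl
  rw [h1, S.liftSec_neg_eq b hh]
  module

theorem isBasicGen_metricSplitting (S : IsReduction EN p g H ξ) (hX : IsSmoothVField X) :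
    IsBasicGen ξ (metricSplitting p g ξ X) :=
  ((S.isBasicGen_liftSec hX (.inl rfl)).add (S.isBasicGen_liftSec hX (.inr rfl))).smul _

theorem mfderiv_metricSplitting (S : IsReduction EN p g H ξ) (x : M) :
    mfderiv 𝓘(ℝ, E) 𝓘(ℝ, EN) p x (metricSplitting p g ξ X x).1 = X (p x) := by
  change mfderiv 𝓘(ℝ, E) 𝓘(ℝ, EN) p x ((1 / 2 : ℝ) • (horLift p g ξ 1 x (X (p x))
    + horLift p g ξ (-1) x (X (p x)))) = X (p x)
  rw [map_smul, map_add, S.mfderiv_horLift, S.mfderiv_horLift]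
  module

theorem courantTriple_metricSplitting (S : IsReduction EN p g H ξ)
    (hh : ∀ x, ∀ a b : TangentSpace 𝓘(ℝ, EN) (p x),
      h.inner (p x) a b = g.inner x (horLift p g ξ 1 x a) (horLift p g ξ 1 x b))
    (hX : IsSmoothVField X) (hY : IsSmoothVField Y) (hZ : IsSmoothVField Z) (x : M) :
    courantTriple H (metricSplitting p g ξ X) (metricSplitting p g ξ Y) (metricSplitting p g ξ Z) x
      = redForm H ξ (connForm g ξ b 1) x (horLift p g ξ 1 x (X (p x)))
            (horLift p g ξ 1 x (Y (p x))) (horLift p g ξ 1 x (Z (p x))) := by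
  have hl (W : VField EN N) (hW : IsSmoothVField W) := S.isBasicGen_liftSec hW (s := 1) (.inl rfl)
  have hρ (W : VField EN N) (hW : IsSmoothVField W) := S.isBasicGen_dualSec hh hW
  have hκ (W : VField EN N) (hW : IsSmoothVField W) :=
    S.isSmoothGen_vertSec (s := 1) b (S.isSmoothVField_horLift (s := -1) hW)
  have hm (W : VField EN N) (hW : IsSmoothVField W) := S.isBasicGen_metricSplitting hW
  have e₀ : courantTriple H (metricSplitting p g ξ X) (metricSplitting p g ξ Y)
      (metricSplitting p g ξ Z) x
      = courantTriple H (liftSec p g ξ 1 X) (metricSplitting p g ξ Y) (metricSplitting p g ξ Z) x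
        - courantTriple H (dualSec p h X) (metricSplitting p g ξ Y) (metricSplitting p g ξ Z) x := by
    have h1 := (hm Y hY).toIsSmoothGen
    have h2 := (hm Z hZ).toIsSmoothGen
    rw [S.metricSplitting_eq (X := X) b hh, courantTriple_add₀ (hl X hX).toIsSmoothGen
        (((hρ X hX).toIsSmoothGen.smul _).add ((hκ X hX).smul _)) h1 h2,
      courantTriple_add₀ ((hρ X hX).toIsSmoothGen.smul _) ((hκ X hX).smul _) h1 h2,
      courantTriple_smul₀ _ (hρ X hX).toIsSmoothGen h1 h2, courantTriple_smul₀ _ (hκ X hX) h1 h2,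
      (hm Y hY).courantTriple_of_mem₀ S.extension (hm Z hZ) (hκ X hX) fun x ↦ vertSec_mem x]
    ring
  have e₁ : courantTriple H (liftSec p g ξ 1 X) (metricSplitting p g ξ Y)
      (metricSplitting p g ξ Z) x
      = courantTriple H (liftSec p g ξ 1 X) (liftSec p g ξ 1 Y) (metricSplitting p g ξ Z) x
        - courantTriple H (liftSec p g ξ 1 X) (dualSec p h Y) (metricSplitting p g ξ Z) x := by
    have h1 := (hl X hX).toIsSmoothGen
    have h2 := (hm Z hZ).toIsSmoothGen
    rw [S.metricSplitting_eq (X := Y) b hh, courantTriple_add₁ h1 (hl Y hY).toIsSmoothGen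
        (((hρ Y hY).toIsSmoothGen.smul _).add ((hκ Y hY).smul _)) h2,
      courantTriple_add₁ h1 ((hρ Y hY).toIsSmoothGen.smul _) ((hκ Y hY).smul _) h2,
      courantTriple_smul₁ h1 _ (hρ Y hY).toIsSmoothGen h2, courantTriple_smul₁ h1 _ (hκ Y hY) h2,
      (hl X hX).courantTriple_of_mem₁ S.extension (hm Z hZ) (hκ Y hY) fun x ↦ vertSec_mem x]
    ring
  have e₂ : courantTriple H (liftSec p g ξ 1 X) (liftSec p g ξ 1 Y)
      (metricSplitting p g ξ Z) x
      = courantTriple H (liftSec p g ξ 1 X) (liftSec p g ξ 1 Y) (liftSec p g ξ 1 Z) x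
        - courantTriple H (liftSec p g ξ 1 X) (liftSec p g ξ 1 Y) (dualSec p h Z) x := by
    rw [S.metricSplitting_eq (X := Z) b hh, courantTriple_add₂, courantTriple_add₂,
      courantTriple_smul₂, courantTriple_smul₂,
      (hl X hX).courantTriple_of_mem₂ S.extension (hl Y hY) (vertSec_mem x)]
    ring
  have hp := S.submersion.contMDiff
  have hlp (W : VField EN N) (y : M) :
      mfderiv 𝓘(ℝ, E) 𝓘(ℝ, EN) p y (liftSec p g ξ 1 W y).1 = W (p y) := S.mfderiv_horLift _
  rw [e₀, e₁, e₂, S.courantTriple_liftSec b hh hX hY hZ,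
    courantTriple_dualSec₀ hp hX hY hZ (hρ X hX).toIsSmoothGen (hm Y hY).toIsSmoothGen
      (hm Z hZ).toIsSmoothGen S.mfderiv_metricSplitting S.mfderiv_metricSplitting,
    courantTriple_dualSec₁ hp hX hY hZ (hl X hX).toIsSmoothGen (hρ Y hY).toIsSmoothGen
      (hm Z hZ).toIsSmoothGen (hlp X) S.mfderiv_metricSplitting,
    courantTriple_dualSec₂ hp hX hY (hl X hX).toIsSmoothGen (hl Y hY).toIsSmoothGen (hlp X) (hlp Y)]
  ring

end IsReduction

end BismutConnection

section AlternatingOfTrilinear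

set_option synthInstance.maxHeartbeats 100000 in
theorem exists_continuousLinearMap_of_trilinear {V : Type*} [NormedAddCommGroup V]
    [NormedSpace ℝ V] [FiniteDimensional ℝ V] (F : V → V → V → ℝ)
    (hadd₀ : ∀ u u' v w, F (u + u') v w = F u v w + F u' v w)
    (hsmul₀ : ∀ (c : ℝ) u v w, F (c • u) v w = c * F u v w)
    (hadd₁ : ∀ u v v' w, F u (v + v') w = F u v w + F u v' w)
    (hsmul₁ : ∀ (c : ℝ) u v w, F u (c • v) w = c * F u v w)
    (hadd : ∀ u v w w', F u v (w + w') = F u v w + F u v w')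
    (hsmul : ∀ (c : ℝ) u v w, F u v (c • w) = c * F u v w) :
    ∃ T : V →L[ℝ] V →L[ℝ] V →L[ℝ] ℝ, ∀ u v w, T u v w = F u v w := by
  obtain ⟨T₂, hT₂⟩ : ∃ T₂ : V → V → V →L[ℝ] ℝ, ∀ u v w, T₂ u v w = F u v w :=
    ⟨fun u v ↦ LinearMap.toContinuousLinearMap
      { toFun := F u v, map_add' := hadd u v, map_smul' := fun c w ↦ hsmul c u v w },
      fun _ _ _ ↦ rfl⟩
  obtain ⟨T₁, hT₁⟩ : ∃ T₁ : V → V →L[ℝ] V →L[ℝ] ℝ, ∀ u v, T₁ u v = T₂ u v :=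
    ⟨fun u ↦ LinearMap.toContinuousLinearMap
      { toFun := T₂ u
        map_add' := fun v v' ↦ ContinuousLinearMap.ext fun w ↦ by
          rw [add_apply, hT₂, hT₂, hT₂, hadd₁]
        map_smul' := fun c v ↦ ContinuousLinearMap.ext fun w ↦ by
          rw [smul_apply, hT₂, hT₂, hsmul₁]; rfl },
      fun _ _ ↦ rfl⟩
  obtain ⟨T, hT⟩ : ∃ T : V →L[ℝ] V →L[ℝ] V →L[ℝ] ℝ, ∀ u, T u = T₁ u :=
    ⟨LinearMap.toContinuousLinearMap
      { toFun := T₁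
        map_add' := fun u u' ↦ ContinuousLinearMap.ext fun v ↦ ContinuousLinearMap.ext fun w ↦ by
          rw [add_apply, add_apply, hT₁, hT₁, hT₁, hT₂, hT₂, hT₂, hadd₀]
        map_smul' := fun c u ↦ ContinuousLinearMap.ext fun v ↦ ContinuousLinearMap.ext fun w ↦ by
          rw [smul_apply, smul_apply, hT₁, hT₁, hT₂, hT₂, hsmul₀]; rfl },
      fun _ ↦ rfl⟩
  exact ⟨T, fun u v w ↦ by rw [hT, hT₁, hT₂]⟩

theorem exists_continuousAlternatingMap_of_antisymm {V : Type*} [NormedAddCommGroup V]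
    [NormedSpace ℝ V] [FiniteDimensional ℝ V] (F : V → V → V → ℝ)
    (hadd : ∀ u v w w', F u v (w + w') = F u v w + F u v w')
    (hsmul : ∀ (c : ℝ) u v w, F u v (c • w) = c * F u v w)
    (h₀₁ : ∀ u v w, F v u w = - F u v w) (h₁₂ : ∀ u v w, F u w v = - F u v w) :
    ∃ σ : V [⋀^Fin 3]→L[ℝ] ℝ, ∀ u v w, σ ![u, v, w] = F u v w := by
  have hadd₁ (u v v' w) : F u (v + v') w = F u v w + F u v' w := by
    rw [h₁₂, hadd, h₁₂ u v w, h₁₂ u v' w]; ring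
  have hsmul₁ (c : ℝ) (u v w) : F u (c • v) w = c * F u v w := by
    rw [h₁₂, hsmul, h₁₂ u v w]; ring
  have hadd₀ (u u' v w) : F (u + u') v w = F u v w + F u' v w := by
    rw [h₀₁, hadd₁, h₀₁ u v w, h₀₁ u' v w]; ring
  have hsmul₀ (c : ℝ) (u v w) : F (c • u) v w = c * F u v w := by
    rw [h₀₁, hsmul₁, h₀₁ u v w]; ring
  obtain ⟨T, hTF⟩ := exists_continuousLinearMap_of_trilinear F hadd₀ hsmul₀ hadd₁ hsmul₁ hadd hsmul
  have hcont : Continuous fun m : Fin 3 → V ↦ F (m 0) (m 1) (m 2) := by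
    simp only [← hTF]
    exact ((T.continuous.comp (continuous_apply 0)).clm_apply (continuous_apply 1)).clm_apply
      (continuous_apply 2)
  have hne : (1 : Fin 3) ≠ 0 ∧ (2 : Fin 3) ≠ 0 ∧ (2 : Fin 3) ≠ 1 := by decide
  let σ₀ : MultilinearMap ℝ (fun _ : Fin 3 ↦ V) ℝ :=
    { toFun := fun m ↦ F (m 0) (m 1) (m 2)
      map_update_add' := by
        intro inst m i x y
        obtain rfl | rfl | rfl : i = 0 ∨ i = 1 ∨ i = 2 := by omega
        · simp only [Function.update_self, Function.update_of_ne hne.1,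
            Function.update_of_ne hne.2.1, hadd₀]
        · simp only [Function.update_self, Function.update_of_ne hne.1.symm,
            Function.update_of_ne hne.2.2, hadd₁]
        · simp only [Function.update_self, Function.update_of_ne hne.2.1.symm,
            Function.update_of_ne hne.2.2.symm, hadd]
      map_update_smul' := by
        intro inst m i c x
        obtain rfl | rfl | rfl : i = 0 ∨ i = 1 ∨ i = 2 := by omega
        · simp only [Function.update_self, Function.update_of_ne hne.1,
            Function.update_of_ne hne.2.1, hsmul₀, smul_eq_mul]
        · simp only [Function.update_self, Function.update_of_ne hne.1.symm,
            Function.update_of_ne hne.2.2, hsmul₁, smul_eq_mul]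
        · simp only [Function.update_self, Function.update_of_ne hne.2.1.symm,
            Function.update_of_ne hne.2.2.symm, hsmul, smul_eq_mul] }
  let σ₁ : ContinuousMultilinearMap ℝ (fun _ : Fin 3 ↦ V) ℝ := ⟨σ₀, hcont⟩
  refine ⟨⟨σ₁, ?_⟩, fun u v w ↦ rfl⟩
  intro m i j hm hij
  change F (m 0) (m 1) (m 2) = 0
  have e₁₂ (u w) : F u w w = 0 := by linarith [h₁₂ u w w]
  have k₀₁ (h : m 0 = m 1) : F (m 0) (m 1) (m 2) = 0 := by rw [h]; linarith [h₀₁ (m 1) (m 1) (m 2)]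
  have k₁₂ (h : m 1 = m 2) : F (m 0) (m 1) (m 2) = 0 := by rw [h, e₁₂]
  have k₀₂ (h : m 0 = m 2) : F (m 0) (m 1) (m 2) = 0 := by rw [h, h₀₁, e₁₂, neg_zero]
  fin_cases i <;> fin_cases j <;> first
    | exact absurd rfl hij
    | exact k₀₁ hm
    | exact k₀₁ hm.symm
    | exact k₁₂ hm
    | exact k₁₂ hm.symm
    | exact k₀₂ hm
    | exact k₀₂ hm.symm

end AlternatingOfTrilinear

section ReducedFlux

set_option linter.unusedSectionVars false

variable {E : Type*} [NormedAddCommGroup E] [NormedSpace ℝ E] [FiniteDimensional ℝ E]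
  {EG : Type*} [NormedAddCommGroup EG] [NormedSpace ℝ EG] [FiniteDimensional ℝ EG]
  {EN : Type*} [NormedAddCommGroup EN] [NormedSpace ℝ EN] [FiniteDimensional ℝ EN]
  {M : Type*} [TopologicalSpace M] [ChartedSpace E M] [IsManifold 𝓘(ℝ, E) ∞ M] [T2Space M]
  {N : Type*} [TopologicalSpace N] [ChartedSpace EN N] [IsManifold 𝓘(ℝ, EN) ∞ N] [T2Space N]
  {G : Type*} [TopologicalSpace G] [ChartedSpace EG G] [Group G] [MulAction G M]
  [CompactSpace G] [LieGroup 𝓘(ℝ, EG) ∞ G] [ContMDiffSMul 𝓘(ℝ, EG) 𝓘(ℝ, E) ∞ G M]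
  {p : M → N} {g : RMetric E M} {H : Form E M 3}
  {ξ : GroupLieAlgebra 𝓘(ℝ, EG) G →ₗ[ℝ] CovField E M} {h : RMetric EN N}
  {X Y Z : VField EN N}

attribute [local instance] isManifold_one isManifold_two

section Alternation

variable {θ : Π x : M, TangentSpace 𝓘(ℝ, E) x →L[ℝ] GroupLieAlgebra 𝓘(ℝ, EG) G} {x : M}
  (u v w w' : TangentSpace 𝓘(ℝ, E) x)

theorem covD_swap {F : Type*} [NormedAddCommGroup F] [NormedSpace ℝ F]
    (α : Π x : M, TangentSpace 𝓘(ℝ, E) x →L[ℝ] F) : covD α x v u = - covD α x u v :=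
  (neg_sub _ _).symm

theorem covD_add {F : Type*} [NormedAddCommGroup F] [NormedSpace ℝ F]
    (α : Π x : M, TangentSpace 𝓘(ℝ, E) x →L[ℝ] F) :
    covD α x u (v + w) = covD α x u v + covD α x u w := by
  let B : E →L[ℝ] E →L[ℝ] F := mvfderiv 𝓘(ℝ, E) (covRep α x) x
  have h (a b c : E) : B a (b + c) - B (b + c) a = B a b - B b a + (B a c - B c a) := by
    simp only [map_add, add_apply]
    abel
  exact h u v w

theorem covD_smul {F : Type*} [NormedAddCommGroup F] [NormedSpace ℝ F]
    (α : Π x : M, TangentSpace 𝓘(ℝ, E) x →L[ℝ] F) (c : ℝ) :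
    covD α x u (c • v) = c • covD α x u v := by
  let B : E →L[ℝ] E →L[ℝ] F := mvfderiv 𝓘(ℝ, E) (covRep α x) x
  have h (a b : E) : B a (c • b) - B (c • b) a = c • (B a b - B b a) := by
    simp only [map_smul, smul_apply, smul_sub]
  exact h u v

theorem cov_map_add (e f : GroupLieAlgebra 𝓘(ℝ, EG) G) :
    ξ (e + f) x u = ξ e x u + ξ f x u :=
  congrArg (fun l : TangentSpace 𝓘(ℝ, E) x →L[ℝ] ℝ ↦ l u) (congrFun (map_add ξ e f) x)

theorem cov_map_smul (c : ℝ) (e : GroupLieAlgebra 𝓘(ℝ, EG) G) :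
    ξ (c • e) x u = c * ξ e x u :=
  congrArg (fun l : TangentSpace 𝓘(ℝ, E) x →L[ℝ] ℝ ↦ l u) (congrFun (map_smul ξ c e) x)

theorem cov_map_neg (e : GroupLieAlgebra 𝓘(ℝ, EG) G) : ξ (-e) x u = - ξ e x u :=
  congrArg (fun l : TangentSpace 𝓘(ℝ, E) x →L[ℝ] ℝ ↦ l u) (congrFun (map_neg ξ e) x)

theorem redForm_swap₀₁ : redForm H ξ θ x v u w = - redForm H ξ θ x u v w := by
  rw [redForm, redForm, alternating_swap₀₁, covD_swap (F := EG) u v θ]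
  have h1 := cov_map_neg (ξ := ξ) w (covD (F := EG) θ x u v)
  refine (congrArg (fun t ↦ - H x ![u, v, w] + t + ξ (covD (F := EG) θ x u w) x v
    - ξ (covD (F := EG) θ x v w) x u) h1).trans ?_
  ring

theorem redForm_swap₁₂ : redForm H ξ θ x u w v = - redForm H ξ θ x u v w := by
  rw [redForm, redForm, alternating_swap₁₂, covD_swap (F := EG) v w θ]
  have h1 := cov_map_neg (ξ := ξ) u (covD (F := EG) θ x v w)
  refine (congrArg (fun t ↦ - H x ![u, v, w] + ξ (covD (F := EG) θ x u w) x v + t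
    - ξ (covD (F := EG) θ x u v) x w) h1).trans ?_
  ring

theorem redForm_add : redForm H ξ θ x u v (w + w')
    = redForm H ξ θ x u v w + redForm H ξ θ x u v w' := by
  have h1 (a b : TangentSpace 𝓘(ℝ, E) x) := (congrArg (fun e : EG ↦ ξ e x b)
    (covD_add (F := EG) a w w' θ)).trans (cov_map_add (ξ := ξ) b _ _)
  have h2 := map_add (contract₃ (H x) u v) w w'
  simp only [contract₃_apply] at h2
  simp only [redForm, map_add]
  rw [h2]
  linarith [h1 v u, h1 u v]

theorem redForm_smul (c : ℝ) : redForm H ξ θ x u v (c • w) = c * redForm H ξ θ x u v w := by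
  have h1 (a b : TangentSpace 𝓘(ℝ, E) x) := (congrArg (fun e : EG ↦ ξ e x b)
    (covD_smul (F := EG) a w θ c)).trans (cov_map_smul (ξ := ξ) b c _)
  have h2 := map_smul (contract₃ (H x) u v) c w
  simp only [contract₃_apply, smul_eq_mul] at h2
  simp only [redForm, map_smul, smul_eq_mul]
  rw [h2]
  linarith [h1 v u, h1 u v]

end Alternation

variable {ι : Type*} [Fintype ι] (b : Module.Basis ι ℝ (GroupLieAlgebra 𝓘(ℝ, EG) G))

namespace IsReduction

theorem redForm_horLift_smul (S : IsReduction EN p g H ξ) (hX : IsSmoothVField X)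
    (hY : IsSmoothVField Y) (hZ : IsSmoothVField Z) (a : G) (x : M) :
    redForm H ξ (connForm g ξ b 1) (a • x) (horLift p g ξ 1 (a • x) (X (p (a • x))))
        (horLift p g ξ 1 (a • x) (Y (p (a • x)))) (horLift p g ξ 1 (a • x) (Z (p (a • x))))
      = redForm H ξ (connForm g ξ b 1) x (horLift p g ξ 1 x (X (p x)))
          (horLift p g ξ 1 x (Y (p x))) (horLift p g ξ 1 x (Z (p x))) := by
  have key {X Y : VField EN N} (hX : IsSmoothVField X) (hY : IsSmoothVField Y) (Z : VField EN N) :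
      ξ (covD (F := EG) (connForm g ξ b 1) (a • x) (horLift p g ξ 1 (a • x) (X (p (a • x))))
        (horLift p g ξ 1 (a • x) (Y (p (a • x))))) (a • x) (horLift p g ξ 1 (a • x) (Z (p (a • x))))
      = ξ (covD (F := EG) (connForm g ξ b 1) x (horLift p g ξ 1 x (X (p x)))
        (horLift p g ξ 1 x (Y (p x)))) x (horLift p g ξ 1 x (Z (p x))) := by
    have h1 := VFieldInvariant.mlieBracket EG (S.actDeriv_horLift X) (S.actDeriv_horLift Y)
      (S.isSmoothVField_horLift (s := 1) hX) (S.isSmoothVField_horLift (s := 1) hY) a x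
    have h2 := (isConnectionForm_connForm (s := 1) b S.metric S.extension S.injective).equivariant a x
      (mlieBracket 𝓘(ℝ, E) (fun y ↦ horLift p g ξ 1 y (X (p y)))
          (fun y ↦ horLift p g ξ 1 y (Y (p y))) x)
    rw [h1] at h2
    rw [S.covD_connForm_horLift b hX hY, S.covD_connForm_horLift b hX hY, cov_map_neg, cov_map_neg,
      h2, ← S.actDeriv_horLift Z]
    exact congrArg Neg.neg (DFunLike.congr_fun (S.extension.equivariant a _ x) _)
  rw [redForm, redForm, key hX hY, key hY hZ, key hX hZ]
  congr 3
  have h3 := DFunLike.congr_fun (S.formInvariant a x) ![horLift p g ξ 1 x (X (p x)),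
    horLift p g ξ 1 x (Y (p x)), horLift p g ξ 1 x (Z (p x))]
  refine Eq.trans (congrArg (H (a • x)) ?_) h3
  rw [← S.actDeriv_horLift X, ← S.actDeriv_horLift Y, ← S.actDeriv_horLift Z]
  funext i
  fin_cases i <;> rfl

theorem redForm_horLift_eq_of_proj_eq (S : IsReduction EN p g H ξ) {x y : M} (hxy : p x = p y)
    (u v w : EN) :
    redForm H ξ (connForm g ξ b 1) x (horLift p g ξ 1 x u) (horLift p g ξ 1 x v)
        (horLift p g ξ 1 x w)
      = redForm H ξ (connForm g ξ b 1) y (horLift p g ξ 1 y u) (horLift p g ξ 1 y v)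
        (horLift p g ξ 1 y w) := by
  obtain ⟨c, rfl⟩ := S.exists_smul hxy
  obtain ⟨X, hX, hXu⟩ := exists_isSmoothVField_eq (E := EN) (M := N) (p y) u
  obtain ⟨Y, hY, hYv⟩ := exists_isSmoothVField_eq (E := EN) (M := N) (p y) v
  obtain ⟨Z, hZ, hZw⟩ := exists_isSmoothVField_eq (E := EN) (M := N) (p y) w
  have h1 := S.redForm_horLift_smul b hX hY hZ c y
  have h2 (W : VField EN N) (a : EN) (h : W (p y) = a) : (W (p (c • y)) : EN) = a := by
    rw [S.proj_smul]; exact h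
  have h3 (W : VField EN N) (a : EN) (h : W (p y) = a) (z : M) (hz : (W (p z) : EN) = a) :
      horLift p g ξ 1 z (W (p z)) = horLift p g ξ 1 z a := congrArg (horLift p g ξ 1 z) hz
  rw [h3 X u hXu _ (h2 X u hXu), h3 Y v hYv _ (h2 Y v hYv), h3 Z w hZw _ (h2 Z w hZw),
    h3 X u hXu _ hXu, h3 Y v hYv _ hYv, h3 Z w hZw _ hZw] at h1
  exact h1

theorem contMDiff_redForm_horLift (S : IsReduction EN p g H ξ) (hX : IsSmoothVField X)
    (hY : IsSmoothVField Y) (hZ : IsSmoothVField Z) : ContMDiff 𝓘(ℝ, E) 𝓘(ℝ, ℝ) ∞ fun x ↦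
      redForm H ξ (connForm g ξ b 1) x (horLift p g ξ 1 x (X (p x)))
          (horLift p g ξ 1 x (Y (p x))) (horLift p g ξ 1 x (Z (p x))) := by
  have key {X Y Z : VField EN N} (hX : IsSmoothVField X) (hY : IsSmoothVField Y)
      (hZ : IsSmoothVField Z) : ContMDiff 𝓘(ℝ, E) 𝓘(ℝ, ℝ) ∞ fun x ↦
      ξ (covD (F := EG) (connForm g ξ b 1) x (horLift p g ξ 1 x (X (p x)))
        (horLift p g ξ 1 x (Y (p x)))) x (horLift p g ξ 1 x (Z (p x))) := by
    have h1 : ContMDiff (M' := EG) 𝓘(ℝ, E) 𝓘(ℝ, EG) ∞ fun x ↦ (connForm g ξ b 1 x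
        (mlieBracket 𝓘(ℝ, E) (fun y ↦ horLift p g ξ 1 y (X (p y)))
          (fun y ↦ horLift p g ξ 1 y (Y (p y))) x) : EG) :=
      S.covSmooth_connForm (s := 1) b _ (isSmoothVField_mlieBracket
        (S.isSmoothVField_horLift hX) (S.isSmoothVField_horLift hY))
    have h2 := (isSmoothGen_combination S.extension h1).cov _
      (S.isSmoothVField_horLift (s := 1) hZ)
    refine h2.neg.congr fun x ↦ ?_
    rw [S.covD_connForm_horLift b hX hY, cov_map_neg]
  have h3 := S.formSmooth.contMDiff_apply
    (X := ![fun x ↦ horLift p g ξ 1 x (X (p x)), fun x ↦ horLift p g ξ 1 x (Y (p x)),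
      fun x ↦ horLift p g ξ 1 x (Z (p x))]) (by
        intro i
        fin_cases i
        exacts [S.isSmoothVField_horLift hX, S.isSmoothVField_horLift hY,
          S.isSmoothVField_horLift hZ])
  have h4 : ContMDiff 𝓘(ℝ, E) 𝓘(ℝ, ℝ) ∞ fun x ↦ H x ![horLift p g ξ 1 x (X (p x)),
      horLift p g ξ 1 x (Y (p x)), horLift p g ξ 1 x (Z (p x))] := by
    refine h3.congr fun x ↦ congrArg (H x) (funext fun i ↦ ?_)
    fin_cases i <;> rfl
  exact ((h4.add (key hX hY hZ)).add (key hY hZ hX)).sub (key hX hZ hY)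

theorem exists_reducedFlux (S : IsReduction EN p g H ξ) :
    ∃ Hred : Form EN N 3, FormSmooth Hred ∧ ∀ x (u v w : TangentSpace 𝓘(ℝ, EN) (p x)),
      Hred (p x) ![u, v, w] = redForm H ξ (connForm g ξ b 1) x (horLift p g ξ 1 x u)
        (horLift p g ξ 1 x v) (horLift p g ξ 1 x w) := by
  let q := Function.surjInv S.surjective
  have hq (n : N) : p (q n) = n := Function.surjInv_eq S.surjective n
  let F (n : N) (u v w : EN) : ℝ := redForm H ξ (connForm g ξ b 1) (q n)
    (horLift p g ξ 1 (q n) u) (horLift p g ξ 1 (q n) v) (horLift p g ξ 1 (q n) w)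
  have hF (n : N) : ∃ σ : EN [⋀^Fin 3]→L[ℝ] ℝ, ∀ u v w, σ ![u, v, w] = F n u v w := by
    refine exists_continuousAlternatingMap_of_antisymm (F n) (fun u v w w' ↦ ?_)
      (fun c u v w ↦ ?_) (fun u v w ↦ redForm_swap₀₁ _ _ _) (fun u v w ↦ redForm_swap₁₂ _ _ _)
    · have h1 := S.horLift_add (s := 1) (x := q n) w w'
      exact (congrArg (redForm H ξ (connForm g ξ b 1) (q n) _ _) h1).trans (redForm_add _ _ _ _)
    · have h1 := S.horLift_smul (s := 1) (x := q n) c w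
      exact (congrArg (redForm H ξ (connForm g ξ b 1) (q n) _ _) h1).trans (redForm_smul _ _ _ _)
  choose σ hσ using hF
  have hspec (x : M) (u v w : EN) : σ (p x) ![u, v, w] = redForm H ξ (connForm g ξ b 1) x
      (horLift p g ξ 1 x u) (horLift p g ξ 1 x v) (horLift p g ξ 1 x w) :=
    (hσ (p x) u v w).trans (S.redForm_horLift_eq_of_proj_eq b (hq (p x)) u v w)
  refine ⟨σ, formSmooth_of_apply fun X hX ↦ ?_, hspec⟩
  refine contMDiff_of_comp_submersion S.submersion S.surjective ?_
  refine (S.contMDiff_redForm_horLift b (hX 0) (hX 1) (hX 2)).congr fun x ↦ ?_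
  refine Eq.trans (congrArg (σ (p x)) (funext fun i ↦ ?_)) (hspec x (X 0 (p x)) (X 1 (p x)) (X 2 (p x)))
  fin_cases i <;> rfl

end IsReduction

end ReducedFlux

section KoszulConnection

set_option linter.unusedSectionVars false

variable {E : Type*} [NormedAddCommGroup E] [NormedSpace ℝ E] [FiniteDimensional ℝ E]
  {M : Type*} [TopologicalSpace M] [ChartedSpace E M] [IsManifold 𝓘(ℝ, E) ∞ M] [T2Space M]

attribute [local instance] isManifold_one isManifold_two

theorem exists_bilinear_of_pos (β : E →L[ℝ] E →L[ℝ] ℝ) (hβ : ∀ v, v ≠ 0 → 0 < β v v)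
    (T : E →L[ℝ] E →L[ℝ] E →L[ℝ] ℝ) :
    ∃ Γ : E →L[ℝ] E →L[ℝ] E, ∀ u v w, β (Γ u v) w = T u v w := by
  have hinj : Function.Injective β := by
    rw [injective_iff_map_eq_zero]
    intro v hv
    by_contra h
    have := hβ v h
    rw [hv] at this
    exact lt_irrefl _ this
  have hd : Module.finrank ℝ E = Module.finrank ℝ (E →L[ℝ] ℝ) := by
    rw [(LinearMap.toContinuousLinearMap (𝕜 := ℝ) (E := E) (F' := ℝ)).symm.finrank_eq]
    exact (Subspace.dual_finrank_eq (K := ℝ) (V := E)).symm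
  let e := (LinearEquiv.ofInjectiveOfFinrankEq (β : E →ₗ[ℝ] E →L[ℝ] ℝ) hinj
    hd).toContinuousLinearEquiv
  have he (l : E →L[ℝ] ℝ) : β (e.symm l) = l := e.apply_symm_apply l
  refine ⟨(ContinuousLinearMap.compL ℝ E (E →L[ℝ] ℝ) E (e.symm : (E →L[ℝ] ℝ) →L[ℝ] E)).comp T,
    fun u v w ↦ ?_⟩
  exact congrArg (fun l : E →L[ℝ] ℝ ↦ l w) (he (T u v))

theorem alternating_add₂ (σ : E [⋀^Fin 3]→L[ℝ] ℝ) (u v w w' : E) :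
    σ ![u, v, w + w'] = σ ![u, v, w] + σ ![u, v, w'] := by
  have hu (z : E) : Function.update ![u, v, w] 2 z = ![u, v, z] := by
    ext i
    fin_cases i <;> rfl
  have h := σ.map_update_add ![u, v, w] 2 w w'
  simpa only [hu] using h

theorem alternating_smul₂ (σ : E [⋀^Fin 3]→L[ℝ] ℝ) (c : ℝ) (u v w : E) :
    σ ![u, v, c • w] = c * σ ![u, v, w] := by
  have hu (z : E) : Function.update ![u, v, w] 2 z = ![u, v, z] := by
    ext i
    fin_cases i <;> rfl
  have h := σ.map_update_smul ![u, v, w] 2 c w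
  simpa only [hu, smul_eq_mul] using h

set_option synthInstance.maxHeartbeats 200000 in
theorem exists_bilinear_koszul (β : E →L[ℝ] E →L[ℝ] ℝ) (hβ : ∀ v, v ≠ 0 → 0 < β v v)
    (B : E →L[ℝ] E →L[ℝ] E →L[ℝ] ℝ) (σ : E [⋀^Fin 3]→L[ℝ] ℝ) :
    ∃ Γ : E →L[ℝ] E →L[ℝ] E, ∀ u v w,
      2 * β (Γ u v) w = B u v w + B v u w - B w u v + σ ![u, v, w] := by
  have hadd₁ (u v v' w) : σ ![u, v + v', w] = σ ![u, v, w] + σ ![u, v', w] := by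
    rw [alternating_swap₁₂, alternating_add₂, alternating_swap₁₂ σ u v w,
      alternating_swap₁₂ σ u v' w]; ring
  have hsmul₁ (c : ℝ) (u v w) : σ ![u, c • v, w] = c * σ ![u, v, w] := by
    rw [alternating_swap₁₂, alternating_smul₂, alternating_swap₁₂ σ u v w]; ring
  have hadd₀ (u u' v w) : σ ![u + u', v, w] = σ ![u, v, w] + σ ![u', v, w] := by
    rw [alternating_swap₀₁, hadd₁, alternating_swap₀₁ σ u v w, alternating_swap₀₁ σ u' v w]; ring
  have hsmul₀ (c : ℝ) (u v w) : σ ![c • u, v, w] = c * σ ![u, v, w] := by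
    rw [alternating_swap₀₁, hsmul₁, alternating_swap₀₁ σ u v w]; ring
  obtain ⟨F, hF⟩ : ∃ F : E → E → E → ℝ, ∀ u v w, B u v w = F u v w := ⟨_, fun _ _ _ ↦ rfl⟩
  have a₀ (u u' v w) : F (u + u') v w = F u v w + F u' v w := by
    rw [← hF, ← hF, ← hF, map_add]; rfl
  have s₀ (c : ℝ) (u v w) : F (c • u) v w = c * F u v w := by
    rw [← hF, ← hF, map_smul]; rfl
  have a₁ (u v v' w) : F u (v + v') w = F u v w + F u v' w := by
    rw [← hF, ← hF, ← hF, map_add]; rfl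
  have s₁ (c : ℝ) (u v w) : F u (c • v) w = c * F u v w := by
    rw [← hF, ← hF, map_smul]; rfl
  have a₂ (u v w w') : F u v (w + w') = F u v w + F u v w' := by
    rw [← hF, ← hF, ← hF, map_add]
  have s₂ (c : ℝ) (u v w) : F u v (c • w) = c * F u v w := by
    rw [← hF, ← hF, map_smul]; rfl
  obtain ⟨T, hT⟩ := exists_continuousLinearMap_of_trilinear
    (fun u v w : E ↦ (F u v w + F v u w - F w u v + σ ![u, v, w]) / 2)
    (fun u u' v w ↦ by simp only [a₀, a₁, hadd₀]; ring)
    (fun c u v w ↦ by simp only [s₀, s₁, hsmul₀]; ring)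
    (fun u v v' w ↦ by simp only [a₀, a₁, a₂, hadd₁]; ring)
    (fun c u v w ↦ by simp only [s₀, s₁, s₂, hsmul₁]; ring)
    (fun u v w w' ↦ by simp only [a₀, a₂, alternating_add₂]; ring)
    (fun c u v w ↦ by simp only [s₀, s₂, alternating_smul₂]; ring)
  obtain ⟨Γ, hΓ⟩ := exists_bilinear_of_pos β hβ T
  exact ⟨Γ, fun u v w ↦ by rw [hΓ, hT, hF, hF, hF]; ring⟩

/-- The components of a metric in a chart. -/
def metricRep (h : RMetric E M) (x₀ x : M) : E →L[ℝ] E →L[ℝ] ℝ :=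
  let B : E →L[ℝ] E →L[ℝ] ℝ := h.inner x
  B.bilinearComp (chartPull x₀ x) (chartPull x₀ x)

theorem metricRep_chartPush (h : RMetric E M) {x₀ x : M} (hx : x ∈ (chartAt E x₀).source)
    (u v : TangentSpace 𝓘(ℝ, E) x) :
    metricRep h x₀ x (chartPush x₀ x u) (chartPush x₀ x v) = h.inner x u v := by
  change h.inner x (chartPull x₀ x (chartPush x₀ x u)) (chartPull x₀ x (chartPush x₀ x v)) = _
  rw [chartPull_chartPush hx, chartPull_chartPush hx]

theorem metricRep_self (h : RMetric E M) (x : M) (u v : TangentSpace 𝓘(ℝ, E) x) :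
    metricRep h x x u v = h.inner x u v := by
  change h.inner x (chartPull x x u) (chartPull x x v) = _
  rw [chartPull_self (E := E) x u, chartPull_self (E := E) x v]

theorem contMDiffAt_metricRep (h : RMetric E M) (x : M) :
    ContMDiffAt 𝓘(ℝ, E) 𝓘(ℝ, E →L[ℝ] E →L[ℝ] ℝ) ∞ (metricRep h x) x := by
  refine contMDiffAt_clm_of_apply fun v ↦ contMDiffAt_clm_of_apply fun w ↦ ?_
  obtain ⟨V, hV, hVx⟩ := exists_isSmoothVField_eq_chartPull (mem_chart_source E x) v
  obtain ⟨W, hW, hWx⟩ := exists_isSmoothVField_eq_chartPull (mem_chart_source E x) w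
  refine (contMDiff_inner_apply h hV hW x).congr_of_eventuallyEq ?_
  filter_upwards [hVx, hWx] with z h1 h2
  rw [h1, h2]
  rfl

theorem mvfderiv_inner_apply (h : RMetric E M) {X Y : VField E M} (hX : IsSmoothVField X)
    (hY : IsSmoothVField Y) (x : M) (u : TangentSpace 𝓘(ℝ, E) x) :
    mvfderiv 𝓘(ℝ, E) (fun z ↦ h.inner z (X z) (Y z)) x u
      = mvfderiv 𝓘(ℝ, E) (metricRep h x) x u (X x) (Y x)
        + h.inner x (mvfderiv 𝓘(ℝ, E) (fun z ↦ chartPush x z (X z)) x u) (Y x)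
        + h.inner x (X x) (mvfderiv 𝓘(ℝ, E) (fun z ↦ chartPush x z (Y z)) x u) := by
  have hx := mem_chart_source E x
  have hX' := (hX.contMDiffAt_push hx).mdifferentiableAt (by simp)
  have hY' := (hY.contMDiffAt_push hx).mdifferentiableAt (by simp)
  have hB := (contMDiffAt_metricRep h x).mdifferentiableAt (by simp)
  have e1 : (fun z ↦ h.inner z (X z) (Y z)) =ᶠ[𝓝 x]
      fun z ↦ metricRep h x z (chartPush x z (X z)) (chartPush x z (Y z)) := by
    filter_upwards [(chartAt E x).open_source.mem_nhds hx] with z hz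
    exact (metricRep_chartPush h hz _ _).symm
  have e2 := mvfderiv_clm_apply (hB.clm_apply hX') hY' u
  have e3 := mvfderiv_clm_apply hB hX' u
  rw [mvfderiv_congr e1, e2, e3, add_apply]
  have p1 : chartPush x x (X x) = X x := chartPush_self x _
  have p2 : chartPush x x (Y x) = Y x := chartPush_self x _
  rw [p1, p2]
  have p3 (v w : E) : metricRep h x x v w = h.inner x v w := metricRep_self h x v w
  exact congrArg₂ (· + ·) (congrArg (_ + ·) (p3 _ _)) (p3 _ _)

theorem exists_affineConnection_koszul (h : RMetric E M) (σ : Form E M 3) :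
    ∃ D : AffineConnection E M, ∀ X Y Z : VField E M, IsSmoothVField X → IsSmoothVField Y →
      IsSmoothVField Z → ∀ x, 2 * h.inner x (D Y x (X x)) (Z x)
        = h.inner x (Z x) (mlieBracket 𝓘(ℝ, E) X Y x)
          - h.inner x (X x) (mlieBracket 𝓘(ℝ, E) Y Z x)
          - h.inner x (Y x) (mlieBracket 𝓘(ℝ, E) X Z x)
          + mvfderiv 𝓘(ℝ, E) (fun z ↦ h.inner z (Y z) (Z z)) x (X x)
          + mvfderiv 𝓘(ℝ, E) (fun z ↦ h.inner z (X z) (Z z)) x (Y x)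
          - mvfderiv 𝓘(ℝ, E) (fun z ↦ h.inner z (X z) (Y z)) x (Z x)
          + σ x ![X x, Y x, Z x] := by
  have : CompleteSpace E := FiniteDimensional.complete ℝ E
  have hΓ (x : M) : ∃ Γ : E →L[ℝ] E →L[ℝ] E, ∀ u v w : TangentSpace 𝓘(ℝ, E) x,
      2 * h.inner x (Γ u v) w = mvfderiv 𝓘(ℝ, E) (metricRep h x) x u v w
        + mvfderiv 𝓘(ℝ, E) (metricRep h x) x v u w - mvfderiv 𝓘(ℝ, E) (metricRep h x) x w u v
        + σ x ![u, v, w] := by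
    exact exists_bilinear_koszul (E := E) (h.inner x) (h.pos x)
      (mvfderiv 𝓘(ℝ, E) (metricRep h x) x) (σ x)
  choose Γ hΓ using hΓ
  let A (Y : VField E M) (x : M) : E →L[ℝ] E := mvfderiv 𝓘(ℝ, E) (fun z ↦ chartPush x z (Y z)) x
  let D : (Π x : M, TangentSpace 𝓘(ℝ, E) x) →
      (Π x : M, TangentSpace 𝓘(ℝ, E) x →L[ℝ] TangentSpace 𝓘(ℝ, E) x) := fun Y x ↦
    A Y x + (Γ x).flip (Y x : E)
  have hD (Y : VField E M) (x : M) (u : TangentSpace 𝓘(ℝ, E) x) :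
      D Y x u = mvfderiv 𝓘(ℝ, E) (fun z ↦ chartPush x z (Y z)) x u + Γ x u (Y x) := rfl
  refine ⟨⟨D, ?_, ?_⟩, ?_⟩
  · intro Y Y' x hY hY' _
    have h1 := (mdifferentiableAt_vfield_iff (mem_chart_source E x)).1 hY
    have h2 := (mdifferentiableAt_vfield_iff (mem_chart_source E x)).1 hY'
    refine ContinuousLinearMap.ext fun u ↦ ?_
    have h3 := DFunLike.congr_fun (mvfderiv_add h1 h2) u
    have h4 : (fun z ↦ chartPush x z ((Y + Y') z))
        = (fun z ↦ chartPush x z (Y z)) + fun z ↦ chartPush x z (Y' z) :=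
      funext fun z ↦ map_add _ _ _
    have h5 : Γ x u ((Y + Y') x) = Γ x u (Y x) + Γ x u (Y' x) := map_add (Γ x u) _ _
    refine (congrArg₂ (fun a b : E ↦ a + b) ((congrArg (fun f : M → E ↦ mvfderiv 𝓘(ℝ, E) f x u)
      h4).trans h3) h5).trans ?_
    exact add_add_add_comm (G := E) _ _ _ _
  · intro Y f x hY hf _
    have h1 := (mdifferentiableAt_vfield_iff (mem_chart_source E x)).1 hY
    refine ContinuousLinearMap.ext fun u ↦ ?_
    have h3 := DFunLike.congr_fun (mvfderiv_smul hf h1) u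
    have h4 : (fun z ↦ chartPush x z ((f • Y) z)) = f • fun z ↦ chartPush x z (Y z) :=
      funext fun z ↦ map_smul (chartPush x z) _ _
    have h5 : Γ x u ((f • Y) x) = f x • Γ x u (Y x) := map_smul (Γ x u) _ _
    have h6 : chartPush x x (Y x) = Y x := chartPush_self x _
    refine (congrArg₂ (fun a b : E ↦ a + b) ((congrArg (fun f : M → E ↦ mvfderiv 𝓘(ℝ, E) f x u)
      h4).trans h3) h5).trans ?_
    have h7 (c : ℝ) (a b d e : E) (l : E →L[ℝ] ℝ) (hb : b = e) :
        (c • a + l u • b) + c • d = c • (a + d) + l u • e := by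
      rw [hb, smul_add]; abel
    exact h7 (f x) _ _ _ _ (mvfderiv 𝓘(ℝ, E) f x) h6
  · intro X Y Z hX hY hZ x
    have hx := mem_chart_source E x
    have dX := (hX.contMDiffAt_push hx).mdifferentiableAt (by simp)
    have dY := (hY.contMDiffAt_push hx).mdifferentiableAt (by simp)
    have dZ := (hZ.contMDiffAt_push hx).mdifferentiableAt (by simp)
    have key {V W : VField E M} (dV : MDifferentiableAt 𝓘(ℝ, E) 𝓘(ℝ, E)
        (fun z ↦ chartPush x z (V z)) x) (dW : MDifferentiableAt 𝓘(ℝ, E) 𝓘(ℝ, E)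
        (fun z ↦ chartPush x z (W z)) x) (u : TangentSpace 𝓘(ℝ, E) x) :
        h.inner x u (mlieBracket 𝓘(ℝ, E) V W x)
          = h.inner x u (mvfderiv 𝓘(ℝ, E) (fun z ↦ chartPush x z (W z)) x (V x))
            - h.inner x u (mvfderiv 𝓘(ℝ, E) (fun z ↦ chartPush x z (V z)) x (W x)) := by
      rw [mlieBracket_eq dV dW]
      exact map_sub (h.inner x u) _ _
    rw [key dX dY, key dY dZ, key dX dZ,
      mvfderiv_inner_apply h hY hZ, mvfderiv_inner_apply h hX hZ, mvfderiv_inner_apply h hX hY]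
    have h1 := hΓ x (X x) (Y x) (Z x)
    have h2 : h.inner x (D Y x (X x)) (Z x)
      = h.inner x (mvfderiv 𝓘(ℝ, E) (fun z ↦ chartPush x z (Y z)) x (X x)) (Z x)
        + h.inner x (Γ x (X x) (Y x)) (Z x) := by
      have h3 := map_add (h.inner x) (mvfderiv 𝓘(ℝ, E) (fun z ↦ chartPush x z (Y z)) x (X x))
        (Γ x (X x) (Y x))
      exact congrArg (fun l : TangentSpace 𝓘(ℝ, E) x →L[ℝ] ℝ ↦ l (Z x)) h3
    refine (congrArg (2 * ·) h2).trans ?_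
    have s1 := h.symm x (mvfderiv 𝓘(ℝ, E) (fun z ↦ chartPush x z (Y z)) x (X x)) (Z x)
    have s2 := h.symm x (mvfderiv 𝓘(ℝ, E) (fun z ↦ chartPush x z (X z)) x (Y x)) (Z x)
    have s3 := h.symm x (mvfderiv 𝓘(ℝ, E) (fun z ↦ chartPush x z (X z)) x (Z x)) (Y x)
    linarith

end KoszulConnection

section ReducedGeometry

set_option linter.unusedSectionVars false

variable {E : Type*} [NormedAddCommGroup E] [NormedSpace ℝ E] [FiniteDimensional ℝ E]
  {EG : Type*} [NormedAddCommGroup EG] [NormedSpace ℝ EG] [FiniteDimensional ℝ EG]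
  {EN : Type*} [NormedAddCommGroup EN] [NormedSpace ℝ EN] [FiniteDimensional ℝ EN]
  {M : Type*} [TopologicalSpace M] [ChartedSpace E M] [IsManifold 𝓘(ℝ, E) ∞ M] [T2Space M]
  {N : Type*} [TopologicalSpace N] [ChartedSpace EN N] [IsManifold 𝓘(ℝ, EN) ∞ N] [T2Space N]
  {G : Type*} [TopologicalSpace G] [ChartedSpace EG G] [Group G] [MulAction G M]
  [CompactSpace G] [LieGroup 𝓘(ℝ, EG) ∞ G] [ContMDiffSMul 𝓘(ℝ, EG) 𝓘(ℝ, E) ∞ G M]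
  {p : M → N} {g : RMetric E M} {H : Form E M 3}
  {ξ : GroupLieAlgebra 𝓘(ℝ, EG) G →ₗ[ℝ] CovField E M} {h : RMetric EN N}
  {ι : Type*} [Fintype ι] (b : Module.Basis ι ℝ (GroupLieAlgebra 𝓘(ℝ, EG) G))

attribute [local instance] isManifold_one isManifold_two

theorem covD_clm_comp {F F' : Type*} [NormedAddCommGroup F] [NormedSpace ℝ F]
    [FiniteDimensional ℝ F] [NormedAddCommGroup F'] [NormedSpace ℝ F'] (L : F →L[ℝ] F')
    {α : Π x : M, TangentSpace 𝓘(ℝ, E) x →L[ℝ] F} (hα : CovSmooth α) (x : M)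
    (u v : TangentSpace 𝓘(ℝ, E) x) :
    covD (fun y ↦ L.comp (α y)) x u v = L (covD α x u v) := by
  have hd := (hα.contMDiffAt_covRep (mem_chart_source E x)).mdifferentiableAt (by simp)
  have key (u v : E) : mvfderiv 𝓘(ℝ, E) (covRep (fun y ↦ L.comp (α y)) x) x u v
      = L (mvfderiv 𝓘(ℝ, E) (covRep α x) x u v) := by
    have h1 := mvfderiv_clm_apply (E := E) (M := M)
      (a := fun _ : M ↦ ContinuousLinearMap.compL ℝ E F F' L) (u := covRep α x) (x := x)
      mdifferentiableAt_const hd u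
    rw [mvfderiv_const] at h1
    refine (congrArg (fun l : E →L[ℝ] F' ↦ l v) (h1.trans (zero_add _))).trans ?_
    rfl
  refine (congrArg₂ (· - ·) (key u v) (key v u)).trans ?_
  exact (map_sub L _ _).symm

namespace IsReduction

theorem curvature_connForm (S : IsReduction EN p g H ξ) (a : ι) {x : M}
    {u v : TangentSpace 𝓘(ℝ, E) x} (hu : u ∈ tau g ξ 1 x) (hv : v ∈ tau g ξ 1 x) :
    curvature b (connForm g ξ b 1) a x u v
      = b.coord a (covD (F := EG) (connForm g ξ b 1) x u v) := by
  have hs : CovSmooth (E := E) (fun y ↦ (coordCLM b a).comp (connForm g ξ b 1 y)) := fun X hX ↦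
    (LinearMap.toContinuousLinearMap (𝕜 := ℝ) (E := EG) (F' := ℝ) (b.coord a)).contMDiff.comp
      (S.covSmooth_connForm (s := 1) b X hX)
  have h1 (w : TangentSpace 𝓘(ℝ, E) x) (hw : w ∈ tau g ξ 1 x) :
      w - fundMap x (connForm g ξ b 1 x w) = w := by
    rw [(connForm_eq_zero_iff b S.extension (S.injective x)).2 hw, map_zero, sub_zero]
  rw [curvature, h1 u hu, h1 v hv, formD_covToForm hs]
  exact covD_clm_comp (F := EG) (LinearMap.toContinuousLinearMap (𝕜 := ℝ) (E := EG) (F' := ℝ)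
    (b.coord a)) (S.covSmooth_connForm (s := 1) b) x u v

theorem redForm_eq_sum_wedge (S : IsReduction EN p g H ξ) {x : M}
    {u v w : TangentSpace 𝓘(ℝ, E) x} (hu : u ∈ tau g ξ 1 x) (hv : v ∈ tau g ξ 1 x)
    (hw : w ∈ tau g ξ 1 x) :
    redForm H ξ (connForm g ξ b 1) x u v w = H x ![u, v, w]
      + ∑ a, wedge₂₁ (curvature b (connForm g ξ b 1) a x) (ξ (b a) x) u v w := by
  have h1 (φ : GroupLieAlgebra 𝓘(ℝ, EG) G) (z : TangentSpace 𝓘(ℝ, E) x) :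
      ξ φ x z = ∑ a, b.coord a φ * ξ (b a) x z := by
    let l : GroupLieAlgebra 𝓘(ℝ, EG) G →ₗ[ℝ] ℝ :=
      { toFun e := ξ e x z
        map_add' e f := cov_map_add z e f
        map_smul' c e := cov_map_smul z c e }
    have h2 := congrArg l (b.sum_repr φ)
    rw [map_sum] at h2
    refine h2.symm.trans (Finset.sum_congr rfl fun a _ ↦ ?_)
    exact map_smul l _ _
  simp only [wedge₂₁, S.curvature_connForm b _ hu hv, S.curvature_connForm b _ hv hw,
    S.curvature_connForm b _ hu hw, Finset.sum_add_distrib, Finset.sum_sub_distrib]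
  have e₁ := h1 (covD (F := EG) (connForm g ξ b 1) x u v) w
  have e₂ := h1 (covD (F := EG) (connForm g ξ b 1) x v w) u
  have e₃ := h1 (covD (F := EG) (connForm g ξ b 1) x u w) v
  rw [redForm]
  linarith

theorem isReducedMetric (S : IsReduction EN p g H ξ)
    (hh : ∀ x, ∀ a b : TangentSpace 𝓘(ℝ, EN) (p x),
      h.inner (p x) a b = g.inner x (horLift p g ξ 1 x a) (horLift p g ξ 1 x b)) :
    IsReducedMetric p g ξ h := by
  rintro s (rfl | rfl) x u hu v hv
  · rw [hh, S.horLift_mfderiv hu, S.horLift_mfderiv hv]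
  · rw [hh, ← S.inner_horLift_neg, S.horLift_mfderiv hu, S.horLift_mfderiv hv]

theorem isMetricConnection (S : IsReduction EN p g H ξ)
    (hh : ∀ x, ∀ a b : TangentSpace 𝓘(ℝ, EN) (p x),
      h.inner (p x) a b = g.inner x (horLift p g ξ 1 x a) (horLift p g ξ 1 x b))
    {D : AffineConnection EN N} (hD : IsReducedPlusBismut p g H ξ D) :
    IsMetricConnection h D := by
  intro Y Z hY hZ n a
  obtain ⟨x, rfl⟩ := S.surjective n
  obtain ⟨X, hX, rfl⟩ := exists_isSmoothVField_eq (E := EN) (M := N) (p x) a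
  rw [S.isReducedPlusBismut_iff hh] at hD
  have h1 := courantTriple_add_swap₁₂ (H := H)
    (S.isBasicGen_liftSec hX (s := -1) (.inr rfl)).toIsSmoothGen
    (S.isBasicGen_liftSec hY (s := 1) (.inl rfl)).toIsSmoothGen
    (S.isBasicGen_liftSec hZ (s := 1) (.inl rfl)).toIsSmoothGen x
  have h2 : (fun y ↦ pairing (liftSec p g ξ 1 Y y) (liftSec p g ξ 1 Z y))
      = (fun y ↦ h.inner (p y) (Y (p y)) (Z (p y))) + fun y ↦ h.inner (p y) (Y (p y)) (Z (p y)) :=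
    funext fun y ↦ (pairing_genLift_self hh _ _).trans (two_mul _)
  have h3 : MDifferentiableAt 𝓘(ℝ, E) 𝓘(ℝ, ℝ) (fun y ↦ h.inner (p y) (Y (p y)) (Z (p y))) x :=
    (((contMDiff_inner_apply h hY hZ).comp S.submersion.contMDiff) x).mdifferentiableAt (by simp)
  rw [hD X Y Z hX hY hZ, hD X Z Y hX hZ hY, h2, mvfderiv_add h3 h3, add_apply,
    mvfderiv_inner_comp S.submersion.contMDiff hY hZ, liftSec_fst, S.mfderiv_horLift,
    h.symm _ _ (Y (p x))] at h1
  linarith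

theorem reducedFlux_eq_torsion (S : IsReduction EN p g H ξ)
    (hh : ∀ x, ∀ a b : TangentSpace 𝓘(ℝ, EN) (p x),
      h.inner (p x) a b = g.inner x (horLift p g ξ 1 x a) (horLift p g ξ 1 x b))
    {D : AffineConnection EN N} (hD : IsReducedPlusBismut p g H ξ D) (x : M)
    (u v w : TangentSpace 𝓘(ℝ, EN) (p x)) :
    redForm H ξ (connForm g ξ b 1) x (horLift p g ξ 1 x u) (horLift p g ξ 1 x v)
        (horLift p g ξ 1 x w) = h.inner (p x) (D.torsion (p x) u v) w := by
  obtain ⟨X, hX, rfl⟩ := exists_isSmoothVField_eq (E := EN) (M := N) (p x) u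
  obtain ⟨Y, hY, rfl⟩ := exists_isSmoothVField_eq (E := EN) (M := N) (p x) v
  obtain ⟨Z, hZ, rfl⟩ := exists_isSmoothVField_eq (E := EN) (M := N) (p x) w
  rw [S.isReducedPlusBismut_iff hh] at hD
  have h1 := S.courantTriple_liftSec_neg b hh hX hY hZ x
  have h2 := S.courantTriple_liftSec_neg b hh hY hX hZ x
  have h3 : (fun n ↦ h.inner n (Y n) (X n)) = fun n ↦ h.inner n (X n) (Y n) :=
    funext fun n ↦ h.symm n _ _
  rw [hD X Y Z hX hY hZ] at h1
  rw [hD Y X Z hY hX hZ, redForm_swap₀₁, h3, mlieBracket_swap_apply (V := Y) (W := X), map_neg] at h2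
  have : CompleteSpace EN := FiniteDimensional.complete ℝ EN
  rw [D.torsion_apply ((hX _).mdifferentiableAt (by simp)) ((hY _).mdifferentiableAt (by simp)),
    h.symm, map_sub, map_sub, h.symm _ _ (D Y (p x) _), h.symm _ _ (D X (p x) _)]
  linarith

theorem exists_isReducedPlusBismut (S : IsReduction EN p g H ξ)
    (hh : ∀ x, ∀ a b : TangentSpace 𝓘(ℝ, EN) (p x),
      h.inner (p x) a b = g.inner x (horLift p g ξ 1 x a) (horLift p g ξ 1 x b)) :
    ∃ D : AffineConnection EN N, IsReducedPlusBismut p g H ξ D := by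
  let b : Module.Basis _ ℝ (GroupLieAlgebra 𝓘(ℝ, EG) G) := Module.finBasis ℝ EG
  obtain ⟨Hred, -, hHred⟩ := S.exists_reducedFlux b
  obtain ⟨D, hD⟩ := exists_affineConnection_koszul h Hred
  refine ⟨D, (S.isReducedPlusBismut_iff hh).2 fun X Y Z hX hY hZ x ↦ ?_⟩
  rw [S.courantTriple_liftSec_neg b hh hX hY hZ, hD X Y Z hX hY hZ, hHred]

end IsReduction

end ReducedGeometry

end CourantReduction

end

open CourantReduction in
theorem mainTheorem4
    {E EG EN : Type*}
    [NormedAddCommGroup E] [NormedSpace ℝ E] [FiniteDimensional ℝ E]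
    [NormedAddCommGroup EG] [NormedSpace ℝ EG] [FiniteDimensional ℝ EG]
    [NormedAddCommGroup EN] [NormedSpace ℝ EN] [FiniteDimensional ℝ EN]
    {M : Type*} [TopologicalSpace M] [T2Space M] [SecondCountableTopology M]
    [ChartedSpace E M] [IsManifold 𝓘(ℝ, E) ∞ M]
    {G : Type*} [TopologicalSpace G] [T2Space G] [CompactSpace G] [ConnectedSpace G]
    [ChartedSpace EG G] [Group G] [LieGroup 𝓘(ℝ, EG) ∞ G]
    [MulAction G M] [ContMDiffSMul 𝓘(ℝ, EG) 𝓘(ℝ, E) ∞ G M]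
    (hfree : ∀ (a : G) (x : M), a • x = x → a = 1)
    -- the quotient manifold `M/G`: the manifold structure on the orbit space for which the
    -- projection is a submersion
    [ChartedSpace EN (MulAction.orbitRel.Quotient G M)]
    [IsManifold 𝓘(ℝ, EN) ∞ (MulAction.orbitRel.Quotient G M)]
    (hsub : IsSubmersion 𝓘(ℝ, E) 𝓘(ℝ, EN) ∞ (orbitProj G M))
    -- the generalized Riemannian structure and the extended action
    (g : RMetric E M) (hg : MetricInvariant G g)
    (H : Form E M 3) (hHsmooth : FormSmooth H) (hH : FormInvariant G H)
    (ξ : GroupLieAlgebra 𝓘(ℝ, EG) G →ₗ[ℝ] CovField E M)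
    (hξ : IsClosedEquivariantExtension H ξ)
    {ι : Type*} [Fintype ι] (b : Module.Basis ι ℝ (GroupLieAlgebra 𝓘(ℝ, EG) G)) :
    -- the distributions `τ_±` model `T(M/G)`
    (∀ s : ℝ, s = 1 ∨ s = -1 → ∀ x,
      BijOn (mfderiv 𝓘(ℝ, E) 𝓘(ℝ, EN) (orbitProj G M) x) (tau g ξ s x) univ) ∧
    ∃ (θ : Π x : M, TangentSpace 𝓘(ℝ, E) x →L[ℝ] GroupLieAlgebra 𝓘(ℝ, EG) G)
      (h : RMetric EN (MulAction.orbitRel.Quotient G M)),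
      IsConnectionForm (tau g ξ 1) θ ∧ IsReducedMetric (orbitProj G M) g ξ h ∧
      (∃ D : AffineConnection EN (MulAction.orbitRel.Quotient G M),
        IsReducedPlusBismut (orbitProj G M) g H ξ D) ∧
      ∀ D : AffineConnection EN (MulAction.orbitRel.Quotient G M),
        IsReducedPlusBismut (orbitProj G M) g H ξ D →
        IsMetricConnection h D ∧
        ∃ Hred : Form EN (MulAction.orbitRel.Quotient G M) 3, FormSmooth Hred ∧
          -- `Hred` is the torsion of the reduced `+`-Bismut connection
          (∀ n (u v w : TangentSpace 𝓘(ℝ, EN) n),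
            Hred n ![u, v, w] = h.inner n (D.torsion n u v) w) ∧
          -- `Hred` is the curvature of the metric splitting of the reduced Courant algebroid
          (∀ X Y Z : VField EN (MulAction.orbitRel.Quotient G M),
            IsSmoothVField X → IsSmoothVField Y → IsSmoothVField Z → ∀ x : M,
              Hred (orbitProj G M x)
                  ![X (orbitProj G M x), Y (orbitProj G M x), Z (orbitProj G M x)] =
                pairing
                  (courantBracket H (metricSplitting (orbitProj G M) g ξ X)
                    (metricSplitting (orbitProj G M) g ξ Y) x)
                  (metricSplitting (orbitProj G M) g ξ Z x)) ∧
          -- `Hred = (H + Ω_+^a ∧ ξ_a)|_{τ_+}`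
          ∀ x, ∀ u ∈ tau g ξ 1 x, ∀ v ∈ tau g ξ 1 x, ∀ w ∈ tau g ξ 1 x,
            Hred (orbitProj G M x)
                ![mfderiv 𝓘(ℝ, E) 𝓘(ℝ, EN) (orbitProj G M) x u,
                  mfderiv 𝓘(ℝ, E) 𝓘(ℝ, EN) (orbitProj G M) x v,
                  mfderiv 𝓘(ℝ, E) 𝓘(ℝ, EN) (orbitProj G M) x w] =
              H x ![u, v, w] + ∑ a, wedge₂₁ (curvature b θ a x) (ξ (b a) x) u v w := by
  have : ContinuousSMul G M := ContMDiffSMul.continuousSMul (I := 𝓘(ℝ, EG)) (I' := 𝓘(ℝ, E)) ∞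
  have : T2Space (MulAction.orbitRel.Quotient G M) := t2Space_orbitRel_quotient
  have S : IsReduction EN (orbitProj G M) g H ξ :=
    { free := hfree
      submersion := hsub
      surjective := Quotient.mk_surjective
      proj_smul := fun a x ↦ orbitProj_smul a x
      exists_smul := fun h ↦ Quotient.exact h
      metric := hg
      formSmooth := hHsmooth
      formInvariant := hH
      extension := hξ }
  refine ⟨fun s _ x ↦ S.bijOn s x, connForm g ξ b 1, ?_⟩
  obtain ⟨h, hh⟩ := S.exists_reducedMetric
  refine ⟨h, isConnectionForm_connForm b hg hξ S.injective, S.isReducedMetric hh,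
    S.exists_isReducedPlusBismut hh, fun D hD ↦ ⟨S.isMetricConnection hh hD, ?_⟩⟩
  obtain ⟨Hred, hs, hHred⟩ := S.exists_reducedFlux b
  refine ⟨Hred, hs, fun n u v w ↦ ?_, fun X Y Z hX hY hZ x ↦ ?_, fun x u hu v hv w hw ↦ ?_⟩
  · obtain ⟨x, rfl⟩ := S.surjective n
    rw [hHred, S.reducedFlux_eq_torsion b hh hD]
  · rw [hHred]
    exact (S.courantTriple_metricSplitting b hh hX hY hZ x).symm
  · rw [hHred, S.horLift_mfderiv hu, S.horLift_mfderiv hv, S.horLift_mfderiv hw,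
      S.redForm_eq_sum_wedge b hu hv hw]
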